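/- **Setting.** Let $\Xi=[-1,1]$ and let $\mathscr M(\Xi)$ be the set of finite nonnegative Borel measures on $\Xi$ with weak-* convergence (duality with continuous functions). Let $H\in C^\infty(\mathbb R)$ be even with $H(0)=1$, $H(\pm1)=0$, $0<H\le 1$ on $(-1,1)$, $H''(0)<0<H''(1)$. Put $k=\frac1\pi\sqrt{|H''(0)|H''(1)}$, $\kappa=1/k$ and, for $\varepsilon>0$, $$g_\varepsilon=Z_\varepsilon^{-1}e^{-H/\varepsilon},\quad Z_\varepsilon=\int_{-1}^1e^{-H/\varepsilon}\,d\xi,\quad \gamma_\varepsilon=g_\varepsilon\,\mathscr L^1|_{\Xi},\quad \tau_\varepsilon=\frac1{2\kappa}\int_{-1}^1\frac{d\xi}{g_\varepsilon(\xi)},\quad \gamma_0=\tfrac12\delta_{-1}+\tfrac12\delta_1 .$$ *Energies.* For $\varepsilon\ge0$ and $\rho\in\mathscr M(\Xi)$ let $\mathcal E_\varepsilon(\rho)=\int_\Xi u\log u\,d\gamma_\varepsilon-\rho(\Xi)\log\rho(\Xi)$ with $u=d\rho/d\gamma_\varepsilon$ if $\rho\ll\gamma_\varepsilon$, and $\mathcal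 E_\varepsilon(\rho)=+\infty$ otherwise ($0\log 0=0$). Thus $\mathcal E_0(\rho)=\frac12(u^+\log u^++u^-\log u^-)-\rho(\Xi)\log\rho(\Xi)$ if $\rho=\frac12u^-\delta_{-1}+\frac12u^+\delta_1$. *Dissipation.* Let $T>0$. For a curve $\rho:[0,T]\to\mathscr M(\Xi)$ and $\varepsilon>0$ let $$\mathcal J_\varepsilon(\rho)=\int_0^T\Big(\frac1{2\tau_\varepsilon}\int_\Xi v^2\,d\rho(t)+2\tau_\varepsilon\int_\Xi\big|\partial_\xi\sqrt u\big|^2\,d\gamma_\varepsilon\Big)dt,\qquad u=\frac{d\rho(t)}{d\gamma_\varepsilon},$$ if $\rho$ is weakly-* continuous and there is a Borel field $v:(0,T)\times\Xi\to\mathbb R$ with $\int_0^T\!\int_\Xi|v|\,d\rho(t)\,dt<\infty$ and $\partial_t\rho+\partial_\xi(\rho v)=0$ in $\mathscr D'((0,T)\times\mathbb R)$ ($\rho$ extended by $0$ outside $\Xi$; then $\rho v$ is unique); $\mathcal J_\varepsilon(\rho)=+\infty$ otherwise. The inner integral $\int|\partial_\xi\sqrt u|^2d\gamma_\varepsilon$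 is $+\infty$ unless $\rho(t)\ll\gamma_\varepsilon$ and $\sqrt u\in W^{1,2}(-1,1)$. *Limit dissipation.* For $w\in\mathbb R$, $u^\pm\ge0$ let $$M(w,u^\pm)=\inf\Big\{\int_{-\kappa}^{\kappa}\frac{w^2}{2u(s)}+\frac{u'(s)^2}{2u(s)}\,ds:\ u\in H^1(-\kappa,\kappa),\ u\ge0,\ u(\pm\kappa)=u^\pm\Big\}\in[0,\infty]$$ (with $0/0=0$ and $a/0=+\infty$ for $a>0$). If $\rho(t)=\frac12u^-(t)\delta_{-1}+\frac12u^+(t)\delta_1$ for all $t\in[0,T]$ with $0\le u^\pm\in AC([0,T])$ and $w:=\frac12\dot u^+=-\frac12\dot u^-$ a.e., let $\mathcal J_0(\rho)=\int_0^TM(w(t),u^\pm(t))\,dt$; otherwise $\mathcal J_0(\rho)=+\infty$. **Theorem (lower bound).** Let $\varepsilon\to0$ along a set $\Lambda\subset(0,\infty)$ having $0$ as an accumulation point (all of $(0,\infty)$, or a sequence). For $\varepsilon\in\Lambda$ let $\rho_\varepsilon\in C([0,T];\mathscr M(\Xi))$ with $\rho_\varepsilon(t)\ll\gamma_\varepsilon$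 for every $t\in[0,T]$, and suppose that there are constants $m,C\ge 0$ independent of $\varepsilon$ with $$\rho_\varepsilon(t)(\Xi)=m\ \text{ for all }t\in[0,T],\qquad \mathcal E_\varepsilon(\rho_\varepsilon(0))\le C,\qquad \mathcal J_\varepsilon(\rho_\varepsilon)\le C .$$ Suppose that $\rho_\varepsilon(t)\to\rho_0(t)$ weakly-* in $\mathscr M(\Xi)$ for every $t\in[0,T]$. Then $$\mathcal J_0(\rho_0)\le\liminf_{\varepsilon\to0}\mathcal J_\varepsilon(\rho_\varepsilon)\qquad\text{and}\qquad \mathcal E_0(\rho_0(t))\le\liminf_{\varepsilon\to0}\mathcal E_\varepsilon(\rho_\varepsilon(t))\quad\text{for every }t\in[0,T].$$ -/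

import Mathlib

open Set Filter Topology MeasureTheory
open scoped ENNReal NNReal ContDiff

noncomputable section

namespace Kramers

/-- The spatial domain `Ξ = [-1, 1]`. -/
abbrev Xi : Type := Icc (-1 : ℝ) 1

/-- The left well `ξ = -1`, as a point of `Ξ`. -/
def leftWell : Xi := ⟨-1, by norm_num⟩

/-- The right well `ξ = 1`, as a point of `Ξ`. -/
def rightWell : Xi := ⟨1, by norm_num⟩

/-- The double-well potential: smooth, even, maximal at `0` with value `1`, minimal on `[-1, 1]`
exactly at the wells `±1` with value `0`, and with nondegenerate second derivatives at `0` and at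
the wells (so that the rate constant is positive and finite). -/
structure IsDoubleWell (H : ℝ → ℝ) : Prop where
  smooth : ContDiff ℝ ∞ H
  even : ∀ x, H (-x) = H x
  at_zero : H 0 = 1
  at_one : H 1 = 0
  pos : ∀ x ∈ Ioo (-1 : ℝ) 1, 0 < H x
  le_one : ∀ x ∈ Icc (-1 : ℝ) 1, H x ≤ 1
  second_zero : iteratedDeriv 2 H 0 < 0
  second_one : 0 < iteratedDeriv 2 H 1

/-- The rate constant `k = (1/π) √(|H''(0)| H''(1))`. -/
def rate (H : ℝ → ℝ) : ℝ :=
  1 / Real.pi * √(|iteratedDeriv 2 H 0| * iteratedDeriv 2 H 1)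

/-- `κ = 1/k`. -/
def kap (H : ℝ → ℝ) : ℝ := 1 / rate H

/-- The normalization constant `Z_ε`. -/
def Z (H : ℝ → ℝ) (ε : ℝ) : ℝ := ∫ x in (-1 : ℝ)..1, Real.exp (-H x / ε)

/-- The Lebesgue density `g_ε` of the invariant measure. -/
def g (H : ℝ → ℝ) (ε : ℝ) (x : ℝ) : ℝ := (Z H ε)⁻¹ * Real.exp (-H x / ε)

/-- The invariant measure `γ_ε = Z_ε⁻¹ e^{-H/ε} 𝓛¹` on `Ξ`. -/
def gam (H : ℝ → ℝ) (ε : ℝ) : Measure Xi :=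
  (Measure.comap ((↑) : Xi → ℝ) volume).withDensity fun ξ => ENNReal.ofReal (g H ε ξ)

/-- The limit measure `γ_0 = ½ δ_{-1} + ½ δ_1` on `Ξ`. -/
def gam0 : Measure Xi :=
  (2⁻¹ : ℝ≥0∞) • Measure.dirac leftWell + (2⁻¹ : ℝ≥0∞) • Measure.dirac rightWell

/-- The time scale `τ_ε = (1/2κ) ∫_{-1}^1 dξ / g_ε(ξ)`. -/
def tau (H : ℝ → ℝ) (ε : ℝ) : ℝ := 1 / (2 * kap H) * ∫ x in (-1 : ℝ)..1, 1 / g H ε x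

/-- The density `u = dρ/dγ`. -/
def dens (γ : Measure Xi) (ρ : FiniteMeasure Xi) (ξ : Xi) : ℝ :=
  ((ρ : Measure Xi).rnDeriv γ ξ).toReal

open Classical in
/-- The free energy `∫ u log u dγ - m log m` with `u = dρ/dγ` and `m = ρ(Ξ)`, equal to `+∞` if `ρ`
is not absolutely continuous with respect to `γ`. As `u log u` is bounded below and `γ` is finite,
the integral is `+∞` exactly if `u log u` is not integrable.
It is `E_ε` for `γ = γ_ε`, and `E_0` for `γ = γ_0`. -/
def freeEnergy (γ : Measure Xi) (ρ : FiniteMeasure Xi) : EReal :=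
  if (ρ : Measure Xi) ≪ γ ∧ Integrable (fun ξ => dens γ ρ ξ * Real.log (dens γ ρ ξ)) γ then
    (((∫ ξ, dens γ ρ ξ * Real.log (dens γ ρ ξ) ∂γ)
      - (ρ.mass : ℝ) * Real.log (ρ.mass : ℝ) : ℝ) : EReal)
  else ⊤

/-- `f` is (the continuous representative of) an element of the Sobolev space
`H¹(a, b) = W^{1,2}(a, b)`, `a < b`: it is absolutely continuous on `[a, b]` with
square-integrable derivative. -/
def IsH1 (a b : ℝ) (f : ℝ → ℝ) : Prop :=
  AbsolutelyContinuousOnInterval f a b ∧ MemLp (deriv f) 2 (volume.restrict (Ioo a b))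

/-- `∫_Ξ |∂_ξ √u|² dγ` where `u = dρ/dγ` and `√u ∈ W^{1,2}(-1, 1)`; the value is `+∞` if `ρ` is
not absolutely continuous with respect to `γ` or if `√u` is not in `W^{1,2}(-1, 1)`.
(The function `z` is the continuous representative of `√u`.) -/
def sqrtDirichlet (γ : Measure Xi) (ρ : FiniteMeasure Xi) : ℝ≥0∞ :=
  ⨅ (z : ℝ → ℝ) (_ : (ρ : Measure Xi) ≪ γ ∧ IsH1 (-1) 1 z ∧
      ∀ᵐ ξ : Xi ∂γ, z (ξ : ℝ) = √(dens γ ρ ξ)),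
    ∫⁻ ξ : Xi, ENNReal.ofReal (deriv z (ξ : ℝ) ^ 2) ∂γ

/-- `(ρ, ρ v)` solves the continuity equation on `(0, T)`: `ρ` is a weakly-* continuous curve of
finite measures on `Ξ`, `v` is a Borel velocity field with `∫∫ |v| dρ dt < ∞`, and
`∂_t ρ + ∂_ξ (ρ v) = 0` in `𝓓'((0, T) × ℝ)`, where `ρ` is extended by zero outside `Ξ`. -/
structure SolvesCE (T : ℝ) (ρ : ℝ → FiniteMeasure Xi) (v : ℝ → Xi → ℝ) : Prop where
  cont : ContinuousOn ρ (Icc 0 T)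
  meas : Measurable (Function.uncurry v)
  integrable : ∫⁻ t in Ioo 0 T, ∫⁻ ξ : Xi, ‖v t ξ‖ₑ ∂(ρ t : Measure Xi) < ⊤
  weak : ∀ φ : ℝ × ℝ → ℝ, ContDiff ℝ ∞ φ → HasCompactSupport φ →
    tsupport φ ⊆ Ioo 0 T ×ˢ univ →
    ∫ t in Ioo 0 T, ∫ ξ : Xi,
      (deriv (fun s => φ (s, (ξ : ℝ))) t + v t ξ * deriv (fun x => φ (t, x)) (ξ : ℝ))
        ∂(ρ t : Measure Xi) = 0

/-- The functional `J_ε(ρ; 0, T) = ∫_0^T ((1/2τ_ε) ∫ v² dρ + 2τ_ε ∫ |∂_ξ √u|² dγ_ε) dt`, where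
`(ρ, ρ v)` solves the continuity equation and `ρ = u γ_ε`; the value is `+∞` if there is no
such `v`. (The infimum is only a way to write this: `ρ v` is determined by `ρ`.) -/
def J (H : ℝ → ℝ) (T ε : ℝ) (ρ : ℝ → FiniteMeasure Xi) : ℝ≥0∞ :=
  ⨅ (v : ℝ → Xi → ℝ) (_ : SolvesCE T ρ v),
    ∫⁻ t in Ioo 0 T,
      (ENNReal.ofReal (1 / (2 * tau H ε)) *
          ∫⁻ ξ : Xi, ENNReal.ofReal (v t ξ ^ 2) ∂(ρ t : Measure Xi)
        + ENNReal.ofReal (2 * tau H ε) * sqrtDirichlet (gam H ε) (ρ t))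

/-- The cell-problem function
`M(w, u^±) = inf { ∫_{-κ}^κ (w²/(2u) + u'²/(2u)) ds : u ∈ H¹(-κ, κ), u ≥ 0, u(±κ) = u^± }`.
In `[0, ∞]` one has `0/0 = 0` and `a/0 = ∞` for `a > 0`: this is the usual lower semicontinuous
convex extension of `(a, u) ↦ a²/u` to `u = 0`. -/
def M (κ w uminus uplus : ℝ) : ℝ≥0∞ :=
  ⨅ (u : ℝ → ℝ) (_ : IsH1 (-κ) κ u ∧ (∀ s ∈ Icc (-κ) κ, 0 ≤ u s) ∧
      u (-κ) = uminus ∧ u κ = uplus),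
    ∫⁻ s in Ioo (-κ) κ,
      (ENNReal.ofReal (w ^ 2) / ENNReal.ofReal (2 * u s)
        + ENNReal.ofReal (deriv u s ^ 2) / ENNReal.ofReal (2 * u s))

/-- The curve `ρ` is `ρ(t) = ½ u⁻(t) δ_{-1} + ½ u⁺(t) δ_1` with `u^± ≥ 0` absolutely continuous on
`[0, T]`, and `w = ½ (u⁺)' = -½ (u⁻)'` almost everywhere. -/
structure IsLimitCurve (T : ℝ) (ρ : ℝ → FiniteMeasure Xi) (uminus uplus w : ℝ → ℝ) : Prop where
  nonneg : ∀ t ∈ Icc 0 T, 0 ≤ uminus t ∧ 0 ≤ uplus t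
  eq : ∀ t ∈ Icc 0 T, (ρ t : Measure Xi) =
    ENNReal.ofReal (uminus t / 2) • Measure.dirac leftWell
      + ENNReal.ofReal (uplus t / 2) • Measure.dirac rightWell
  ac_minus : AbsolutelyContinuousOnInterval uminus 0 T
  ac_plus : AbsolutelyContinuousOnInterval uplus 0 T
  flux : ∀ᵐ t ∂(volume.restrict (Ioo 0 T)),
    w t = deriv uplus t / 2 ∧ w t = -(deriv uminus t / 2)

/-- The limit functional `J_0(ρ; 0, T) = ∫_0^T M(w(t), u^±(t)) dt`, with value `+∞` if `ρ` is not
of the form described in `IsLimitCurve`. (On `[0, T]` the functions `u^±` are determined by `ρ`,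
and so is `w` almost everywhere; the infimum is only a way to write this.) -/
def J0 (H : ℝ → ℝ) (T : ℝ) (ρ : ℝ → FiniteMeasure Xi) : ℝ≥0∞ :=
  ⨅ (uminus : ℝ → ℝ) (uplus : ℝ → ℝ) (w : ℝ → ℝ) (_ : IsLimitCurve T ρ uminus uplus w),
    ∫⁻ t in Ioo 0 T, M (kap H) (w t) (uminus t) (uplus t)

end Kramers

end

/-! ### Distributional derivatives on an interval, and a Riesz representation -/

namespace Kramers

/-! The proof works with dual lower bounds throughout: they are linear in the pair (ρ, ρv), so they
pass to weak-* limits without any compactness of densities or velocities. At a fixed time, v²/(2τ) ≥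
vα - τα²/2, and after writing u = z², integrating by parts and completing a square, the Fisher
information dominates functionals that are linear in ρ (`ofReal_le_diss`).

The right tests come from the variable s with ds = dξ/(g_ε τ_ε), which maps [-1, 1] onto [-κ, κ] and
sends almost all of this length to the barrier. Take a, b on [-κ, κ] with b' = -(a² + b²)/2, test
the flux with a(s) ds/dξ and the Fisher information with b(s), corrected inside the wells so that it
vanishes at ±1. All quadratic terms carry the factor 1/(g_ε² τ_ε); on the barrier they cancel by the
equation for b, in the wells the factor is small (`exists_cellTest`). The continuity equation turns
the flux term into endpoint values, and for the limit curve with densities u^± there remains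
(∫a)(u⁺(t) - u⁺(s))/2 + ∫(b(κ)u⁺ - b(-κ)u⁻) on every time interval [s, t]
(`ofReal_cellTest_le_liminf`).

This is enough by convex duality: M(w, u^±) is at most the supremum of w∫a + b(κ)u⁺ - b(-κ)u⁻. The
minimizer of the cell problem is an explicit quadratic polynomial u, and a = w/u, b = u'/u is an
optimal test (`M_le_of_forall_cellTest`). The lower limit of the dissipation is a superadditive
function of time intervals. Tests with large ∫a make u⁺ absolutely continuous
(`absolutelyContinuous_of_cellTest_le`); differentiating in time then bounds M almost everywhere,
and integration gives the dissipation bound (`lintegral_M_le`).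

The errors of the tests are multiples of 1 - ξ², so the limit must live on the two wells at every
time. For this the entropy has to be bounded uniformly in time, by its initial value and the
dissipation. Instead of a chain rule for the entropy along the curve, one uses time averages μ_k of
ρ with Bernstein weights. The difference μ_k - μ_{k-1} is a divergence whose flux is controlled by
μ_k itself, as in an implicit Euler scheme, and μ_k has finite Fisher information. Convexity of the
entropy gives one step (`SolvesCE.regEntropy_le_add`), the steps add up with a constant independent
of the degree (`SolvesCE.exists_average_entropy_le`), and as the degree tends to infinity the
averages approach ρ(t). The entropy bound, used through its Legendre dual, then excludes mass away
from the wells (`integral_one_sub_sq_eq_zero`).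

The energies are treated by duality as well: u log u lies above its tangent at any positive
continuous function, and γ_ε → γ_0 (`freeEnergy_le_liminf`). -/

/-- The fundamental theorem: the primitive of a continuous function. -/
lemma hasDerivAt_primitive {f : ℝ → ℝ} (hf : Continuous f) (a x : ℝ) :
    HasDerivAt (fun y => ∫ s in a..y, f s) (f x) x :=
  intervalIntegral.integral_hasDerivAt_right (hf.intervalIntegrable _ _)
    (hf.stronglyMeasurableAtFilter _ _) hf.continuousAt

lemma contDiff_primitive {f : ℝ → ℝ} (hf : ContDiff ℝ ∞ f) (a : ℝ) :
    ContDiff ℝ ∞ (fun y => ∫ s in a..y, f s) := by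
  rw [contDiff_infty_iff_deriv]
  refine ⟨fun x => (hasDerivAt_primitive hf.continuous a x).differentiableAt, ?_⟩
  rwa [show deriv (fun y => ∫ s in a..y, f s) = f from
    funext fun x => (hasDerivAt_primitive hf.continuous a x).deriv]

lemma exists_Icc_of_isCompact_subset_Ioo {a b : ℝ} (hab : a < b) {K : Set ℝ} (hK : IsCompact K)
    (h : K ⊆ Ioo a b) : ∃ α β, a < α ∧ α ≤ β ∧ β < b ∧ K ⊆ Icc α β := by
  rcases K.eq_empty_or_nonempty with rfl | hne
  · exact ⟨(a + b) / 2, (a + b) / 2, by linarith, le_rfl, by linarith, empty_subset _⟩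
  · have h1 := hK.sInf_mem hne
    have h2 := hK.sSup_mem hne
    exact ⟨sInf K, sSup K, (h h1).1, csInf_le hK.bddBelow h2, (h h2).2,
      fun x hx => ⟨csInf_le hK.bddBelow hx, le_csSup hK.bddAbove hx⟩⟩

/-- A function on an interval whose distributional derivative vanishes is constant. -/
lemma ae_eq_const_of_weak_deriv_zero {a b : ℝ} (hab : a < b) {f : ℝ → ℝ}
    (hf : IntervalIntegrable f volume a b)
    (H : ∀ χ : ℝ → ℝ, ContDiff ℝ ∞ χ → HasCompactSupport χ → tsupport χ ⊆ Ioo a b →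
      ∫ x in a..b, deriv χ x * f x = 0) :
    ∃ c, ∀ᵐ x ∂volume.restrict (Ioo a b), f x = c := by
  obtain ⟨θ, hθs, hθc, hθd, hθ1⟩ : ∃ θ : ℝ → ℝ, tsupport θ ⊆ Ioo a b ∧ HasCompactSupport θ ∧
      ContDiff ℝ ∞ θ ∧ ∫ x in a..b, θ x = 1 := by
    let B : ContDiffBump ((a + b) / 2) := ⟨(b - a) / 8, (b - a) / 4, by linarith, by linarith⟩
    have hs : tsupport (B.normed volume) ⊆ Ioo a b := by
      rw [B.tsupport_normed_eq, Real.closedBall_eq_Icc]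
      intro x hx
      have h1 : (a + b) / 2 - (b - a) / 4 ≤ x := hx.1
      have h2 : x ≤ (a + b) / 2 + (b - a) / 4 := hx.2
      constructor <;> linarith
    refine ⟨B.normed volume, hs, ?_, B.contDiff_normed, ?_⟩
    · rw [HasCompactSupport, B.tsupport_normed_eq]; exact isCompact_closedBall _ _
    · rw [intervalIntegral.integral_eq_integral_of_support_subset, B.integral_normed]
      exact (subset_tsupport _).trans (hs.trans Ioo_subset_Ioc_self)
  -- Since θ has unit mass, this is the only possible value of the constant.
  set c := ∫ x in a..b, θ x * f x with hc
  refine ⟨c, ?_⟩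
  have hfi : IntegrableOn f (Ioo a b) :=
    ((intervalIntegrable_iff_integrableOn_Ioc_of_le hab.le).1 hf).mono_set Ioo_subset_Ioc_self
  have key : ∀ᵐ x ∂volume, x ∈ Ioo a b → f x - c = 0 := by
    refine isOpen_Ioo.ae_eq_zero_of_integral_contDiff_smul_eq_zero ?_ ?_
    · exact (hfi.sub (integrableOn_const (by simp))).locallyIntegrableOn
    intro ψ hψd hψc hψs
    set m := ∫ x in a..b, ψ x with hm
    -- Subtracting mθ makes the mean zero, so the primitive of ζ has compact support and is an
    -- admissible test function.
    let ζ : ℝ → ℝ := fun x => ψ x - m * θ x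
    have hζd : ContDiff ℝ ∞ ζ := hψd.sub (contDiff_const.mul hθd)
    have hζ0 : ∫ x in a..b, ζ x = 0 := by
      have hi : IntervalIntegrable (fun x => m * θ x) volume a b :=
        (continuous_const.mul hθd.continuous).intervalIntegrable _ _
      simp only [ζ]
      rw [intervalIntegral.integral_sub (hψd.continuous.intervalIntegrable _ _) hi,
        intervalIntegral.integral_const_mul, hθ1]
      simp [hm]
    obtain ⟨α, β, h1, h2, h3, h4⟩ := exists_Icc_of_isCompact_subset_Ioo hab
      (hψc.isCompact.union hθc.isCompact) (union_subset hψs hθs)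
    have hζz : ∀ x, x ∉ Icc α β → ζ x = 0 := by
      intro x hx
      have hx1 : x ∉ tsupport ψ := fun h => hx (h4 (Or.inl h))
      have hx2 : x ∉ tsupport θ := fun h => hx (h4 (Or.inr h))
      simp [ζ, image_eq_zero_of_notMem_tsupport hx1, image_eq_zero_of_notMem_tsupport hx2]
    let p : ℝ → ℝ := fun y => ∫ s in a..y, ζ s
    have hpz : ∀ x, x ∉ Icc α β → p x = 0 := by
      intro x hx
      rcases lt_or_ge x α with hxα | hxα
      · refine intervalIntegral.integral_zero_ae (Eventually.of_forall fun y hy => hζz y ?_)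
        have := (uIoc_subset_uIcc hy)
        intro hy'
        have h5 : y ≤ max a x := this.2
        have : max a x < α := max_lt h1 hxα
        linarith [hy'.1]
      · have hxβ : β < x := by by_contra h; exact hx ⟨hxα, not_lt.1 h⟩
        have : p x = (∫ s in a..b, ζ s) + ∫ s in b..x, ζ s :=
          (intervalIntegral.integral_add_adjacent_intervals
            (hζd.continuous.intervalIntegrable _ _) (hζd.continuous.intervalIntegrable _ _)).symm
        rw [this, hζ0, zero_add]
        refine intervalIntegral.integral_zero_ae (Eventually.of_forall fun y hy => hζz y ?_)
        have := (uIoc_subset_uIcc hy)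
        intro hy'
        have h5 : min b x ≤ y := this.1
        have : β < min b x := lt_min h3 hxβ
        linarith [hy'.2]
    have hps : tsupport p ⊆ Icc α β :=
      closure_minimal (fun x hx => by_contra fun h => hx (hpz x h)) isClosed_Icc
    have hH := H p (contDiff_primitive hζd a)
      (isCompact_Icc.of_isClosed_subset (isClosed_tsupport _) hps)
      (hps.trans fun x hx => ⟨h1.trans_le hx.1, hx.2.trans_lt h3⟩)
    have hder : ∀ x, deriv p x = ζ x := fun x => (hasDerivAt_primitive hζd.continuous a x).deriv
    simp only [hder] at hH
    have e1 : ∫ x, ψ x • (f x - c) = ∫ x in a..b, ψ x * (f x - c) := by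
      rw [intervalIntegral.integral_eq_integral_of_support_subset]
      · rfl
      · intro x hx
        refine Ioo_subset_Ioc_self (hψs (subset_tsupport _ fun h => hx ?_))
        simp [h]
    have i1 : IntervalIntegrable (fun x => ψ x * f x) volume a b :=
      hf.continuousOn_mul hψd.continuous.continuousOn
    have i2 : IntervalIntegrable (fun x => θ x * f x) volume a b :=
      hf.continuousOn_mul hθd.continuous.continuousOn
    have e2 : ∫ x in a..b, ζ x * f x = (∫ x in a..b, ψ x * f x) - m * c := by
      rw [hc, ← intervalIntegral.integral_const_mul,
        ← intervalIntegral.integral_sub i1 (i2.const_mul m)]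
      congr 1; ext x; simp only [ζ]; ring
    have e3 : ∫ x in a..b, ψ x * (f x - c) = (∫ x in a..b, ψ x * f x) - m * c := by
      rw [hm, ← intervalIntegral.integral_mul_const,
        ← intervalIntegral.integral_sub i1 ((hψd.continuous.intervalIntegrable _ _).mul_const c)]
      congr 1; ext x; ring
    rw [e1, e3, ← e2, hH]
  rw [ae_restrict_iff' measurableSet_Ioo]
  filter_upwards [key] with x hx hx'
  linarith [hx hx']

lemma ae_deriv_primitive {a b : ℝ} {h : ℝ → ℝ} (hh : IntervalIntegrable h volume a b) :
    ∀ᵐ x, x ∈ uIcc a b → deriv (fun y => ∫ s in a..y, h s) x = h x := by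
  filter_upwards [hh.ae_hasDerivAt_integral] with x hx hx'
  exact (hx hx' a left_mem_uIcc).deriv

/-- The lemma of du Bois-Reymond: a function with an integrable distributional derivative is
almost everywhere a primitive of it. -/
lemma ae_eq_primitive_of_weak_deriv {a b : ℝ} (hab : a < b) {f h : ℝ → ℝ}
    (hf : IntervalIntegrable f volume a b) (hh : IntervalIntegrable h volume a b)
    (H : ∀ χ : ℝ → ℝ, ContDiff ℝ ∞ χ → HasCompactSupport χ → tsupport χ ⊆ Ioo a b →
      (∫ x in a..b, deriv χ x * f x) + ∫ x in a..b, χ x * h x = 0) :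
    ∃ c, ∀ᵐ x ∂volume.restrict (Ioo a b), f x = c + ∫ y in a..x, h y := by
  have hac : AbsolutelyContinuousOnInterval (fun x => ∫ y in a..x, h y) a b :=
    hh.absolutelyContinuousOnInterval_intervalIntegral left_mem_uIcc
  have hpi : IntervalIntegrable (fun x => ∫ y in a..x, h y) volume a b :=
    hac.continuousOn.intervalIntegrable
  obtain ⟨c, hc⟩ := ae_eq_const_of_weak_deriv_zero hab (hf.sub hpi) (by
    intro χ h1 h2 h3
    have hχac : AbsolutelyContinuousOnInterval χ a b :=
      (h1.of_le (by exact_mod_cast le_top)).contDiffOn.absolutelyContinuousOnInterval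
    have hz : ∀ x, x ∉ Ioo a b → χ x = 0 := fun x hx =>
      image_eq_zero_of_notMem_tsupport fun h => hx (h3 h)
    have hdc : Continuous (deriv χ) := h1.continuous_deriv (by exact_mod_cast le_top)
    have := hχac.integral_mul_deriv_eq_deriv_mul hac
    rw [hz a (by simp), hz b (by simp)] at this
    have e : ∫ x in a..b, χ x * deriv (fun y => ∫ s in a..y, h s) x = ∫ x in a..b, χ x * h x := by
      refine intervalIntegral.integral_congr_ae ?_
      filter_upwards [ae_deriv_primitive hh] with x hx hx'
      rw [hx (uIoc_subset_uIcc hx')]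
    rw [e] at this
    have e2 : ∫ x in a..b, deriv χ x * (f x - ∫ y in a..x, h y)
        = (∫ x in a..b, deriv χ x * f x) - ∫ x in a..b, deriv χ x * ∫ y in a..x, h y := by
      rw [← intervalIntegral.integral_sub (hf.continuousOn_mul hdc.continuousOn)
        (hpi.continuousOn_mul hdc.continuousOn)]
      congr 1; ext x; ring
    rw [e2]
    have := H χ h1 h2 h3
    linarith)
  refine ⟨c, ?_⟩
  filter_upwards [hc] with x hx
  linarith

/-- A functional that is bounded by the norm of a linear image in a Hilbert space is represented
by an element of the Hilbert space. -/
lemma exists_riesz {V E : Type*} [AddCommGroup V] [Module ℝ V] [NormedAddCommGroup E]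
    [InnerProductSpace ℝ E] [CompleteSpace E] (Φ : V →ₗ[ℝ] E) (ℓ : V →ₗ[ℝ] ℝ) (C : ℝ)
    (hC : 0 ≤ C) (h : ∀ x, |ℓ x| ≤ C * ‖Φ x‖) :
    ∃ y : E, ‖y‖ ≤ C ∧ ∀ x, ℓ x = inner ℝ y (Φ x) := by
  -- The bound forces ℓ to vanish on the kernel of Φ, so ℓ ∘ s does not depend on the linear section
  -- s; it is extended from the range by Hahn–Banach.
  obtain ⟨s, hs⟩ := Φ.rangeRestrict.exists_rightInverse_of_surjective Φ.range_rangeRestrict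
  have hs' : ∀ z : LinearMap.range Φ, Φ (s z) = z := fun z =>
    congrArg Subtype.val (LinearMap.congr_fun hs z)
  let f : LinearMap.range Φ →L[ℝ] ℝ := (ℓ ∘ₗ s).mkContinuous C (by
    intro z
    have := h (s z)
    rw [hs'] at this
    simpa using this)
  have hf : ‖f‖ ≤ C := LinearMap.mkContinuous_norm_le _ hC _
  obtain ⟨F, hF, hFn⟩ := exists_extension_norm_eq (LinearMap.range Φ) f
  refine ⟨(InnerProductSpace.toDual ℝ E).symm F, by simpa [hFn] using hf, fun x => ?_⟩
  rw [InnerProductSpace.toDual_symm_apply]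
  have e : F (Φ x) = f (Φ.rangeRestrict x) := hF (Φ.rangeRestrict x)
  rw [e]
  have h0 : Φ (x - s (Φ.rangeRestrict x)) = 0 := by
    rw [map_sub, hs']; simp
  have h1 := h (x - s (Φ.rangeRestrict x))
  rw [h0, norm_zero, mul_zero] at h1
  have h2 : ℓ (x - s (Φ.rangeRestrict x)) = 0 := abs_nonpos_iff.1 h1
  rw [map_sub, sub_eq_zero] at h2
  simpa [f] using h2

end Kramers

/-! ### The Gibbs measures: concentration at the wells and size of 1/(g τ) -/

namespace Kramers

section Gibbs

variable {H : ℝ → ℝ}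

lemma IsDoubleWell.continuous (hH : IsDoubleWell H) : Continuous H := hH.smooth.continuous

lemma IsDoubleWell.nonneg (hH : IsDoubleWell H) {x : ℝ} (hx : x ∈ Icc (-1 : ℝ) 1) : 0 ≤ H x := by
  rcases eq_or_lt_of_le hx.1 with h | h
  · rw [← h, hH.even, hH.at_one]
  rcases eq_or_lt_of_le hx.2 with h' | h'
  · rw [h', hH.at_one]
  · exact (hH.pos x ⟨h, h'⟩).le

lemma IsDoubleWell.kap_pos (hH : IsDoubleWell H) : 0 < kap H := by
  have h1 := hH.second_zero
  have h2 := hH.second_one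
  have : 0 < |iteratedDeriv 2 H 0| * iteratedDeriv 2 H 1 := mul_pos (abs_pos.2 h1.ne) h2
  unfold kap rate
  have := Real.sqrt_pos.2 this
  have := Real.pi_pos
  positivity

lemma continuous_gibbs (hH : Continuous H) (ε : ℝ) : Continuous fun x => Real.exp (-H x / ε) := by
  fun_prop

lemma Z_pos (hH : Continuous H) (ε : ℝ) : 0 < Z H ε :=
  intervalIntegral.intervalIntegral_pos_of_pos ((continuous_gibbs hH ε).intervalIntegrable _ _)
    (fun _ => Real.exp_pos _) (by norm_num)

lemma g_pos (hH : Continuous H) (ε x : ℝ) : 0 < g H ε x :=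
  mul_pos (inv_pos.2 (Z_pos hH ε)) (Real.exp_pos _)

@[fun_prop]
lemma continuous_g (hH : Continuous H) (ε : ℝ) : Continuous (g H ε) :=
  continuous_const.mul (continuous_gibbs hH ε)

lemma integral_g (hH : Continuous H) (ε : ℝ) : ∫ x in (-1 : ℝ)..1, g H ε x = 1 := by
  unfold g
  rw [intervalIntegral.integral_const_mul]
  exact inv_mul_cancel₀ (Z_pos hH ε).ne'

lemma one_div_g (ε x : ℝ) : 1 / g H ε x = Z H ε * Real.exp (H x / ε) := by
  unfold g
  rw [one_div, mul_inv, inv_inv, ← Real.exp_neg, neg_div, neg_neg]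

lemma continuous_one_div_g (hH : Continuous H) (ε : ℝ) : Continuous fun x => 1 / g H ε x :=
  continuous_const.div (continuous_g hH ε) fun x => (g_pos hH ε x).ne'

lemma integral_one_div_g_pos (hH : Continuous H) (ε : ℝ) :
    0 < ∫ x in (-1 : ℝ)..1, 1 / g H ε x :=
  intervalIntegral.intervalIntegral_pos_of_pos
    ((continuous_one_div_g hH ε).intervalIntegrable _ _)
    (fun x => one_div_pos.2 (g_pos hH ε x)) (by norm_num)

lemma tau_pos (hH : IsDoubleWell H) (ε : ℝ) : 0 < tau H ε :=
  mul_pos (one_div_pos.2 (mul_pos two_pos hH.kap_pos))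
    (integral_one_div_g_pos hH.continuous ε)

/-- Integrals with respect to Lebesgue measure on `Ξ`. -/
lemma map_comap_coe :
    (Measure.comap ((↑) : Xi → ℝ) volume).map (↑) = volume.restrict (Icc (-1 : ℝ) 1) := by
  rw [(MeasurableEmbedding.subtype_coe measurableSet_Icc).map_comap, Subtype.range_coe]

lemma measurableEmbedding_coe : MeasurableEmbedding ((↑) : Xi → ℝ) :=
  MeasurableEmbedding.subtype_coe measurableSet_Icc

lemma lintegral_comap_coe (f : ℝ → ℝ≥0∞) :
    ∫⁻ ξ : Xi, f ξ ∂(Measure.comap ((↑) : Xi → ℝ) volume) = ∫⁻ x in Ioo (-1 : ℝ) 1, f x := by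
  rw [← measurableEmbedding_coe.lintegral_map, map_comap_coe, restrict_Ioo_eq_restrict_Icc]

lemma measurable_ofReal_g (hH : Continuous H) (ε : ℝ) :
    Measurable fun ξ : Xi => ENNReal.ofReal (g H ε ξ) :=
  ENNReal.measurable_ofReal.comp ((continuous_g hH ε).measurable.comp measurable_subtype_coe)

lemma lintegral_gam (hH : Continuous H) (ε : ℝ) (f : ℝ → ℝ≥0∞) :
    ∫⁻ ξ : Xi, f ξ ∂(gam H ε) = ∫⁻ x in Ioo (-1 : ℝ) 1, ENNReal.ofReal (g H ε x) * f x := by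
  unfold gam
  rw [lintegral_withDensity_eq_lintegral_mul_non_measurable _ (measurable_ofReal_g hH ε)
    (Eventually.of_forall fun _ => ENNReal.ofReal_lt_top)]
  exact lintegral_comap_coe fun x => ENNReal.ofReal (g H ε x) * f x

lemma integral_gam (hH : Continuous H) (ε : ℝ) (f : ℝ → ℝ) :
    ∫ ξ : Xi, f ξ ∂(gam H ε) = ∫ x in (-1 : ℝ)..1, g H ε x * f x := by
  unfold gam
  rw [integral_withDensity_eq_integral_toReal_smul (measurable_ofReal_g hH ε)
    (Eventually.of_forall fun _ => ENNReal.ofReal_lt_top),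
    intervalIntegral.integral_of_le (by norm_num), ← restrict_Ioo_eq_restrict_Ioc,
    restrict_Ioo_eq_restrict_Icc, ← map_comap_coe, measurableEmbedding_coe.integral_map]
  refine integral_congr_ae (Eventually.of_forall fun ξ => ?_)
  simp [ENNReal.toReal_ofReal (g_pos hH ε ξ).le]

lemma integrable_gam_iff (hH : Continuous H) (ε : ℝ) (f : ℝ → ℝ) :
    Integrable (fun ξ : Xi => f ξ) (gam H ε) ↔
      IntervalIntegrable (fun x => g H ε x * f x) volume (-1) 1 := by
  unfold gam
  rw [integrable_withDensity_iff_integrable_smul' (measurable_ofReal_g hH ε)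
    (Eventually.of_forall fun _ => ENNReal.ofReal_lt_top),
    intervalIntegrable_iff_integrableOn_Ioo_of_le (by norm_num), IntegrableOn,
    restrict_Ioo_eq_restrict_Icc, ← map_comap_coe, measurableEmbedding_coe.integrable_map_iff]
  refine integrable_congr (Eventually.of_forall fun ξ => ?_)
  simp [ENNReal.toReal_ofReal (g_pos hH ε ξ).le]

lemma ae_gam_iff (hH : Continuous H) (ε : ℝ) (p : ℝ → Prop) :
    (∀ᵐ ξ : Xi ∂(gam H ε), p ξ) ↔ ∀ᵐ x ∂(volume.restrict (Ioo (-1 : ℝ) 1)), p x := by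
  unfold gam
  rw [restrict_Ioo_eq_restrict_Icc, ← map_comap_coe,
    measurableEmbedding_coe.ae_map_iff, ae_withDensity_iff (measurable_ofReal_g hH ε)]
  simp [g_pos hH ε]

lemma isProbabilityMeasure_gam (hH : Continuous H) (ε : ℝ) :
    IsProbabilityMeasure (gam H ε) := by
  constructor
  have := lintegral_gam hH ε (fun _ => 1)
  simp only [lintegral_one, mul_one] at this
  rw [this, ← ofReal_integral_eq_lintegral_ofReal, restrict_Ioo_eq_restrict_Ioc,
    ← intervalIntegral.integral_of_le (by norm_num), integral_g hH, ENNReal.ofReal_one]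
  · rw [restrict_Ioo_eq_restrict_Icc]
    exact (continuous_g hH ε).integrableOn_Icc
  · exact Eventually.of_forall fun x => (g_pos hH ε x).le

lemma tendsto_exp_neg_div {c : ℝ} (hc : 0 < c) :
    Tendsto (fun ε : ℝ => Real.exp (-c / ε)) (𝓝[>] 0) (𝓝 0) := by
  have h : Tendsto (fun ε : ℝ => c * ε⁻¹) (𝓝[>] 0) atTop :=
    tendsto_inv_nhdsGT_zero.const_mul_atTop hc
  refine (Real.tendsto_exp_neg_atTop_nhds_zero.comp h).congr fun ε => ?_
  simp [div_eq_mul_inv]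

/-- Away from the wells the densities `g_ε` vanish uniformly. -/
lemma eventually_g_le (hH : IsDoubleWell H) {r : ℝ} (hr : r < 1) {δ : ℝ} (hδ : 0 < δ) :
    ∀ᶠ ε in 𝓝[>] (0 : ℝ), ∀ x, |x| ≤ r → g H ε x ≤ δ := by
  rcases lt_or_ge r 0 with hr0 | hr0
  · exact Eventually.of_forall fun ε x hx => absurd (abs_nonneg x) (by linarith)
  obtain ⟨x0, hx0, hmin⟩ := isCompact_Icc.exists_isMinOn (nonempty_Icc.2 (by linarith : -r ≤ r))
    hH.continuous.continuousOn
  have hpos : 0 < H x0 := hH.pos x0 ⟨by linarith [hx0.1], by linarith [hx0.2]⟩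
  set h := H x0
  -- A strip of width d at the well gives Z_ε ≥ d e^{-h/(2ε)}, which beats e^{-H/ε} ≤ e^{-h/ε} on
  -- |x| ≤ r.
  obtain ⟨d, hd, hd1⟩ : ∃ d ∈ Ioo (0 : ℝ) 1, ∀ x ∈ Icc (1 - d) 1, H x ≤ h / 2 := by
    have : ∀ᶠ x in 𝓝 (1 : ℝ), H x < h / 2 :=
      hH.continuous.continuousAt.eventually_lt_const (by rw [hH.at_one]; linarith)
    obtain ⟨e, he, hb⟩ := Metric.eventually_nhds_iff.1 this
    refine ⟨min (e / 2) (1 / 2), ⟨by positivity, by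
      have := min_le_right (e / 2) (1 / 2 : ℝ); linarith⟩, fun x hx => (hb ?_).le⟩
    rw [Real.dist_eq, abs_lt]
    have := min_le_left (e / 2) (1 / 2 : ℝ)
    constructor <;> linarith [hx.1, hx.2]
  have ht := (tendsto_exp_neg_div (half_pos hpos)).eventually_lt_const
    (show (0 : ℝ) < δ * d from mul_pos hδ hd.1)
  filter_upwards [ht, self_mem_nhdsWithin] with ε h1 hε x hx
  have hε : 0 < ε := hε
  have hZ : d * Real.exp (-(h / 2) / ε) ≤ Z H ε := by
    have i1 := (continuous_gibbs hH.continuous ε).intervalIntegrable (μ := volume)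
    have e1 : Z H ε = (∫ x in (-1 : ℝ)..(1 - d), Real.exp (-H x / ε)) +
        ∫ x in (1 - d)..1, Real.exp (-H x / ε) :=
      (intervalIntegral.integral_add_adjacent_intervals (i1 _ _) (i1 _ _)).symm
    have e2 : 0 ≤ ∫ x in (-1 : ℝ)..(1 - d), Real.exp (-H x / ε) :=
      intervalIntegral.integral_nonneg (by linarith [hd.2]) fun _ _ => (Real.exp_pos _).le
    have e3 : ∫ x in (1 - d)..1, Real.exp (-(h / 2) / ε) ≤
        ∫ x in (1 - d)..1, Real.exp (-H x / ε) := by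
      refine intervalIntegral.integral_mono_on (by linarith [hd.1]) (by simp) (i1 _ _) fun y hy => ?_
      gcongr
      exact hd1 y hy
    rw [intervalIntegral.integral_const, smul_eq_mul] at e3
    rw [e1]; linarith
  have hHx : h ≤ H x := hmin (abs_le.1 hx)
  have h2 : Real.exp (-H x / ε) ≤ Real.exp (-(h / 2) / ε) * Real.exp (-(h / 2) / ε) := by
    rw [← Real.exp_add]
    refine Real.exp_le_exp.2 ?_
    rw [← add_div]
    gcongr
    linarith
  unfold g
  rw [inv_mul_le_iff₀ (Z_pos hH.continuous ε)]
  have hp := Real.exp_pos (-(h / 2) / ε)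
  calc _ ≤ _ := h2
    _ ≤ Real.exp (-(h / 2) / ε) * (δ * d) := by gcongr
    _ = (d * Real.exp (-(h / 2) / ε)) * δ := by ring
    _ ≤ _ := by gcongr

lemma g_neg (hH : IsDoubleWell H) (ε x : ℝ) : g H ε (-x) = g H ε x := by
  simp [g, hH.even]

/-- The invariant measures `γ_ε` converge weakly to `γ_0`. -/
lemma tendsto_integral_gam (hH : IsDoubleWell H) {f : ℝ → ℝ} (hf : Continuous f) :
    Tendsto (fun ε => ∫ ξ : Xi, f ξ ∂(gam H ε)) (𝓝[>] 0) (𝓝 ((f (-1) + f 1) / 2)) := by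
  -- As g_ε is even, only the even part of f counts. Minus its value at ±1 it is small near the
  -- wells, while g_ε is small elsewhere.
  let e : ℝ → ℝ := fun x => (f x + f (-x)) / 2 - (f 1 + f (-1)) / 2
  have he : Continuous e := by fun_prop
  have hgc := continuous_g hH.continuous
  have key : ∀ ε, (∫ ξ : Xi, f ξ ∂(gam H ε)) - (f (-1) + f 1) / 2 =
      ∫ x in (-1 : ℝ)..1, g H ε x * e x := by
    intro ε
    have hg := hgc ε
    rw [integral_gam hH.continuous]
    have h1 : ∫ x in (-1 : ℝ)..1, g H ε x * f (-x) = ∫ x in (-1 : ℝ)..1, g H ε x * f x := by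
      have := intervalIntegral.integral_comp_neg (a := -1) (b := 1) (fun x => g H ε x * f x)
      simpa [g_neg hH] using this
    have i1 : IntervalIntegrable (fun x => g H ε x * f x) volume (-1) 1 :=
      (hg.mul hf).intervalIntegrable _ _
    have i2 : IntervalIntegrable (fun x => g H ε x * f (-x)) volume (-1) 1 :=
      (hg.mul (hf.comp continuous_neg)).intervalIntegrable _ _
    have h2 : ∫ x in (-1 : ℝ)..1, g H ε x * e x =
        ∫ x in (-1 : ℝ)..1, ((1 / 2) * (g H ε x * f x) + (1 / 2) * (g H ε x * f (-x)))
          - (f 1 + f (-1)) / 2 * g H ε x := by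
      congr 1; ext x; simp only [e]; ring
    rw [h2, intervalIntegral.integral_sub ((i1.const_mul _).add (i2.const_mul _))
      ((hg.intervalIntegrable _ _).const_mul _),
      intervalIntegral.integral_add (i1.const_mul _) (i2.const_mul _)]
    simp only [intervalIntegral.integral_const_mul]
    rw [h1, integral_g hH.continuous]
    ring
  obtain ⟨E, hE⟩ := isCompact_Icc.exists_bound_of_continuousOn (s := Icc (-1 : ℝ) 1) he.continuousOn
  have hE0 : 0 ≤ E := (norm_nonneg _).trans (hE 0 (by simp))
  rw [Metric.tendsto_nhds]
  intro δ hδ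
  set δ' := δ / (2 + 2 * E)
  have hδ' : 0 < δ' := by positivity
  obtain ⟨r, hr, hr1⟩ : ∃ r < 1, ∀ x ∈ Icc (-1 : ℝ) 1, r < |x| → |e x| ≤ δ' := by
    have h1 : ∀ᶠ x in 𝓝 (1 : ℝ), |e x| < δ' := by
      refine he.abs.continuousAt.eventually_lt_const ?_
      simp only [e]; rw [sub_self, abs_zero]; exact hδ'
    obtain ⟨d, hd, hb⟩ := Metric.eventually_nhds_iff.1 h1
    have hsym : ∀ x, e (-x) = e x := fun x => by simp only [e, neg_neg]; ring
    refine ⟨1 - d, by linarith, fun x hx hxr => ?_⟩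
    have hx1 : |x| ≤ 1 := abs_le.2 hx
    have h2 : |e (|x|)| < δ' := hb (by rw [Real.dist_eq, abs_lt]; constructor <;> linarith)
    rcases abs_choice x with h | h <;> rw [h] at h2
    · exact h2.le
    · rw [hsym] at h2; exact h2.le
  filter_upwards [eventually_g_le hH hr hδ'] with ε hε
  rw [Real.dist_eq, key]
  have hg := hgc ε
  have hb : ‖∫ x in (-1 : ℝ)..1, g H ε x * e x‖ ≤
      ∫ x in (-1 : ℝ)..1, (δ' * g H ε x + E * δ') := by
    refine intervalIntegral.norm_integral_le_of_norm_le (by norm_num)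
      (Eventually.of_forall fun x hx => ?_)
      ((by fun_prop : Continuous fun x => δ' * g H ε x + E * δ').intervalIntegrable _ _)
    have hx' := Ioc_subset_Icc_self hx
    have hgx := g_pos hH.continuous ε x
    rw [norm_mul, Real.norm_of_nonneg hgx.le, Real.norm_eq_abs]
    rcases lt_or_ge r |x| with h | h
    · have := hr1 x hx' h
      nlinarith [mul_nonneg hE0 hδ'.le]
    · have h1 := hε x h
      have h2 := hE x hx'
      rw [Real.norm_eq_abs] at h2
      have := mul_le_mul h1 h2 (abs_nonneg _) hδ'.le
      nlinarith [mul_pos hδ' hgx]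
  have h3 : ∫ x in (-1 : ℝ)..1, (δ' * g H ε x + E * δ') = δ' + 2 * E * δ' := by
    rw [intervalIntegral.integral_add ((hg.intervalIntegrable _ _).const_mul _) (by simp),
      intervalIntegral.integral_const_mul, integral_g hH.continuous,
      intervalIntegral.integral_const, smul_eq_mul]
    ring
  rw [h3] at hb
  rw [Real.norm_eq_abs] at hb
  refine hb.trans_lt ?_
  have : δ' * (2 + 2 * E) = δ := by simp only [δ']; field_simp
  nlinarith

/-- Z_ε is a factor of both 1/g_ε and τ_ε, so it cancels. What remains compares e^{H/ε} with its
integral, which is dominated by the barrier. -/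
lemma one_div_g_mul_tau (hH : IsDoubleWell H) (ε x : ℝ) :
    1 / (g H ε x * tau H ε) =
      2 * kap H * Real.exp (H x / ε) / ∫ y in (-1 : ℝ)..1, Real.exp (H y / ε) := by
  have hk := hH.kap_pos
  have hZ := Z_pos hH.continuous ε
  have h1 : ∫ x in (-1 : ℝ)..1, 1 / g H ε x = Z H ε * ∫ y in (-1 : ℝ)..1, Real.exp (H y / ε) := by
    simp only [one_div_g, intervalIntegral.integral_const_mul]
  have h2 := integral_one_div_g_pos hH.continuous ε
  rw [h1] at h2
  have h3 : 0 < ∫ y in (-1 : ℝ)..1, Real.exp (H y / ε) := (mul_pos_iff_of_pos_left hZ).1 h2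
  rw [← div_div, one_div_g, tau, h1]
  field_simp

/-- In the wells both `1 / (g_ε τ_ε)` and `1 / (g_ε² τ_ε)` vanish uniformly. -/
lemma eventually_well_small (hH : IsDoubleWell H) {δ : ℝ} (hδ : 0 < δ) :
    ∀ᶠ ε in 𝓝[>] (0 : ℝ), ∀ x ∈ Icc (-1 : ℝ) 1, H x ≤ 1 / 4 →
      1 / (g H ε x * tau H ε) ≤ δ ∧ 1 / (g H ε x ^ 2 * tau H ε) ≤ δ := by
  have hk := hH.kap_pos
  -- The barrier gives ∫ e^{H/ε} ≥ d e^{3/(4ε)}. Where H ≤ 1/4, even the square of e^{H/ε} is at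
  -- most e^{1/(2ε)}, so a factor e^{-1/(4ε)} is gained.
  obtain ⟨d, hd, hd1⟩ : ∃ d ∈ Ioo (0 : ℝ) 1, ∀ x ∈ Icc 0 d, 3 / 4 ≤ H x := by
    have : ∀ᶠ x in 𝓝 (0 : ℝ), 3 / 4 < H x :=
      hH.continuous.continuousAt.eventually_const_lt (by rw [hH.at_zero]; norm_num)
    obtain ⟨e, he, hb⟩ := Metric.eventually_nhds_iff.1 this
    refine ⟨min (e / 2) (1 / 2), ⟨by positivity, by
      have := min_le_right (e / 2) (1 / 2 : ℝ); linarith⟩, fun x hx => (hb ?_).le⟩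
    rw [Real.dist_eq, abs_lt]
    have := min_le_left (e / 2) (1 / 2 : ℝ)
    constructor <;> linarith [hx.1, hx.2]
  have ht := (tendsto_exp_neg_div (show (0 : ℝ) < 1 / 4 by norm_num)).eventually_lt_const
    (show (0 : ℝ) < δ * d / (4 * kap H) by have := hd.1; positivity)
  filter_upwards [ht, self_mem_nhdsWithin] with ε h1 hε x hx hHx
  have hε : 0 < ε := hε
  have hHc := hH.continuous
  set I := ∫ y in (-1 : ℝ)..1, Real.exp (H y / ε) with hI
  have hIl : d * Real.exp ((3 / 4) / ε) ≤ I := by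
    have ic : Continuous fun y => Real.exp (H y / ε) := by fun_prop
    have e3 : ∫ x in (0 : ℝ)..d, Real.exp ((3 / 4) / ε) ≤ ∫ x in (0 : ℝ)..d, Real.exp (H x / ε) := by
      refine intervalIntegral.integral_mono_on hd.1.le (by simp) (ic.intervalIntegrable _ _)
        fun y hy => ?_
      gcongr
      exact hd1 y hy
    have e4 : ∫ x in (0 : ℝ)..d, Real.exp (H x / ε) ≤ I :=
      intervalIntegral.integral_mono_interval (by norm_num) hd.1.le hd.2.le
        (Eventually.of_forall fun _ => (Real.exp_pos _).le) (ic.intervalIntegrable _ _)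
    rw [intervalIntegral.integral_const, smul_eq_mul] at e3
    linarith
  have hIpos : 0 < I := lt_of_lt_of_le (by have := hd.1; positivity) hIl
  have hZ2 : Z H ε ≤ 2 := by
    have : Z H ε ≤ ∫ x in (-1 : ℝ)..1, (1 : ℝ) := by
      refine intervalIntegral.integral_mono_on (by norm_num)
        ((continuous_gibbs hHc ε).intervalIntegrable _ _) (by simp) fun y hy => ?_
      have := hH.nonneg hy
      rw [Real.exp_le_one_iff, neg_div]
      simp only [Left.neg_nonpos_iff]
      positivity
    refine this.trans ?_
    norm_num
  set E := Real.exp (H x / ε) with hE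
  have hE1 : 1 ≤ E := Real.one_le_exp (div_nonneg (hH.nonneg hx) hε.le)
  have hE2 : E ^ 2 ≤ Real.exp ((3 / 4) / ε) * Real.exp (-(1 / 4) / ε) := by
    rw [← Real.exp_add, hE, ← Real.exp_nat_mul]
    refine Real.exp_le_exp.2 ?_
    rw [← add_div, ← mul_div_assoc]
    gcongr
    push_cast
    linarith
  have hd0 := hd.1
  have main : 4 * kap H * E ^ 2 ≤ δ * I := by
    have h4 : Real.exp (-(1 / 4) / ε) * (4 * kap H) ≤ δ * d := by
      rw [← le_div_iff₀ (by positivity)]; exact h1.le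
    calc 4 * kap H * E ^ 2
        ≤ 4 * kap H * (Real.exp ((3 / 4) / ε) * Real.exp (-(1 / 4) / ε)) := by gcongr
      _ = Real.exp ((3 / 4) / ε) * (Real.exp (-(1 / 4) / ε) * (4 * kap H)) := by ring
      _ ≤ Real.exp ((3 / 4) / ε) * (δ * d) := by gcongr
      _ = δ * (d * Real.exp ((3 / 4) / ε)) := by ring
      _ ≤ _ := by gcongr
  have hEE : E ≤ E ^ 2 := by nlinarith
  have hf := one_div_g_mul_tau hH ε x
  rw [← hI, ← hE] at hf
  constructor
  · rw [hf, div_le_iff₀ hIpos]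
    nlinarith [mul_le_mul_of_nonneg_left hEE hk.le, mul_pos hk (lt_of_lt_of_le one_pos hE1)]
  · have : 1 / (g H ε x ^ 2 * tau H ε) = (1 / g H ε x) * (1 / (g H ε x * tau H ε)) := by
      rw [one_div_mul_one_div]; ring_nf
    rw [this, hf, one_div_g, ← hE, mul_div_assoc', div_le_iff₀ hIpos]
    calc Z H ε * E * (2 * kap H * E) = Z H ε * (2 * kap H * E ^ 2) := by ring
      _ ≤ 2 * (2 * kap H * E ^ 2) := by gcongr
      _ ≤ _ := by linarith

end Gibbs

end Kramers

/-! ### Weakly continuous curves and the continuity equation -/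

namespace Kramers

section Curves

variable {T : ℝ} {ρ : ℝ → FiniteMeasure Xi} {v : ℝ → Xi → ℝ}

lemma integrable_of_continuous (μ : Measure Xi) [IsFiniteMeasure μ] {f : Xi → ℝ}
    (hf : Continuous f) : Integrable f μ :=
  hf.integrable_of_hasCompactSupport (HasCompactSupport.of_compactSpace f)

lemma continuous_integral_finiteMeasure {f : Xi → ℝ} (hf : Continuous f) :
    Continuous fun μ : FiniteMeasure Xi => ∫ ξ, f ξ ∂(μ : Measure Xi) :=
  FiniteMeasure.continuous_integral_continuousMap (⟨f, hf⟩ : C(Xi, ℝ))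

lemma continuousOn_integral (hρ : ContinuousOn ρ (Icc 0 T)) {f : Xi → ℝ} (hf : Continuous f) :
    ContinuousOn (fun t => ∫ ξ, f ξ ∂(ρ t : Measure Xi)) (Icc 0 T) :=
  (continuous_integral_finiteMeasure hf).comp_continuousOn hρ

/-- A weakly continuous curve of measures is a finite kernel. -/
lemma exists_kernel (hρ : ContinuousOn ρ (Icc 0 T)) :
    ∃ κ : ProbabilityTheory.Kernel ℝ Xi, ProbabilityTheory.IsFiniteKernel κ ∧
      ∀ t ∈ Icc 0 T, κ t = (ρ t : Measure Xi) := by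
  classical
  -- Nothing is known about ρ outside [0, T], so it is replaced by zero there.
  let μ : ℝ → FiniteMeasure Xi := (Icc 0 T).piecewise ρ 0
  have hμ : ∀ t ∈ Icc 0 T, μ t = ρ t := fun t ht => piecewise_eq_of_mem _ _ _ ht
  have hμ' : ∀ t ∉ Icc 0 T, μ t = 0 := fun t ht => piecewise_eq_of_notMem _ _ _ ht
  have hm : ∀ f : BoundedContinuousFunction Xi ℝ≥0,
      Measurable fun t => ∫⁻ ξ, f ξ ∂(μ t : Measure Xi) := by
    intro f
    have hc : Continuous fun ν : FiniteMeasure Xi => ∫⁻ ξ, f ξ ∂(ν : Measure Xi) :=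
      FiniteMeasure.continuous_lintegral_boundedContinuousFunction f
    have := (hc.comp_continuousOn hρ).measurable_piecewise (g := fun _ => 0)
      continuousOn_const measurableSet_Icc
    convert this using 1
    ext t
    by_cases ht : t ∈ Icc 0 T
    · simp [hμ t ht, ht, -mem_Icc]
    · simp [hμ' t ht, ht, -mem_Icc]
  -- Closed sets form a generating π-system, and their indicators are pointwise limits of bounded
  -- continuous functions.
  have hF : ∀ s : Set Xi, IsClosed s → Measurable fun t => (μ t : Measure Xi) s := by
    intro s hs
    exact measurable_of_tendsto_metrizable (fun n => hm (hs.apprSeq n))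
      (tendsto_pi_nhds.2 fun t =>
        HasOuterApproxClosed.tendsto_lintegral_apprSeq hs (μ t : Measure Xi))
  have hmeas : Measurable fun t => (μ t : Measure Xi) := by
    refine Measurable.measure_of_isPiSystem (S := {s | IsClosed s}) ?_ isPiSystem_isClosed
      (fun s hs => hF s hs) (hF univ isClosed_univ)
    rw [← borel_eq_generateFrom_isClosed]
    exact BorelSpace.measurable_eq
  refine ⟨⟨fun t => μ t, hmeas⟩, ?_, fun t ht => by change (μ t : Measure Xi) = _; rw [hμ t ht]⟩
  have hb := (isCompact_Icc (a := (0 : ℝ)) (b := T)).exists_bound_of_continuousOn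
    (f := fun t => ((ρ t).mass : ℝ))
    (NNReal.continuous_coe.comp_continuousOn (FiniteMeasure.continuous_mass.comp_continuousOn hρ))
  obtain ⟨B, hB⟩ := hb
  refine ⟨⟨ENNReal.ofReal B, ENNReal.ofReal_lt_top, fun t => ?_⟩⟩
  change (μ t : Measure Xi) univ ≤ _
  by_cases ht : t ∈ Icc 0 T
  · rw [hμ t ht, ← FiniteMeasure.ennreal_mass, ← ENNReal.ofReal_coe_nnreal]
    exact ENNReal.ofReal_le_ofReal ((le_abs_self _).trans (hB t ht))
  · rw [hμ' t ht]; simp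

/-- Integration of a function of time and space that is absolutely integrable along a curve. -/
lemma integrableOn_integral_curve (hρ : ContinuousOn ρ (Icc 0 T))
    {F : ℝ → Xi → ℝ} (hF : Measurable (Function.uncurry F))
    (hi : ∫⁻ t in Ioo 0 T, ∫⁻ ξ : Xi, ‖F t ξ‖ₑ ∂(ρ t : Measure Xi) < ⊤) :
    (∀ᵐ t ∂volume.restrict (Ioo 0 T), Integrable (F t) (ρ t : Measure Xi)) ∧
      IntegrableOn (fun t => ∫ ξ, F t ξ ∂(ρ t : Measure Xi)) (Ioo 0 T) ∧
      IntegrableOn (fun t => ∫ ξ, ‖F t ξ‖ ∂(ρ t : Measure Xi)) (Ioo 0 T) := by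
  obtain ⟨κ, hκ, hκρ⟩ := exists_kernel hρ
  have hae : ∀ᵐ t ∂volume.restrict (Ioo 0 T), κ t = (ρ t : Measure Xi) := by
    filter_upwards [ae_restrict_mem measurableSet_Ioo] with t ht
    exact hκρ t (Ioo_subset_Icc_self ht)
  have hi' : Integrable (Function.uncurry F) ((volume.restrict (Ioo 0 T)).compProd κ) := by
    refine ⟨hF.aestronglyMeasurable, ?_⟩
    rw [HasFiniteIntegral, Measure.lintegral_compProd hF.enorm]
    refine lt_of_eq_of_lt (lintegral_congr_ae ?_) hi
    filter_upwards [hae] with t ht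
    simp only [ht, Function.uncurry_apply_pair]
  have h1 := (Measure.integrable_compProd_iff hF.aestronglyMeasurable).1 hi'
  refine ⟨?_, ?_, ?_⟩
  · filter_upwards [h1.1, hae] with t h2 h3
    rw [← h3]; exact h2
  · refine (integrable_congr ?_).1 hi'.integral_compProd
    filter_upwards [hae] with t ht
    simp only [ProbabilityTheory.Kernel.prodMkLeft_apply, ht, Function.uncurry_apply_pair]
  · refine (integrable_congr ?_).1 h1.2
    filter_upwards [hae] with t ht
    simp only [ht, Function.uncurry_apply_pair]

lemma SolvesCE.integrable_mul (h : SolvesCE T ρ v) {f : ℝ → ℝ} (hf : Continuous f) :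
    (∀ᵐ t ∂volume.restrict (Ioo 0 T), Integrable (fun ξ => v t ξ * f ξ) (ρ t : Measure Xi)) ∧
      IntegrableOn (fun t => ∫ ξ, v t ξ * f ξ ∂(ρ t : Measure Xi)) (Ioo 0 T) := by
  obtain ⟨B, hB⟩ := isCompact_Icc.exists_bound_of_continuousOn (s := Icc (-1 : ℝ) 1) hf.continuousOn
  have hB0 : 0 ≤ B := (norm_nonneg _).trans (hB 0 (by simp))
  have hm : Measurable (Function.uncurry fun t (ξ : Xi) => v t ξ * f ξ) :=
    h.meas.mul (hf.measurable.comp (measurable_subtype_coe.comp measurable_snd))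
  have := integrableOn_integral_curve h.cont hm (by
    refine lt_of_le_of_lt (b := ENNReal.ofReal B *
      ∫⁻ t in Ioo 0 T, ∫⁻ ξ : Xi, ‖v t ξ‖ₑ ∂(ρ t : Measure Xi)) ?_
      (ENNReal.mul_lt_top ENNReal.ofReal_lt_top h.integrable)
    rw [← lintegral_const_mul' _ _ ENNReal.ofReal_ne_top]
    refine lintegral_mono fun t => ?_
    rw [← lintegral_const_mul' _ _ ENNReal.ofReal_ne_top]
    refine lintegral_mono fun ξ => ?_
    rw [enorm_mul, mul_comm]
    gcongr
    rw [← ofReal_norm]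
    exact ENNReal.ofReal_le_ofReal (hB ξ ξ.2))
  exact ⟨this.1, this.2.1⟩

/-- Test functions χ(t)B(x)φ(x), with a cut-off B equal to 1 near Ξ and φ' = f, show that t ↦ ∫ φ
dρ(t) has the weak derivative ∫ v f dρ(t). Both sides of the integrated identity are continuous in
time, hence it holds at every t, including 0 and T. -/
lemma SolvesCE.integral_sub_of_contDiff (h : SolvesCE T ρ v) (hT : 0 < T) {f : ℝ → ℝ}
    (hf : ContDiff ℝ ∞ f) {t : ℝ} (ht : t ∈ Icc 0 T) :
    (∫ ξ : Xi, (∫ y in (-1 : ℝ)..ξ, f y) ∂(ρ t : Measure Xi))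
        - ∫ ξ : Xi, (∫ y in (-1 : ℝ)..ξ, f y) ∂(ρ 0 : Measure Xi)
      = ∫ r in 0..t, ∫ ξ : Xi, v r ξ * f ξ ∂(ρ r : Measure Xi) := by
  set φ : ℝ → ℝ := fun x => ∫ y in (-1 : ℝ)..x, f y with hφ
  have hφd : ContDiff ℝ ∞ φ := contDiff_primitive hf _
  have hφξ : Continuous fun ξ : Xi => φ ξ := hφd.continuous.comp continuous_subtype_val
  set F : ℝ → ℝ := fun t => ∫ ξ : Xi, φ ξ ∂(ρ t : Measure Xi) with hF
  set G : ℝ → ℝ := fun r => ∫ ξ : Xi, v r ξ * f ξ ∂(ρ r : Measure Xi) with hG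
  have hFc : ContinuousOn F (Icc 0 T) := continuousOn_integral h.cont hφξ
  have hFi : IntervalIntegrable F volume 0 T := by
    rw [← uIcc_of_le hT.le] at hFc; exact hFc.intervalIntegrable
  obtain ⟨hae, hGi'⟩ := h.integrable_mul hf.continuous
  have hGi : IntervalIntegrable G volume 0 T := by
    rwa [intervalIntegrable_iff_integrableOn_Ioo_of_le hT.le]
  obtain ⟨c, hc⟩ := ae_eq_primitive_of_weak_deriv hT hFi hGi (by
    intro χ hχ hχc hχs
    let B : ContDiffBump (0 : ℝ) := ⟨2, 3, by norm_num, by norm_num⟩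
    have hBd : ContDiff ℝ ∞ B := B.contDiff
    have hB1 : ∀ ξ : Xi, ∀ᶠ x in 𝓝 (ξ : ℝ), B x = 1 := by
      intro ξ
      have : Metric.ball (0 : ℝ) 2 ∈ 𝓝 (ξ : ℝ) := by
        refine Metric.isOpen_ball.mem_nhds ?_
        rw [Metric.mem_ball, Real.dist_eq, sub_zero, abs_lt]
        exact ⟨by linarith [ξ.2.1], by linarith [ξ.2.2]⟩
      filter_upwards [this] with x hx
      exact B.one_of_mem_closedBall (Metric.ball_subset_closedBall hx)
    let Φ : ℝ × ℝ → ℝ := fun z => χ z.1 * (B z.2 * φ z.2)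
    have hΦs : tsupport Φ ⊆ tsupport χ ×ˢ Metric.closedBall 0 3 := by
      refine closure_minimal ?_ ((isClosed_tsupport _).prod Metric.isClosed_closedBall)
      intro z hz
      refine ⟨subset_tsupport _ fun h0 => hz (by simp [Φ, h0]), ?_⟩
      by_contra h0
      have : B z.2 = 0 := B.zero_of_le_dist (by
        simp only [Metric.mem_closedBall, not_le] at h0; exact h0.le)
      exact hz (by simp [Φ, this])
    have hw := h.weak Φ
      ((hχ.comp contDiff_fst).mul ((hBd.comp contDiff_snd).mul (hφd.comp contDiff_snd)))
      ((hχc.isCompact.prod (isCompact_closedBall _ _)).of_isClosed_subset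
        (isClosed_tsupport _) hΦs)
      (hΦs.trans (prod_mono hχs (subset_univ _)))
    have e1 : ∀ t (ξ : Xi), deriv (fun s => Φ (s, (ξ : ℝ))) t = deriv χ t * φ ξ := by
      intro t ξ
      simp only [Φ, (hB1 ξ).self_of_nhds, one_mul]
      exact deriv_mul_const (hχ.differentiable (by simp) t) _
    have e2 : ∀ t (ξ : Xi), deriv (fun x => Φ (t, x)) (ξ : ℝ) = χ t * f ξ := by
      intro t ξ
      have hloc : (fun x => Φ (t, x)) =ᶠ[𝓝 (ξ : ℝ)] fun x => χ t * φ x := by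
        filter_upwards [hB1 ξ] with x hx
        simp [Φ, hx]
      rw [hloc.deriv_eq]
      exact ((hasDerivAt_primitive hf.continuous _ _).const_mul _).deriv
    simp only [e1, e2] at hw
    have hdc : Continuous (deriv χ) := hχ.continuous_deriv (by exact_mod_cast le_top)
    rw [← intervalIntegral.integral_add (hFi.continuousOn_mul hdc.continuousOn)
      (hGi.continuousOn_mul hχ.continuous.continuousOn),
      intervalIntegral.integral_of_le hT.le, ← restrict_Ioo_eq_restrict_Ioc]
    refine Eq.trans (integral_congr_ae ?_) hw
    filter_upwards [hae] with t ht
    simp only [hF, hG]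
    rw [← integral_const_mul, ← integral_const_mul, ← integral_add]
    · congr 1; ext ξ; ring
    · exact (integrable_of_continuous _ hφξ).const_mul _
    · exact ht.const_mul _)
  have hac := hGi.absolutelyContinuousOnInterval_intervalIntegral (left_mem_uIcc (a := 0) (b := T))
  have hcont : ContinuousOn (fun t => c + ∫ y in 0..t, G y) (Icc 0 T) := by
    have := hac.continuousOn
    rw [uIcc_of_le hT.le] at this
    exact continuousOn_const.add this
  have heq := Measure.eqOn_Icc_of_ae_eq volume hT.ne
    (by rw [← restrict_Ioo_eq_restrict_Icc]; exact hc) hFc hcont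
  have h1 := heq ht
  have h2 := heq ⟨le_rfl, hT.le⟩
  simp only [intervalIntegral.integral_same, add_zero] at h2
  change F t - F 0 = _
  rw [h1, h2]; ring

lemma SolvesCE.intervalIntegrable_mul (h : SolvesCE T ρ v) (hT : 0 ≤ T) {f : ℝ → ℝ}
    (hf : Continuous f) :
    IntervalIntegrable (fun r => ∫ ξ : Xi, v r ξ * f ξ ∂(ρ r : Measure Xi)) volume 0 T := by
  rw [intervalIntegrable_iff_integrableOn_Ioo_of_le hT]
  exact (h.integrable_mul hf).2

/-- The continuity equation tested with a `C¹` function of the space variable. -/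
lemma SolvesCE.integral_sub_zero (h : SolvesCE T ρ v) (hT : 0 < T) {f : ℝ → ℝ}
    (hf : Continuous f) {t : ℝ} (ht : t ∈ Icc 0 T) :
    (∫ ξ : Xi, (∫ y in (-1 : ℝ)..ξ, f y) ∂(ρ t : Measure Xi))
        - ∫ ξ : Xi, (∫ y in (-1 : ℝ)..ξ, f y) ∂(ρ 0 : Measure Xi)
      = ∫ r in 0..t, ∫ ξ : Xi, v r ξ * f ξ ∂(ρ r : Measure Xi) := by
  have hprim : ∀ {f : ℝ → ℝ}, Continuous f → Continuous fun ξ : Xi => ∫ y in (-1 : ℝ)..ξ, f y :=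
    fun hf => (continuous_iff_continuousAt.2 fun x =>
      (hasDerivAt_primitive hf (-1) x).continuousAt).comp continuous_subtype_val
  obtain ⟨hvi, -, hVi⟩ := integrableOn_integral_curve h.cont h.meas h.integrable
  set V := ∫ r in Ioo 0 T, ∫ ξ : Xi, ‖v r ξ‖ ∂(ρ r : Measure Xi) with hV
  have hint : ∀ {f : ℝ → ℝ}, Continuous f →
      IntervalIntegrable (fun r => ∫ ξ : Xi, v r ξ * f ξ ∂(ρ r : Measure Xi)) volume 0 t :=
    fun hf => (h.intervalIntegrable_mul hT.le hf).mono_set (by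
      rw [uIcc_of_le hT.le, uIcc_of_le ht.1]; exact Icc_subset_Icc_right ht.2)
  rw [← sub_eq_zero]
  -- K collects the effect of replacing f by a uniformly close polynomial: the primitives change by
  -- at most twice the uniform error, as Ξ has length 2, and the flux term by the uniform error
  -- times ∫∫ |v| dρ dt.
  set K := 2 * (ρ t : Measure Xi).real univ + 2 * (ρ 0 : Measure Xi).real univ + V with hK
  have hK0 : 0 ≤ K := by
    have : 0 ≤ V := integral_nonneg fun _ => integral_nonneg fun _ => norm_nonneg _
    positivity
  refine abs_eq_zero.1 (le_antisymm (le_of_forall_pos_le_add fun δ hδ => ?_) (abs_nonneg _))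
  obtain ⟨p, hp⟩ := exists_polynomial_near_of_continuousOn (-1) 1 f hf.continuousOn (δ / (K + 1))
    (by positivity)
  have hpc : Continuous fun x => p.eval x := p.continuous
  have hd := h.integral_sub_of_contDiff hT (f := fun x => p.eval x) (by
    simpa only [Polynomial.coe_aeval_eq_eval] using p.contDiff_aeval (𝕜 := ℝ) ∞) ht
  have b1 : ∀ ν : FiniteMeasure Xi, |(∫ ξ : Xi, (∫ y in (-1 : ℝ)..ξ, f y) ∂(ν : Measure Xi)) -
      ∫ ξ : Xi, (∫ y in (-1 : ℝ)..ξ, p.eval y) ∂(ν : Measure Xi)| ≤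
      δ / (K + 1) * 2 * (ν : Measure Xi).real univ := by
    intro ν
    rw [← integral_sub (integrable_of_continuous _ (hprim hf))
      (integrable_of_continuous _ (hprim hpc))]
    rw [← Real.norm_eq_abs]
    refine norm_integral_le_of_norm_le_const (Eventually.of_forall fun ξ => ?_)
    rw [← intervalIntegral.integral_sub (hf.intervalIntegrable _ _) (hpc.intervalIntegrable _ _)]
    refine (intervalIntegral.norm_integral_le_of_norm_le_const (C := δ / (K + 1))
      fun x hx => ?_).trans ?_
    · rw [uIoc_of_le ξ.2.1] at hx
      rw [Real.norm_eq_abs, abs_sub_comm]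
      exact (hp x ⟨hx.1.le, hx.2.trans ξ.2.2⟩).le
    · have : |(ξ : ℝ) - -1| ≤ 2 := by
        rw [abs_le]; constructor <;> linarith [ξ.2.1, ξ.2.2]
      gcongr
  have b2 : |(∫ r in 0..t, ∫ ξ : Xi, v r ξ * f ξ ∂(ρ r : Measure Xi)) -
      ∫ r in 0..t, ∫ ξ : Xi, v r ξ * p.eval (ξ : ℝ) ∂(ρ r : Measure Xi)| ≤ δ / (K + 1) * V := by
    rw [← intervalIntegral.integral_sub (hint hf) (hint hpc),
      intervalIntegral.integral_of_le ht.1]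
    have hsub : Ioc 0 t ⊆ Ioc 0 T := Ioc_subset_Ioc_right ht.2
    have hVi' : IntegrableOn (fun r => δ / (K + 1) * ∫ ξ : Xi, ‖v r ξ‖ ∂(ρ r : Measure Xi))
        (Ioc 0 T) := by
      rw [IntegrableOn, ← restrict_Ioo_eq_restrict_Ioc]; exact hVi.const_mul _
    rw [← Real.norm_eq_abs]
    refine (norm_integral_le_of_norm_le (hVi'.mono_set hsub) ?_).trans ?_
    · have a1 := (h.integrable_mul hf).1
      have a2 := (h.integrable_mul hpc).1
      rw [restrict_Ioo_eq_restrict_Ioc] at a1 a2 hvi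
      filter_upwards [ae_mono (Measure.restrict_mono_set _ hsub) a1,
        ae_mono (Measure.restrict_mono_set _ hsub) a2,
        ae_mono (Measure.restrict_mono_set _ hsub) hvi] with r h1 h2 h3
      rw [← integral_sub h1 h2, ← integral_const_mul]
      refine norm_integral_le_of_norm_le (h3.norm.const_mul _) (Eventually.of_forall fun ξ => ?_)
      rw [← mul_sub, norm_mul, mul_comm]
      gcongr
      rw [Real.norm_eq_abs, abs_sub_comm]
      exact (hp ξ ξ.2).le
    · rw [hV, ← integral_const_mul, restrict_Ioo_eq_restrict_Ioc]
      refine setIntegral_mono_set hVi' (Eventually.of_forall fun r => ?_) hsub.eventuallyLE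
      exact mul_nonneg (by positivity) (integral_nonneg fun _ => norm_nonneg _)
  have b3 := b1 (ρ t)
  have b4 := b1 (ρ 0)
  have hδK : δ / (K + 1) * K ≤ δ := by
    rw [div_mul_eq_mul_div, div_le_iff₀ (by positivity)]; nlinarith
  rw [zero_add]
  rw [abs_le] at *
  constructor <;> nlinarith [b2.1, b2.2, b3.1, b3.2, b4.1, b4.2]

lemma SolvesCE.integral_sub (h : SolvesCE T ρ v) (hT : 0 < T) {f : ℝ → ℝ} (hf : Continuous f)
    {s t : ℝ} (hs : s ∈ Icc 0 T) (ht : t ∈ Icc 0 T) :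
    (∫ ξ : Xi, (∫ y in (-1 : ℝ)..ξ, f y) ∂(ρ t : Measure Xi))
        - ∫ ξ : Xi, (∫ y in (-1 : ℝ)..ξ, f y) ∂(ρ s : Measure Xi)
      = ∫ r in s..t, ∫ ξ : Xi, v r ξ * f ξ ∂(ρ r : Measure Xi) := by
  have h1 := h.integral_sub_zero hT hf hs
  have h2 := h.integral_sub_zero hT hf ht
  have hi := h.intervalIntegrable_mul hT.le hf
  have hm : ∀ r ∈ Icc 0 T, IntervalIntegrable
      (fun r => ∫ ξ : Xi, v r ξ * f ξ ∂(ρ r : Measure Xi)) volume 0 r := fun r hr =>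
    hi.mono_set (by
      rw [uIcc_of_le hT.le, uIcc_of_le hr.1]; exact Icc_subset_Icc_right hr.2)
  rw [← intervalIntegral.integral_interval_sub_left (hm t ht) (hm s hs), ← h1, ← h2]
  ring

end Curves

end Kramers

/-! ### Dual lower bounds for the dissipation at a fixed time -/

namespace Kramers

section Dissipation

variable {H : ℝ → ℝ}

/-- The integrand of `J`: the dissipation at a fixed time. -/
noncomputable def diss (H : ℝ → ℝ) (ε : ℝ) (ρ : FiniteMeasure Xi) (v : Xi → ℝ) : ℝ≥0∞ :=
  ENNReal.ofReal (1 / (2 * tau H ε)) * ∫⁻ ξ : Xi, ENNReal.ofReal (v ξ ^ 2) ∂(ρ : Measure Xi)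
    + ENNReal.ofReal (2 * tau H ε) * sqrtDirichlet (gam H ε) ρ

/-- If f is not integrable, the left side is zero by convention. Hence real lower bounds can be
integrated into [0, ∞] with no integrability to check. -/
lemma ofReal_integral_le_lintegral {α : Type*} [MeasurableSpace α] {μ : Measure α} (f : α → ℝ) :
    ENNReal.ofReal (∫ x, f x ∂μ) ≤ ∫⁻ x, ENNReal.ofReal (f x) ∂μ := by
  by_cases hf : Integrable f μ
  · rw [integral_eq_lintegral_pos_part_sub_lintegral_neg_part hf]
    exact (ENNReal.ofReal_le_ofReal (sub_le_self _ ENNReal.toReal_nonneg)).trans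
      ENNReal.ofReal_toReal_le
  · simp [integral_undef hf]

lemma dens_nonneg (γ : Measure Xi) (ρ : FiniteMeasure Xi) (ξ : Xi) : 0 ≤ dens γ ρ ξ :=
  ENNReal.toReal_nonneg

lemma integral_eq_integral_dens (hH : Continuous H) {ε : ℝ} {ρ : FiniteMeasure Xi}
    (hac : (ρ : Measure Xi) ≪ gam H ε) (F : Xi → ℝ) :
    ∫ ξ, F ξ ∂(ρ : Measure Xi) = ∫ ξ, dens (gam H ε) ρ ξ * F ξ ∂(gam H ε) := by
  have := isProbabilityMeasure_gam hH ε
  exact (integral_rnDeriv_smul (f := F) hac).symm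

/-- The Fisher information dominates its tangent functionals. -/
lemma ofReal_le_sqrtDirichlet (hH : IsDoubleWell H) {ε : ℝ} (ρ : FiniteMeasure Xi) {f : ℝ → ℝ}
    (hf : Continuous f) (h0 : ∫ x in (-1 : ℝ)..1, f x = 0) :
    ENNReal.ofReal (∫ ξ : Xi, (-(tau H ε * (f ξ / g H ε ξ))
      - tau H ε / 2 * ((∫ y in (-1 : ℝ)..ξ, f y) / g H ε ξ) ^ 2) ∂(ρ : Measure Xi)) ≤
      ENNReal.ofReal (2 * tau H ε) * sqrtDirichlet (gam H ε) ρ := by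
  have hτ := tau_pos hH ε
  have hgp := g_pos hH.continuous ε
  have hgc := continuous_g hH.continuous ε
  rw [← ENNReal.div_le_iff' (by simpa using hτ) ENNReal.ofReal_ne_top]
  refine le_iInf₂ fun z hz => ?_
  rw [ENNReal.div_le_iff' (by simpa using hτ) ENNReal.ofReal_ne_top]
  obtain ⟨hac, ⟨hzac, hz2⟩, hzd⟩ := hz
  set p : ℝ → ℝ := fun x => ∫ y in (-1 : ℝ)..x, f y with hp
  have hpd : ∀ x, HasDerivAt p (f x) x := fun x => hasDerivAt_primitive hf _ x
  have hpc : Continuous p := continuous_iff_continuousAt.2 fun x => (hpd x).continuousAt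
  have hpac : AbsolutelyContinuousOnInterval p (-1) 1 :=
    (hf.intervalIntegrable _ _).absolutelyContinuousOnInterval_intervalIntegral left_mem_uIcc
  have hsq : Integrable (fun x => deriv z x ^ 2) (volume.restrict (Ioo (-1 : ℝ) 1)) :=
    hz2.integrable_sq
  have hz1 : IntegrableOn (deriv z) (Ioo (-1 : ℝ) 1) := hz2.integrable (by norm_num)
  have hzc : ContinuousOn z (uIcc (-1) 1) := hzac.continuousOn
  have hz1' : IntervalIntegrable (deriv z) volume (-1) 1 :=
    (intervalIntegrable_iff_integrableOn_Ioo_of_le (by norm_num)).2 hz1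
  have hsq' : IntervalIntegrable (fun x => deriv z x ^ 2) volume (-1) 1 :=
    (intervalIntegrable_iff_integrableOn_Ioo_of_le (by norm_num)).2 hsq
  have e1 : ∫ ξ : Xi, (-(tau H ε * (f ξ / g H ε ξ)) - tau H ε / 2 * (p ξ / g H ε ξ) ^ 2)
      ∂(ρ : Measure Xi) =
      ∫ x in (-1 : ℝ)..1, (-(tau H ε) * (f x * z x ^ 2)
        - tau H ε / 2 * (p x ^ 2 * z x ^ 2 / g H ε x)) := by
    rw [integral_eq_integral_dens hH.continuous hac]
    have : ∫ ξ : Xi, dens (gam H ε) ρ ξ *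
        (-(tau H ε * (f ξ / g H ε ξ)) - tau H ε / 2 * (p ξ / g H ε ξ) ^ 2) ∂(gam H ε) =
        ∫ ξ : Xi, z ξ ^ 2 *
        (-(tau H ε * (f ξ / g H ε ξ)) - tau H ε / 2 * (p ξ / g H ε ξ) ^ 2) ∂(gam H ε) := by
      refine integral_congr_ae ?_
      filter_upwards [hzd] with ξ hξ
      rw [hξ, Real.sq_sqrt (dens_nonneg _ _ _)]
    rw [this, integral_gam hH.continuous ε (fun x => z x ^ 2 *
        (-(tau H ε * (f x / g H ε x)) - tau H ε / 2 * (p x / g H ε x) ^ 2))]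
    congr 1; ext x
    have := (hgp x).ne'
    field_simp
  -- There are no boundary terms: p(-1) = 0 by construction and p(1) = 0 by the mean-zero condition
  -- `h0`.
  have e2 : ∫ x in (-1 : ℝ)..1, f x * z x ^ 2 = -∫ x in (-1 : ℝ)..1, 2 * (z x * deriv z x * p x) := by
    have hzz : AbsolutelyContinuousOnInterval (fun x => z x * z x) (-1) 1 := hzac.mul hzac
    have := hzz.integral_mul_deriv_eq_deriv_mul hpac
    have hp1 : p 1 = 0 := h0
    have hp0 : p (-1) = 0 := by simp [hp]
    rw [hp1, hp0, mul_zero, mul_zero, sub_zero, zero_sub] at this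
    have l : ∫ x in (-1 : ℝ)..1, f x * z x ^ 2 = ∫ x in (-1 : ℝ)..1, z x * z x * deriv p x := by
      congr 1; ext x; rw [(hpd x).deriv]; ring
    rw [l, this]
    congr 1
    refine intervalIntegral.integral_congr_ae ?_
    filter_upwards [hzac.ae_differentiableAt] with x hx hx'
    have hd := (hx (uIoc_subset_uIcc hx')).hasDerivAt
    rw [(hd.fun_mul hd).deriv]; ring
  have i1 : IntervalIntegrable (fun x => f x * z x ^ 2) volume (-1) 1 :=
    (hf.continuousOn.mul (hzc.pow 2)).intervalIntegrable
  have i2 : IntervalIntegrable (fun x => p x ^ 2 * z x ^ 2 / g H ε x) volume (-1) 1 :=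
    (((hpc.pow 2).continuousOn.mul (hzc.pow 2)).div hgc.continuousOn
      fun x _ => (hgp x).ne').intervalIntegrable
  have i3 : IntervalIntegrable (fun x => 2 * (z x * deriv z x * p x)) volume (-1) 1 :=
    ((hz1'.continuousOn_mul hzc).mul_continuousOn hpc.continuousOn).const_mul _
  have i4 : IntervalIntegrable (fun x => 2 * tau H ε * (g H ε x * deriv z x ^ 2)) volume (-1) 1 :=
    (hsq'.continuousOn_mul hgc.continuousOn).const_mul _
  have e3 : ∫ x in (-1 : ℝ)..1, (-(tau H ε) * (f x * z x ^ 2)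
        - tau H ε / 2 * (p x ^ 2 * z x ^ 2 / g H ε x)) ≤
      ∫ x in (-1 : ℝ)..1, 2 * tau H ε * (g H ε x * deriv z x ^ 2) := by
    rw [intervalIntegral.integral_sub (i1.const_mul _) (i2.const_mul _),
      intervalIntegral.integral_const_mul, e2, neg_mul_neg, ← intervalIntegral.integral_const_mul,
      ← intervalIntegral.integral_sub (i3.const_mul _) (i2.const_mul _)]
    refine intervalIntegral.integral_mono_on (by norm_num) ((i3.const_mul _).sub (i2.const_mul _))
      i4 fun x _ => ?_
    have hg := hgp x
    -- The duality gap is a square, which vanishes exactly when p z = 2 g z'.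
    have key : 2 * tau H ε * (g H ε x * deriv z x ^ 2) - (tau H ε * (2 * (z x * deriv z x * p x))
        - tau H ε / 2 * (p x ^ 2 * z x ^ 2 / g H ε x)) =
        tau H ε / (2 * g H ε x) * (2 * g H ε x * deriv z x - p x * z x) ^ 2 := by
      field_simp; ring
    have : 0 ≤ tau H ε / (2 * g H ε x) * (2 * g H ε x * deriv z x - p x * z x) ^ 2 := by
      positivity
    linarith
  rw [e1]
  refine (ENNReal.ofReal_le_ofReal e3).trans ?_
  rw [intervalIntegral.integral_of_le (by norm_num), ← restrict_Ioo_eq_restrict_Ioc]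
  refine (ofReal_integral_le_lintegral _).trans (le_of_eq ?_)
  rw [lintegral_gam hH.continuous ε (fun x => ENNReal.ofReal (deriv z x ^ 2)),
    ← lintegral_const_mul' _ _ ENNReal.ofReal_ne_top]
  congr 1; ext x
  rw [← ENNReal.ofReal_mul (hgp x).le, ← ENNReal.ofReal_mul (by positivity)]

/-- The Fenchel inequality v²/(2τ) ≥ vα - τα²/2 is added to the tangent bound for the Fisher
information. The functions α and f are independent of each other, and the left side is linear in ρ
and ρv. -/
lemma ofReal_le_diss (hH : IsDoubleWell H) {ε : ℝ} (ρ : FiniteMeasure Xi) {v : Xi → ℝ}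
    (hv : Measurable v) {α : ℝ → ℝ} (hα : Continuous α) {f : ℝ → ℝ}
    (hf : Continuous f) (h0 : ∫ x in (-1 : ℝ)..1, f x = 0) :
    ENNReal.ofReal ((∫ ξ : Xi, v ξ * α ξ ∂(ρ : Measure Xi)) +
      ∫ ξ : Xi, (-(tau H ε / 2 * α ξ ^ 2) - tau H ε * (f ξ / g H ε ξ)
      - tau H ε / 2 * ((∫ y in (-1 : ℝ)..ξ, f y) / g H ε ξ) ^ 2) ∂(ρ : Measure Xi)) ≤
      diss H ε ρ v := by
  have hτ := tau_pos hH ε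
  have hgc := continuous_g hH.continuous ε
  have hgp := g_pos hH.continuous ε
  have hαξ : Continuous fun ξ : Xi => α ξ := hα.comp continuous_subtype_val
  unfold diss
  -- With infinite kinetic energy nothing is to be shown; otherwise v ∈ L²(ρ), which justifies
  -- splitting the integrals.
  by_cases hfin : ∫⁻ ξ : Xi, ENNReal.ofReal (v ξ ^ 2) ∂(ρ : Measure Xi) = ⊤
  · rw [hfin, ENNReal.mul_top (by simpa using hτ), top_add]
    exact le_top
  have hv2 : Integrable (fun ξ => v ξ ^ 2) (ρ : Measure Xi) := by
    refine ⟨(hv.pow_const 2).aestronglyMeasurable, ?_⟩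
    rw [hasFiniteIntegral_iff_ofReal (Eventually.of_forall fun ξ => sq_nonneg _)]
    exact lt_top_iff_ne_top.2 hfin
  have hvm : MemLp v 2 (ρ : Measure Xi) :=
    (memLp_two_iff_integrable_sq hv.aestronglyMeasurable).2 hv2
  have hvα : Integrable (fun ξ => v ξ * α ξ) (ρ : Measure Xi) :=
    hvm.integrable_mul ((memLp_two_iff_integrable_sq hαξ.aestronglyMeasurable).2
      (integrable_of_continuous _ (hαξ.pow 2)))
  have hα2 : Integrable (fun ξ : Xi => tau H ε / 2 * α ξ ^ 2) (ρ : Measure Xi) :=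
    integrable_of_continuous _ (by fun_prop)
  have hfg : Integrable (fun ξ : Xi => -(tau H ε * (f ξ / g H ε ξ))
      - tau H ε / 2 * ((∫ y in (-1 : ℝ)..ξ, f y) / g H ε ξ) ^ 2) (ρ : Measure Xi) := by
    have hpc : Continuous fun x => ∫ y in (-1 : ℝ)..x, f y := continuous_iff_continuousAt.2
      fun x => (hasDerivAt_primitive hf _ x).continuousAt
    have h1 : Continuous fun x => -(tau H ε * (f x / g H ε x))
      - tau H ε / 2 * ((∫ y in (-1 : ℝ)..x, f y) / g H ε x) ^ 2 :=
      ((continuous_const.mul (hf.div hgc fun x => (hgp x).ne')).neg).sub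
        (continuous_const.mul ((hpc.div hgc fun x => (hgp x).ne').pow 2))
    exact integrable_of_continuous _ (h1.comp continuous_subtype_val)
  have hsplit : (∫ ξ : Xi, v ξ * α ξ ∂(ρ : Measure Xi)) +
      ∫ ξ : Xi, (-(tau H ε / 2 * α ξ ^ 2) - tau H ε * (f ξ / g H ε ξ)
      - tau H ε / 2 * ((∫ y in (-1 : ℝ)..ξ, f y) / g H ε ξ) ^ 2) ∂(ρ : Measure Xi) =
      (∫ ξ : Xi, (v ξ * α ξ - tau H ε / 2 * α ξ ^ 2) ∂(ρ : Measure Xi)) +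
      ∫ ξ : Xi, (-(tau H ε * (f ξ / g H ε ξ))
      - tau H ε / 2 * ((∫ y in (-1 : ℝ)..ξ, f y) / g H ε ξ) ^ 2) ∂(ρ : Measure Xi) := by
    have e1 : ∫ ξ : Xi, (-(tau H ε / 2 * α ξ ^ 2) - tau H ε * (f ξ / g H ε ξ)
        - tau H ε / 2 * ((∫ y in (-1 : ℝ)..ξ, f y) / g H ε ξ) ^ 2) ∂(ρ : Measure Xi) =
        (∫ ξ : Xi, (-(tau H ε * (f ξ / g H ε ξ))
          - tau H ε / 2 * ((∫ y in (-1 : ℝ)..ξ, f y) / g H ε ξ) ^ 2) ∂(ρ : Measure Xi)) -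
        ∫ ξ : Xi, tau H ε / 2 * α ξ ^ 2 ∂(ρ : Measure Xi) := by
      rw [← integral_sub hfg hα2]
      congr 1; ext ξ; ring
    rw [e1, integral_sub hvα hα2]
    ring
  rw [hsplit]
  refine ENNReal.ofReal_add_le.trans (add_le_add ?_ (ofReal_le_sqrtDirichlet hH ρ hf h0))
  rw [← lintegral_const_mul' _ _ ENNReal.ofReal_ne_top]
  refine (ofReal_integral_le_lintegral _).trans (lintegral_mono fun ξ => ?_)
  rw [← ENNReal.ofReal_mul (by positivity)]
  refine ENNReal.ofReal_le_ofReal ?_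
  have key : 1 / (2 * tau H ε) * v ξ ^ 2 - (v ξ * α ξ - tau H ε / 2 * α ξ ^ 2) =
    1 / (2 * tau H ε) * (v ξ - tau H ε * α ξ) ^ 2 := by field_simp; ring
  have : 0 ≤ 1 / (2 * tau H ε) * (v ξ - tau H ε * α ξ) ^ 2 := by positivity
  linarith

end Dissipation

end Kramers

/-! ### Regularity of measures with finite Fisher information, stated by duality -/

namespace Kramers

section FiniteFisher

variable {H : ℝ → ℝ}

/-- Smooth functions with compact support in `(-1, 1)`. -/
def testFunctions : Submodule ℝ (ℝ → ℝ) where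
  carrier := {p | ContDiff ℝ ∞ p ∧ HasCompactSupport p ∧ tsupport p ⊆ Ioo (-1) 1}
  add_mem' := fun ⟨h1, h2, h3⟩ ⟨h4, h5, h6⟩ =>
    ⟨h1.add h4, h2.add h5, (tsupport_add _ _).trans (union_subset h3 h6)⟩
  zero_mem' := ⟨contDiff_const, HasCompactSupport.zero, by simp [tsupport]⟩
  smul_mem' := fun c p ⟨h1, h2, h3⟩ => ⟨contDiff_const.smul h1, h2.smul_left,
    (closure_mono (Function.support_const_smul_subset c p)).trans h3⟩

lemma integral_eq_integral_rnDeriv (hH : Continuous H) {ε : ℝ} {μ : Measure Xi} [IsFiniteMeasure μ]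
    (hac : μ ≪ gam H ε) {U : ℝ → ℝ} (hU : ∀ᵐ ξ : Xi ∂(gam H ε), U ξ = (μ.rnDeriv (gam H ε) ξ).toReal)
    (F : ℝ → ℝ) :
    ∫ ξ : Xi, F ξ ∂μ = ∫ x in (-1 : ℝ)..1, g H ε x * (U x * F x) := by
  have := isProbabilityMeasure_gam hH ε
  rw [← integral_gam hH ε (fun x => U x * F x), ← integral_rnDeriv_smul hac]
  refine integral_congr_ae ?_
  filter_upwards [hU] with ξ h
  rw [h, smul_eq_mul]

lemma integrable_iff_rnDeriv (hH : Continuous H) {ε : ℝ} {μ : Measure Xi} [IsFiniteMeasure μ]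
    (hac : μ ≪ gam H ε) {U : ℝ → ℝ} (hU : ∀ᵐ ξ : Xi ∂(gam H ε), U ξ = (μ.rnDeriv (gam H ε) ξ).toReal)
    (F : ℝ → ℝ) :
    Integrable (fun ξ : Xi => F ξ) μ ↔
      IntervalIntegrable (fun x => U x * F x) volume (-1) 1 := by
  have := isProbabilityMeasure_gam hH ε
  have hgc := continuous_g hH ε
  have hgp := g_pos hH ε
  rw [← integrable_rnDeriv_smul_iff hac]
  have h1 : Integrable (fun x => (μ.rnDeriv (gam H ε) x).toReal • F x) (gam H ε) ↔
      Integrable (fun ξ : Xi => U ξ * F ξ) (gam H ε) := by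
    refine integrable_congr ?_
    filter_upwards [hU] with ξ h
    rw [h, smul_eq_mul]
  rw [h1, integrable_gam_iff hH ε (fun x => U x * F x)]
  refine ⟨fun h => ?_, fun h => h.continuousOn_mul hgc.continuousOn⟩
  refine (h.continuousOn_mul (continuous_one_div_g hH ε).continuousOn).congr fun x _ => ?_
  have := (hgp x).ne'
  field_simp

/-- A measure with finite Fisher information has an absolutely continuous density `u`, and
`u' / u` is square-integrable. -/
lemma exists_density_of_fisher (hH : IsDoubleWell H) {ε : ℝ} {μ : Measure Xi} [IsFiniteMeasure μ]
    (hac : μ ≪ gam H ε) {K : ℝ}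
    (hQ : ∀ p ∈ testFunctions, (-(tau H ε * ∫ ξ : Xi, deriv p ξ / g H ε ξ ∂μ)) -
      tau H ε / 2 * ∫ ξ : Xi, (p ξ / g H ε ξ) ^ 2 ∂μ ≤ K) :
    ∃ u Y : ℝ → ℝ, AbsolutelyContinuousOnInterval u (-1) 1 ∧ (∀ x ∈ Icc (-1 : ℝ) 1, 0 ≤ u x) ∧
      (∀ᵐ ξ : Xi ∂(gam H ε), u ξ = (μ.rnDeriv (gam H ε) ξ).toReal) ∧
      (∀ᵐ x : ℝ, x ∈ Icc (-1 : ℝ) 1 → deriv u x = -(u x * Y x)) ∧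
      IntervalIntegrable (fun x => u x * Y x) volume (-1) 1 ∧
      Integrable (fun ξ : Xi => Y ξ ^ 2) μ ∧ ∫ ξ : Xi, Y ξ ^ 2 ∂μ ≤ 2 * K / tau H ε := by
  have hHc := hH.continuous
  have hτ := tau_pos hH ε
  have hgc := continuous_g hHc ε
  have hgp := g_pos hHc ε
  have hprob := isProbabilityMeasure_gam hHc ε
  let U : ℝ → ℝ := Function.extend ((↑) : Xi → ℝ)
    (fun ξ => (μ.rnDeriv (gam H ε) ξ).toReal) 0
  have hUξ : ∀ ξ : Xi, U ξ = (μ.rnDeriv (gam H ε) ξ).toReal := fun ξ =>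
    Subtype.val_injective.extend_apply _ _ ξ
  have hU := Eventually.of_forall (f := ae (gam H ε)) hUξ
  have hU0 : ∀ x, 0 ≤ U x := by
    intro x
    by_cases hx : x ∈ Icc (-1 : ℝ) 1
    · exact (hUξ ⟨x, hx⟩).symm ▸ ENNReal.toReal_nonneg
    · refine (show U x = 0 from Function.extend_apply' _ _ _ ?_).ge
      rintro ⟨ξ, rfl⟩; exact hx ξ.2
  have hpg : ∀ p : ℝ → ℝ, Continuous p → Continuous fun x => p x / g H ε x := fun p hp =>
    hp.div hgc fun x => (hgp x).ne'
  have hpgξ : ∀ p : ℝ → ℝ, Continuous p → Continuous fun ξ : Xi => p ξ / g H ε ξ := fun p hp =>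
    (hpg p hp).comp continuous_subtype_val
  have hmem : ∀ p : ℝ → ℝ, Continuous p → MemLp (fun ξ : Xi => p ξ / g H ε ξ) 2 μ := fun p hp =>
    (memLp_two_iff_integrable_sq (hpgξ p hp).aestronglyMeasurable).2
      (integrable_of_continuous _ ((hpgξ p hp).pow 2))
  have hcont : ∀ p : testFunctions, Continuous (p : ℝ → ℝ) := fun p => p.2.1.continuous
  have hdc : ∀ p : testFunctions, Continuous (deriv (p : ℝ → ℝ)) := fun p =>
    p.2.1.continuous_deriv (by exact_mod_cast le_top)
  have hdiff : ∀ p : testFunctions, Differentiable ℝ (p : ℝ → ℝ) := fun p =>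
    p.2.1.differentiable (by simp)
  have hint : ∀ p : testFunctions, Integrable (fun ξ : Xi => deriv (p : ℝ → ℝ) ξ / g H ε ξ) μ :=
    fun p => integrable_of_continuous _ (hpgξ _ (hdc p))
  let Φ : testFunctions →ₗ[ℝ] Lp ℝ 2 μ :=
    { toFun := fun p => (hmem p (hcont p)).toLp
      map_add' := fun p q => by
        rw [← MemLp.toLp_add]
        refine MemLp.toLp_congr _ _ (Eventually.of_forall fun ξ => ?_)
        simp [add_div]
      map_smul' := fun c p => by
        rw [RingHom.id_apply, ← MemLp.toLp_const_smul]
        refine MemLp.toLp_congr _ _ (Eventually.of_forall fun ξ => ?_)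
        simp [mul_div_assoc] }
  let ℓ : testFunctions →ₗ[ℝ] ℝ :=
    { toFun := fun p => ∫ ξ : Xi, deriv (p : ℝ → ℝ) ξ / g H ε ξ ∂μ
      map_add' := fun p q => by
        rw [← integral_add (hint p) (hint q)]
        congr 1; ext ξ
        rw [Submodule.coe_add, deriv_add (hdiff p _) (hdiff q _), add_div]
      map_smul' := fun c p => by
        rw [RingHom.id_apply, smul_eq_mul, ← integral_const_mul]
        congr 1; ext ξ
        rw [Submodule.coe_smul, deriv_const_smul _ (hdiff p _), smul_eq_mul, mul_div_assoc] }
  have hΦ : ∀ p : testFunctions, ‖Φ p‖ ^ 2 = ∫ ξ : Xi, ((p : ℝ → ℝ) ξ / g H ε ξ) ^ 2 ∂μ := by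
    intro p
    rw [← real_inner_self_eq_norm_sq, L2.inner_def]
    refine integral_congr_ae ?_
    filter_upwards [(hmem p (hcont p)).coeFn_toLp] with ξ hξ
    simp only [Φ, LinearMap.coe_mk, AddHom.coe_mk]
    rw [hξ, real_inner_self_eq_norm_sq, Real.norm_eq_abs, sq_abs]
  have hQ' : ∀ p : testFunctions, -(tau H ε * ℓ p) - tau H ε / 2 * ‖Φ p‖ ^ 2 ≤ K := fun p => by
    rw [hΦ]; exact hQ p p.2
  have hK : 0 ≤ K := by
    have := hQ' 0
    simpa using this
  have hbound : ∀ p : testFunctions, |ℓ p| ≤ √(2 * K / tau H ε) * ‖Φ p‖ := by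
    intro p
    -- The bound `hQ` for all multiples of p makes this quadratic polynomial nonnegative; its
    -- discriminant yields the homogeneous estimate that the Riesz argument needs.
    have h1 : ∀ x : ℝ, 0 ≤ (tau H ε / 2 * ‖Φ p‖ ^ 2) * (x * x) + (tau H ε * ℓ p) * x + K := by
      intro x
      have := hQ' (x • p)
      rw [map_smul, map_smul, norm_smul, smul_eq_mul, mul_pow, Real.norm_eq_abs, sq_abs] at this
      nlinarith
    have h2 := discrim_le_zero h1
    rw [discrim] at h2
    refine abs_le_of_sq_le_sq ?_ (by positivity)
    rw [mul_pow, Real.sq_sqrt (by positivity), div_mul_eq_mul_div, le_div_iff₀ hτ]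
    have : tau H ε * (ℓ p ^ 2 * tau H ε) ≤ tau H ε * (2 * K * ‖Φ p‖ ^ 2) := by nlinarith
    exact le_of_mul_le_mul_left this hτ
  obtain ⟨y, hyn, hy⟩ := exists_riesz Φ ℓ _ (Real.sqrt_nonneg _) hbound
  let Y : ℝ → ℝ := Function.extend ((↑) : Xi → ℝ) y 0
  have hYξ : ∀ ξ : Xi, Y ξ = y ξ := fun ξ => Subtype.val_injective.extend_apply _ _ ξ
  have hy2 : MemLp y 2 μ := Lp.memLp y
  have hY1 : Integrable (fun ξ : Xi => Y ξ) μ := by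
    simp only [hYξ]; exact hy2.integrable (by norm_num)
  have hY2 : Integrable (fun ξ : Xi => Y ξ ^ 2) μ := by
    simp only [hYξ]; exact hy2.integrable_sq
  have hYn : ∫ ξ : Xi, Y ξ ^ 2 ∂μ ≤ 2 * K / tau H ε := by
    have : ∫ ξ : Xi, Y ξ ^ 2 ∂μ = ‖y‖ ^ 2 := by
      rw [← real_inner_self_eq_norm_sq, L2.inner_def]
      refine integral_congr_ae (Eventually.of_forall fun ξ => ?_)
      simp [hYξ, sq]
    rw [this]
    calc ‖y‖ ^ 2 ≤ √(2 * K / tau H ε) ^ 2 := by gcongr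
      _ = _ := Real.sq_sqrt (by positivity)
  have hUi : IntervalIntegrable U volume (-1) 1 := by
    have := (integrable_iff_rnDeriv hHc hac hU (fun _ => 1)).1 (integrable_const 1)
    simpa using this
  have hUYi : IntervalIntegrable (fun x => U x * Y x) volume (-1) 1 :=
    (integrable_iff_rnDeriv hHc hac hU Y).1 hY1
  -- The weight g cancels: ℓ is ∫ χ' U dx by its definition and ∫ χ U Y dx by the representation. So
  -- the weak derivative of U is -UY.
  obtain ⟨c, hc⟩ := ae_eq_primitive_of_weak_deriv (by norm_num) hUi hUYi.neg (by
    intro χ h1 h2 h3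
    let p : testFunctions := ⟨χ, h1, h2, h3⟩
    have e1 : ℓ p = ∫ x in (-1 : ℝ)..1, deriv χ x * U x := by
      change ∫ ξ : Xi, deriv χ ξ / g H ε ξ ∂μ = _
      rw [integral_eq_integral_rnDeriv hHc hac hU (fun x => deriv χ x / g H ε x)]
      congr 1; ext x
      have := (hgp x).ne'
      field_simp
    have e2 : ℓ p = ∫ x in (-1 : ℝ)..1, χ x * (U x * Y x) := by
      rw [hy p, L2.inner_def]
      have : ∫ ξ : Xi, inner ℝ (y ξ) (Φ p ξ) ∂μ = ∫ ξ : Xi, Y ξ * (χ ξ / g H ε ξ) ∂μ := by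
        refine integral_congr_ae ?_
        filter_upwards [(hmem p (hcont p)).coeFn_toLp] with ξ hξ
        simp only [Φ, LinearMap.coe_mk, AddHom.coe_mk]
        rw [hξ, hYξ]
        simp [p, mul_comm]
      rw [this, integral_eq_integral_rnDeriv hHc hac hU (fun x => Y x * (χ x / g H ε x))]
      congr 1; ext x
      have := (hgp x).ne'
      field_simp
    rw [← e1, e2, ← intervalIntegral.integral_add]
    · simp
    · exact hUYi.continuousOn_mul h1.continuous.continuousOn
    · exact hUYi.neg.continuousOn_mul h1.continuous.continuousOn)
  let u : ℝ → ℝ := fun x => c + ∫ s in (-1 : ℝ)..x, -(U s * Y s)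
  have huac : AbsolutelyContinuousOnInterval u (-1) 1 := by
    have h1 := hUYi.neg.absolutelyContinuousOnInterval_intervalIntegral
      (left_mem_uIcc (a := (-1 : ℝ)) (b := 1))
    have h2 : AbsolutelyContinuousOnInterval (fun _ : ℝ => c) (-1) 1 :=
      (contDiff_const.contDiffOn (n := 1)).absolutelyContinuousOnInterval
    exact h2.add h1
  have huU : ∀ᵐ x ∂volume.restrict (Ioo (-1 : ℝ) 1), U x = u x := hc
  have hucont : ContinuousOn u (Icc (-1) 1) := by
    have := huac.continuousOn
    rwa [uIcc_of_le (by norm_num)] at this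
  have hu0 : ∀ x ∈ Icc (-1 : ℝ) 1, 0 ≤ u x := by
    have heq := Measure.eqOn_Icc_of_ae_eq volume (by norm_num : (-1 : ℝ) ≠ 1) (f := u)
      (g := fun x => |u x|) (by
        rw [← restrict_Ioo_eq_restrict_Icc]
        filter_upwards [huU] with x hx
        rw [← hx, abs_of_nonneg (hU0 x)]) hucont hucont.abs
    intro x hx
    rw [heq hx]; exact abs_nonneg _
  have huU' : ∀ᵐ x : ℝ, x ∈ Icc (-1 : ℝ) 1 → U x = u x := by
    rw [← ae_restrict_iff' measurableSet_Icc, ← restrict_Ioo_eq_restrict_Icc]; exact huU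
  refine ⟨u, Y, huac, hu0, ?_, ?_, ?_, hY2, hYn⟩
  · filter_upwards [(ae_gam_iff hHc ε (fun x => U x = u x)).2 huU] with ξ hξ
    rw [← hξ, hUξ]
  · filter_upwards [hUYi.neg.ae_hasDerivAt_integral, huU'] with x h1 h2 hx
    rw [← uIcc_of_le (by norm_num : (-1 : ℝ) ≤ 1)] at hx
    have h3 := (h1 hx (-1) left_mem_uIcc).const_add c
    rw [uIcc_of_le (by norm_num)] at hx
    rw [← h2 hx]
    exact h3.deriv
  · refine hUYi.congr_ae ?_
    rw [uIoc_of_le (by norm_num), ← restrict_Ioo_eq_restrict_Ioc]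
    filter_upwards [huU] with x hx
    rw [hx]

end FiniteFisher

end Kramers

/-! ### One implicit step of the entropy estimate -/

namespace Kramers

section Entropy

variable {H : ℝ → ℝ}

/-- The convex function `(1 + u) log (1 + u) - u`. -/
noncomputable def eta (u : ℝ) : ℝ := (1 + u) * Real.log (1 + u) - u

/-- A regularized relative entropy. -/
noncomputable def regEntropy (γ μ : Measure Xi) : ℝ≥0∞ :=
  ∫⁻ ξ, ENNReal.ofReal (eta (μ.rnDeriv γ ξ).toReal) ∂γ

/-- This is convexity of `eta`, whose derivative is log(1 + u), obtained from log x ≤ x - 1 at x =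
(1 + u)/(1 + w). Unlike log u, this derivative stays finite at u = 0, so it can serve as a test
function. -/
lemma eta_tangent {u w : ℝ} (hu : 0 ≤ u) (hw : 0 ≤ w) :
    eta u + Real.log (1 + u) * (w - u) ≤ eta w := by
  have h1 : Real.log ((1 + u) / (1 + w)) ≤ (1 + u) / (1 + w) - 1 :=
    Real.log_le_sub_one_of_pos (by positivity)
  rw [Real.log_div (by positivity) (by positivity)] at h1
  have h2 : (1 + w) * (Real.log (1 + u) - Real.log (1 + w)) ≤ u - w := by
    calc _ ≤ (1 + w) * ((1 + u) / (1 + w) - 1) := by gcongr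
      _ = u - w := by field_simp; ring
  unfold eta
  nlinarith

lemma eta_nonneg {u : ℝ} (hu : 0 ≤ u) : 0 ≤ eta u := by
  have := eta_tangent le_rfl hu
  simpa [eta] using this

/-- The function log(1 + ·) is 1-Lipschitz on [0, ∞). -/
lemma AbsolutelyContinuousOnInterval.log_one_add {u : ℝ → ℝ} {a b : ℝ}
    (hu : AbsolutelyContinuousOnInterval u a b) (h0 : ∀ x ∈ uIcc a b, 0 ≤ u x) :
    AbsolutelyContinuousOnInterval (fun x => Real.log (1 + u x)) a b := by
  rw [absolutelyContinuousOnInterval_iff] at hu ⊢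
  have key : ∀ {s t : ℝ}, 0 ≤ s → 0 ≤ t → Real.log (1 + s) - Real.log (1 + t) ≤ |s - t| := by
    intro s t hs ht
    rw [← Real.log_div (by positivity) (by positivity)]
    have h1 : Real.log ((1 + s) / (1 + t)) ≤ (1 + s) / (1 + t) - 1 :=
      Real.log_le_sub_one_of_pos (by positivity)
    have h2 : (1 + s) / (1 + t) - 1 = (s - t) / (1 + t) := by field_simp; ring
    refine h1.trans (h2.trans_le ?_)
    rw [div_le_iff₀ (by positivity)]
    nlinarith [le_abs_self (s - t), abs_nonneg (s - t)]
  intro ε hε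
  obtain ⟨δ, hδ, h⟩ := hu ε hε
  refine ⟨δ, hδ, fun E hE hEδ => lt_of_le_of_lt (Finset.sum_le_sum fun i hi => ?_) (h E hE hEδ)⟩
  have h1 := h0 _ (hE.1 i hi).1
  have h2 := h0 _ (hE.1 i hi).2
  rw [Real.dist_eq, Real.dist_eq, abs_sub_le_iff]
  exact ⟨key h1 h2, abs_sub_comm (u _) (u _) ▸ key h2 h1⟩

/-- Formally `hP` is used with f = (log(1 + u))', for which |f| ≤ |Y|. This derivative is only
square-integrable, so it is approximated by continuous functions in L² and the error is sent to
zero. Equality of the masses removes the constant of integration. -/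
lemma integral_log_density_le (hH : IsDoubleWell H) {ε : ℝ} {μ₀ μ₁ : Measure Xi}
    [IsFiniteMeasure μ₀] [IsFiniteMeasure μ₁] (hac : μ₁ ≪ gam H ε)
    (hmass : μ₀ univ = μ₁ univ) {P S θ : ℝ} (hθ : 0 ≤ θ)
    (hP : ∀ f : ℝ → ℝ, Continuous f → (∫ ξ : Xi, (∫ y in (-1 : ℝ)..ξ, f y) ∂μ₁) -
      ∫ ξ : Xi, (∫ y in (-1 : ℝ)..ξ, f y) ∂μ₀ ≤ P + θ * ∫ ξ : Xi, f ξ ^ 2 ∂μ₁)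
    {u Y : ℝ → ℝ} (huac : AbsolutelyContinuousOnInterval u (-1) 1)
    (hu0 : ∀ x ∈ Icc (-1 : ℝ) 1, 0 ≤ u x)
    (hu : ∀ᵐ ξ : Xi ∂(gam H ε), u ξ = (μ₁.rnDeriv (gam H ε) ξ).toReal)
    (hd : ∀ᵐ x : ℝ, x ∈ Icc (-1 : ℝ) 1 → deriv u x = -(u x * Y x))
    (hY : Integrable (fun ξ : Xi => Y ξ ^ 2) μ₁) (hYS : ∫ ξ : Xi, Y ξ ^ 2 ∂μ₁ ≤ S) :
    (∫ ξ : Xi, Real.log (1 + u ξ) ∂μ₁) - ∫ ξ : Xi, Real.log (1 + u ξ) ∂μ₀ ≤ P + θ * S := by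
  have hHc := hH.continuous
  have hgc := continuous_g hHc ε
  have hgp := g_pos hHc ε
  have hI : uIcc (-1 : ℝ) 1 = Icc (-1) 1 := uIcc_of_le (by norm_num)
  have hucont : ContinuousOn u (Icc (-1) 1) := hI ▸ huac.continuousOn
  set φ : ℝ → ℝ := fun x => Real.log (1 + u x) with hφ
  have hφac : AbsolutelyContinuousOnInterval φ (-1) 1 :=
    AbsolutelyContinuousOnInterval.log_one_add huac (by rwa [hI])
  set ψ : ℝ → ℝ := deriv φ with hψ
  have hψd : ∀ᵐ x : ℝ, x ∈ Icc (-1 : ℝ) 1 → ψ x = -(u x * Y x) / (1 + u x) := by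
    filter_upwards [hd, huac.ae_differentiableAt] with x h1 h2 hx
    have h3 := (h2 (hI ▸ hx)).hasDerivAt
    rw [h1 hx] at h3
    have h4 := hu0 x hx
    exact ((h3.const_add 1).log (by positivity)).deriv
  -- The first bound puts ψ in L²(dx), so that it can be approximated; the second one is the
  -- estimate in L²(μ₁).
  have hψ1 : ∀ᵐ x : ℝ, x ∈ Icc (-1 : ℝ) 1 → ψ x ^ 2 ≤ u x * Y x ^ 2 ∧ ψ x ^ 2 ≤ Y x ^ 2 := by
    filter_upwards [hψd] with x h1 hx
    have h4 := hu0 x hx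
    rw [h1 hx, div_pow, neg_sq, mul_pow]
    have hy := sq_nonneg (Y x)
    constructor
    · rw [div_le_iff₀ (by positivity)]
      have : u x ^ 2 ≤ u x * (1 + u x) ^ 2 := by nlinarith [mul_nonneg h4 h4, mul_nonneg (mul_nonneg h4 h4) h4]
      nlinarith [mul_le_mul_of_nonneg_right this hy]
    · rw [div_le_iff₀ (by positivity)]
      have : u x ^ 2 ≤ (1 + u x) ^ 2 := by nlinarith
      nlinarith [mul_le_mul_of_nonneg_right this hy]
  have hrI : ∀ {p : ℝ → Prop}, (∀ᵐ x : ℝ, x ∈ Icc (-1 : ℝ) 1 → p x) →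
      ∀ᵐ x ∂volume.restrict (Ioo (-1 : ℝ) 1), p x := fun h => by
    rw [restrict_Ioo_eq_restrict_Icc, ae_restrict_iff' measurableSet_Icc]; exact h
  have hψm : Measurable ψ := measurable_deriv φ
  have huY : IntervalIntegrable (fun x => u x * Y x ^ 2) volume (-1) 1 :=
    (integrable_iff_rnDeriv hHc hac hu (fun x => Y x ^ 2)).1 hY
  have hψ2 : Integrable (fun x => ψ x ^ 2) (volume.restrict (Ioo (-1 : ℝ) 1)) := by
    refine ((intervalIntegrable_iff_integrableOn_Ioo_of_le (by norm_num)).1 huY).mono'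
      (hψm.pow_const 2).aestronglyMeasurable ?_
    filter_upwards [hrI hψ1] with x hx
    rw [Real.norm_of_nonneg (sq_nonneg _)]; exact hx.1
  have hψL : MemLp ψ (ENNReal.ofReal 2) (volume.restrict (Ioo (-1 : ℝ) 1)) := by
    rw [ENNReal.ofReal_ofNat]
    exact (memLp_two_iff_integrable_sq hψm.aestronglyMeasurable).2 hψ2
  have hμψ : ∀ᵐ ξ : Xi ∂μ₁, ψ ξ ^ 2 ≤ Y ξ ^ 2 :=
    hac.ae_le ((ae_gam_iff hHc ε (fun x => ψ x ^ 2 ≤ Y x ^ 2)).2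
      (by filter_upwards [hrI hψ1] with x hx using hx.2))
  have hψμ : Integrable (fun ξ : Xi => ψ ξ ^ 2) μ₁ := by
    refine hY.mono' ((hψm.comp measurable_subtype_coe).pow_const 2).aestronglyMeasurable ?_
    filter_upwards [hμψ] with ξ hξ
    rw [Real.norm_of_nonneg (sq_nonneg _)]; exact hξ
  have hψS : ∫ ξ : Xi, ψ ξ ^ 2 ∂μ₁ ≤ S := (integral_mono_ae hψμ hY hμψ).trans hYS
  have hψ1i : IntervalIntegrable ψ volume (-1) 1 := hφac.intervalIntegrable_deriv
  obtain ⟨B, hB⟩ := isCompact_Icc.exists_bound_of_continuousOn (hgc.continuousOn.mul hucont)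
  have hB0 : 0 ≤ B := (norm_nonneg _).trans (hB 0 (by simp))
  have hφξ : Continuous fun ξ : Xi => φ ξ := by
    have h1 : Continuous fun ξ : Xi => u ξ := continuousOn_iff_continuous_domRestrict.1 hucont
    exact (h1.const_add 1).log fun ξ => by have := hu0 ξ ξ.2; positivity
  have hr : μ₀.real univ = μ₁.real univ := by simp [measureReal_def, hmass]
  set M := μ₁.real univ with hM
  have main : ∀ s : ℝ, 0 < s → (∫ ξ : Xi, φ ξ ∂μ₁) - ∫ ξ : Xi, φ ξ ∂μ₀ ≤
      P + θ * ((1 + s) * S + (s ^ 2 + s) * B) + 4 * s * M := by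
    intro s hs
    -- The squared L² error is s². Young's inequality with parameter s then costs (1 + 1/s)s²B = (s²
    -- + s)B in ∫ f² dμ₁, where B bounds the Lebesgue density g u of μ₁.
    obtain ⟨f, -, hfs, hf, hfL⟩ := hψL.exists_hasCompactSupport_integral_rpow_sub_le
      (by norm_num) (sq_pos_of_pos hs)
    rw [ENNReal.ofReal_ofNat] at hfL hψL
    have hdi : Integrable (fun x => (ψ x - f x) ^ 2) (volume.restrict (Ioo (-1 : ℝ) 1)) :=
      (hψL.sub hfL).integrable_sq
    have hdi' : IntervalIntegrable (fun x => (ψ x - f x) ^ 2) volume (-1) 1 :=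
      (intervalIntegrable_iff_integrableOn_Ioo_of_le (by norm_num)).2 hdi
    have hds : ∫ x in (-1 : ℝ)..1, (ψ x - f x) ^ 2 ≤ s ^ 2 := by
      rw [intervalIntegral.integral_of_le (by norm_num), ← restrict_Ioo_eq_restrict_Ioc]
      simpa using hfs
    have hfi := hf.intervalIntegrable (μ := volume)
    have hd1 : ∫ x in (-1 : ℝ)..1, |ψ x - f x| ≤ 2 * s := by
      have : ∫ x in (-1 : ℝ)..1, |ψ x - f x| ≤
          ∫ x in (-1 : ℝ)..1, (s / 2 + 1 / (2 * s) * (ψ x - f x) ^ 2) := by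
        refine intervalIntegral.integral_mono_on (by norm_num) (hψ1i.sub (hfi _ _)).abs
          ((by simp : IntervalIntegrable (fun _ => s / 2) volume (-1) 1).add (hdi'.const_mul _))
          fun x _ => ?_
        have h1 : s / 2 + 1 / (2 * s) * (ψ x - f x) ^ 2 - |ψ x - f x| =
            1 / (2 * s) * (s - |ψ x - f x|) ^ 2 := by
          rw [← sq_abs (ψ x - f x)]; field_simp; ring
        have : 0 ≤ 1 / (2 * s) * (s - |ψ x - f x|) ^ 2 := by positivity
        linarith
      refine this.trans ?_
      rw [intervalIntegral.integral_add (by simp) (hdi'.const_mul _),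
        intervalIntegral.integral_const, intervalIntegral.integral_const_mul, smul_eq_mul]
      have : 1 / (2 * s) * ∫ x in (-1 : ℝ)..1, (ψ x - f x) ^ 2 ≤ 1 / (2 * s) * s ^ 2 := by gcongr
      have e : 1 / (2 * s) * s ^ 2 = s / 2 := by field_simp
      linarith
    have hclose : ∀ ξ : Xi, |φ ξ - φ (-1) - ∫ y in (-1 : ℝ)..ξ, f y| ≤ 2 * s := by
      intro ξ
      have hsub : uIcc (-1 : ℝ) ξ ⊆ uIcc (-1) 1 := by
        rw [hI, uIcc_of_le ξ.2.1]; exact Icc_subset_Icc_right ξ.2.2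
      rw [← (hφac.mono hsub).integral_deriv_eq_sub, ← hψ,
        ← intervalIntegral.integral_sub (hψ1i.mono_set hsub) (hfi _ _)]
      refine (intervalIntegral.abs_integral_le_integral_abs ξ.2.1).trans (le_trans ?_ hd1)
      exact intervalIntegral.integral_mono_interval le_rfl ξ.2.1 ξ.2.2
        (Eventually.of_forall fun _ => abs_nonneg _) (hψ1i.sub (hfi _ _)).abs
    have hpc : Continuous fun ξ : Xi => ∫ y in (-1 : ℝ)..ξ, f y :=
      (continuous_iff_continuousAt.2 fun x =>
        (hasDerivAt_primitive hf (-1) x).continuousAt).comp continuous_subtype_val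
    have hdiff : ∀ μ : Measure Xi, IsFiniteMeasure μ → |(∫ ξ : Xi, φ ξ ∂μ) - φ (-1) * μ.real univ -
        ∫ ξ : Xi, (∫ y in (-1 : ℝ)..ξ, f y) ∂μ| ≤ 2 * s * μ.real univ := by
      intro μ hμ
      have e : (∫ ξ : Xi, φ ξ ∂μ) - φ (-1) * μ.real univ - ∫ ξ : Xi, (∫ y in (-1 : ℝ)..ξ, f y) ∂μ =
          ∫ ξ : Xi, (φ ξ - φ (-1) - ∫ y in (-1 : ℝ)..ξ, f y) ∂μ := by
        have i1 : Integrable (fun ξ : Xi => φ ξ - φ (-1)) μ :=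
          (integrable_of_continuous _ hφξ).sub (integrable_const _)
        rw [integral_sub i1 (integrable_of_continuous _ hpc),
          integral_sub (integrable_of_continuous _ hφξ) (integrable_const _)]
        simp [mul_comm]
      rw [e, ← Real.norm_eq_abs]
      exact norm_integral_le_of_norm_le_const (Eventually.of_forall hclose)
    have hf2 : ∫ ξ : Xi, f ξ ^ 2 ∂μ₁ ≤ (1 + s) * S + (s ^ 2 + s) * B := by
      have hgu : ContinuousOn (fun x => g H ε x * u x) (uIcc (-1) 1) :=
        hI ▸ hgc.continuousOn.mul hucont
      have hguψ : IntervalIntegrable (fun x => g H ε x * (u x * ψ x ^ 2)) volume (-1) 1 :=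
        ((integrable_iff_rnDeriv hHc hac hu (fun x => ψ x ^ 2)).1 hψμ).continuousOn_mul
          hgc.continuousOn
      rw [integral_eq_integral_rnDeriv hHc hac hu (fun x => f x ^ 2)]
      have h1 : ∫ x in (-1 : ℝ)..1, g H ε x * (u x * f x ^ 2) ≤
          ∫ x in (-1 : ℝ)..1, ((1 + s) * (g H ε x * (u x * ψ x ^ 2)) +
            (1 + 1 / s) * B * (ψ x - f x) ^ 2) := by
        refine intervalIntegral.integral_mono_on (by norm_num) ?_
          ((hguψ.const_mul _).add (hdi'.const_mul _)) fun x hx => ?_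
        · have : ContinuousOn (fun x => g H ε x * (u x * f x ^ 2)) (uIcc (-1) 1) :=
            (hgu.mul (hf.pow 2).continuousOn).congr fun x _ => by
              change _ = g H ε x * u x * f x ^ 2; ring
          exact this.intervalIntegrable
        · have h2 : f x ^ 2 ≤ (1 + s) * ψ x ^ 2 + (1 + 1 / s) * (ψ x - f x) ^ 2 := by
            have : (1 + s) * ψ x ^ 2 + (1 + 1 / s) * (ψ x - f x) ^ 2 - f x ^ 2 =
              1 / s * (s * ψ x + (ψ x - f x)) ^ 2 := by field_simp; ring
            have : 0 ≤ 1 / s * (s * ψ x + (ψ x - f x)) ^ 2 := by positivity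
            linarith
          have h3 : g H ε x * u x ≤ B := (le_abs_self _).trans (hB x hx)
          have h4 : 0 ≤ g H ε x * u x := mul_nonneg (hgp x).le (hu0 x hx)
          have h5 : 0 ≤ (1 + 1 / s) * (ψ x - f x) ^ 2 := by positivity
          have h6 := mul_le_mul_of_nonneg_left h2 h4
          have h7 := mul_le_mul_of_nonneg_right h3 h5
          calc g H ε x * (u x * f x ^ 2) = g H ε x * u x * f x ^ 2 := by ring
            _ ≤ _ := h6
            _ = (1 + s) * (g H ε x * (u x * ψ x ^ 2)) +
                g H ε x * u x * ((1 + 1 / s) * (ψ x - f x) ^ 2) := by ring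
            _ ≤ (1 + s) * (g H ε x * (u x * ψ x ^ 2)) +
                B * ((1 + 1 / s) * (ψ x - f x) ^ 2) := by gcongr
            _ = _ := by ring
      refine h1.trans ?_
      rw [intervalIntegral.integral_add (hguψ.const_mul _) (hdi'.const_mul _),
        intervalIntegral.integral_const_mul, intervalIntegral.integral_const_mul,
        ← integral_eq_integral_rnDeriv hHc hac hu (fun x => ψ x ^ 2)]
      have e : (1 + 1 / s) * B * s ^ 2 = (s ^ 2 + s) * B := by field_simp
      rw [← e]
      gcongr
    have h0 := hdiff μ₀ inferInstance
    have h1 := hdiff μ₁ inferInstance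
    rw [hr] at h0
    have h2 := hP f hf
    have h3 := mul_le_mul_of_nonneg_left hf2 hθ
    rw [abs_le] at h0 h1
    linarith [h0.1, h1.2]
  have ht : Tendsto (fun s : ℝ => P + θ * ((1 + s) * S + (s ^ 2 + s) * B) + 4 * s * M) (𝓝[>] 0)
      (𝓝 (P + θ * S)) := by
    have : Continuous fun s : ℝ => P + θ * ((1 + s) * S + (s ^ 2 + s) * B) + 4 * s * M := by
      fun_prop
    have h := this.tendsto 0
    simp only [add_zero, one_mul, mul_zero, zero_mul, ne_eq, OfNat.ofNat_ne_zero,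
      not_false_eq_true, zero_pow] at h
    exact h.mono_left nhdsWithin_le_nhds
  exact ge_of_tendsto ht (by filter_upwards [self_mem_nhdsWithin] with s hs using main s hs)

/-- One step of the entropy estimate: if `μ₁ - μ₀` is a divergence that is controlled by `μ₁`,
and `μ₁` has finite Fisher information, then the entropy of `μ₁` is controlled by that of `μ₀`. -/
lemma regEntropy_le_add (hH : IsDoubleWell H) {ε : ℝ} {μ₀ μ₁ : Measure Xi}
    [IsFiniteMeasure μ₀] [IsFiniteMeasure μ₁] (hac₀ : μ₀ ≪ gam H ε) (hac : μ₁ ≪ gam H ε)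
    (hmass : μ₀ univ = μ₁ univ) {P K θ : ℝ} (hθ : 0 ≤ θ)
    (hQ : ∀ p ∈ testFunctions, (-(tau H ε * ∫ ξ : Xi, deriv p ξ / g H ε ξ ∂μ₁)) -
      tau H ε / 2 * ∫ ξ : Xi, (p ξ / g H ε ξ) ^ 2 ∂μ₁ ≤ K)
    (hP : ∀ f : ℝ → ℝ, Continuous f → (∫ ξ : Xi, (∫ y in (-1 : ℝ)..ξ, f y) ∂μ₁) -
      ∫ ξ : Xi, (∫ y in (-1 : ℝ)..ξ, f y) ∂μ₀ ≤ P + θ * tau H ε / 2 * ∫ ξ : Xi, f ξ ^ 2 ∂μ₁) :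
    regEntropy (gam H ε) μ₁ ≤ regEntropy (gam H ε) μ₀ + ENNReal.ofReal (P + θ * K) := by
  have hτ := tau_pos hH ε
  have hprob := isProbabilityMeasure_gam hH.continuous ε
  obtain ⟨u, Y, huac, hu0, hu, hd, -, hY, hYS⟩ := exists_density_of_fisher hH hac hQ
  have h1 := integral_log_density_le hH hac hmass (by positivity) hP huac hu0 hu hd hY hYS
  have e : θ * tau H ε / 2 * (2 * K / tau H ε) = θ * K := by field_simp
  rw [e] at h1
  have hφξ : Continuous fun ξ : Xi => Real.log (1 + u ξ) := by
    have hucont := huac.continuousOn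
    rw [uIcc_of_le (by norm_num)] at hucont
    have h1 : Continuous fun ξ : Xi => u ξ := continuousOn_iff_continuous_domRestrict.1 hucont
    exact (h1.const_add 1).log fun ξ => by have := hu0 ξ ξ.2; positivity
  have hφ0 : ∀ ξ : Xi, 0 ≤ Real.log (1 + u ξ) := fun ξ =>
    Real.log_nonneg (by linarith [hu0 ξ ξ.2])
  set φ : Xi → ℝ := fun ξ => Real.log (1 + u ξ) with hφ
  have hφm : Measurable fun ξ => ENNReal.ofReal (φ ξ) :=
    ENNReal.measurable_ofReal.comp hφξ.measurable
  have hlin : ∀ μ : Measure Xi, IsFiniteMeasure μ → μ ≪ gam H ε →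
      ∫⁻ ξ, ENNReal.ofReal ((μ.rnDeriv (gam H ε) ξ).toReal * φ ξ) ∂(gam H ε) =
        ENNReal.ofReal (∫ ξ, φ ξ ∂μ) := by
    intro μ _ hμ
    rw [ofReal_integral_eq_lintegral_ofReal (integrable_of_continuous _ hφξ)
      (Eventually.of_forall hφ0), ← lintegral_rnDeriv_mul hμ hφm.aemeasurable]
    refine lintegral_congr_ae ?_
    filter_upwards [μ.rnDeriv_lt_top (gam H ε)] with ξ hξ
    rw [ENNReal.ofReal_mul ENNReal.toReal_nonneg, ENNReal.ofReal_toReal hξ.ne]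
  -- The entropies may be infinite, so the integrated convexity inequality is arranged with
  -- nonnegative terms only; the finite term ∫ φ dμ₀ is cancelled at the end.
  have key : regEntropy (gam H ε) μ₁ + ENNReal.ofReal (∫ ξ, φ ξ ∂μ₀) ≤
      regEntropy (gam H ε) μ₀ + ENNReal.ofReal (∫ ξ, φ ξ ∂μ₁) := by
    rw [← hlin μ₀ inferInstance hac₀, ← hlin μ₁ inferInstance hac, regEntropy, regEntropy]
    rw [← lintegral_add_right _ (by
      have := (μ₀.measurable_rnDeriv (gam H ε)).ennreal_toReal
      exact ENNReal.measurable_ofReal.comp (this.mul hφξ.measurable)),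
      ← lintegral_add_right _ (by
      have := (μ₁.measurable_rnDeriv (gam H ε)).ennreal_toReal
      exact ENNReal.measurable_ofReal.comp (this.mul hφξ.measurable))]
    refine lintegral_mono_ae ?_
    filter_upwards [hu] with ξ hξ
    have a1 : 0 ≤ (μ₀.rnDeriv (gam H ε) ξ).toReal := ENNReal.toReal_nonneg
    have a2 := hu0 ξ ξ.2
    rw [← hξ, ← ENNReal.ofReal_add (eta_nonneg a2) (mul_nonneg a1 (hφ0 ξ)),
      ← ENNReal.ofReal_add (eta_nonneg a1) (mul_nonneg a2 (hφ0 ξ))]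
    refine ENNReal.ofReal_le_ofReal ?_
    have : eta (u ξ) + φ ξ * ((μ₀.rnDeriv (gam H ε) ξ).toReal - u ξ) ≤
      eta (μ₀.rnDeriv (gam H ε) ξ).toReal := eta_tangent a2 a1
    linarith
  have hle : ENNReal.ofReal (∫ ξ, φ ξ ∂μ₁) ≤
      ENNReal.ofReal (∫ ξ, φ ξ ∂μ₀) + ENNReal.ofReal (P + θ * K) :=
    (ENNReal.ofReal_le_ofReal (by linarith)).trans ENNReal.ofReal_add_le
  have := key.trans (add_le_add_right hle _)
  rw [add_comm (ENNReal.ofReal (∫ ξ, φ ξ ∂μ₀)), ← add_assoc] at this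
  exact (ENNReal.add_le_add_iff_right ENNReal.ofReal_ne_top).1 this

end Entropy

end Kramers

/-! ### Bernstein polynomials as weights for time averages -/

namespace Kramers

section Bernstein

/-- The Bernstein polynomial of index `k` and degree `n`, as a function. -/
noncomputable def bern (n k : ℕ) (x : ℝ) : ℝ := (bernsteinPolynomial ℝ n k).eval x

lemma bern_eq (n k : ℕ) (x : ℝ) : bern n k x = n.choose k * x ^ k * (1 - x) ^ (n - k) := by
  simp [bern, bernsteinPolynomial]

@[fun_prop]
lemma continuous_bern (n k : ℕ) : Continuous (bern n k) := (bernsteinPolynomial ℝ n k).continuous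

lemma bern_nonneg (n k : ℕ) {x : ℝ} (hx : x ∈ Icc (0 : ℝ) 1) : 0 ≤ bern n k x := by
  have h0 := hx.1
  have h1 : 0 ≤ 1 - x := by linarith [hx.2]
  rw [bern_eq]; positivity

lemma sum_bern (n : ℕ) (x : ℝ) : ∑ k ∈ Finset.range (n + 1), bern n k x = 1 := by
  have := congrArg (Polynomial.eval x) (bernsteinPolynomial.sum ℝ n)
  simpa [bern, Polynomial.eval_finsetSum] using this

lemma bern_zero_at_zero (n : ℕ) : bern n 0 0 = 1 := by
  simp [bern, bernsteinPolynomial.eval_at_0]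

lemma bern_succ_at_zero (n k : ℕ) : bern n (k + 1) 0 = 0 := by
  simp [bern, bernsteinPolynomial.eval_at_0]

lemma bern_at_one {n k : ℕ} (h : k < n) : bern n k 1 = 0 := by
  simp [bern, bernsteinPolynomial.eval_at_1, h.ne]

lemma hasDerivAt_bern_zero (n : ℕ) (x : ℝ) :
    HasDerivAt (bern (n + 1) 0) (-((n + 1) * bern n 0 x)) x := by
  have := (bernsteinPolynomial ℝ (n + 1) 0).hasDerivAt x
  rw [bernsteinPolynomial.derivative_zero] at this
  exact this.congr_deriv (by simp [bern]; ring)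

lemma hasDerivAt_bern_succ (n k : ℕ) (x : ℝ) :
    HasDerivAt (bern (n + 1) (k + 1)) ((n + 1) * (bern n k x - bern n (k + 1) x)) x := by
  have := (bernsteinPolynomial ℝ (n + 1) (k + 1)).hasDerivAt x
  rw [bernsteinPolynomial.derivative_succ] at this
  exact this.congr_deriv (by simp [bern])

/-- The degree n + 1 polynomial of index k + 1 vanishes at both ends, and its derivative is a
multiple of the difference of two neighbours of degree n. Hence neighbours have equal integrals. -/
lemma integral_bern {n k : ℕ} (h : k ≤ n) : ∫ x in (0 : ℝ)..1, bern n k x = 1 / (n + 1) := by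
  have hn : (n + 1 : ℝ) ≠ 0 := by positivity
  induction k with
  | zero =>
    have := intervalIntegral.integral_eq_sub_of_hasDerivAt (a := 0) (b := 1)
      (fun x _ => hasDerivAt_bern_zero n x) (Continuous.intervalIntegrable (by fun_prop) _ _)
    rw [bern_at_one (by lia), bern_zero_at_zero, intervalIntegral.integral_neg,
      intervalIntegral.integral_const_mul] at this
    field_simp
    linarith
  | succ k ih =>
    have := intervalIntegral.integral_eq_sub_of_hasDerivAt (a := 0) (b := 1)
      (fun x _ => hasDerivAt_bern_succ n k x) (Continuous.intervalIntegrable (by fun_prop) _ _)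
    rw [bern_at_one (by lia), bern_succ_at_zero, intervalIntegral.integral_const_mul,
      intervalIntegral.integral_sub ((continuous_bern _ _).intervalIntegrable _ _)
      ((continuous_bern _ _).intervalIntegrable _ _), ih (by lia)] at this
    rw [sub_zero, mul_eq_zero] at this
    rcases this with h | h
    · exact absurd h hn
    · linarith

/-- The polynomials of degree n + 1 appear as weights of the flux between consecutive averages,
those of degree n as weights of the averages. This relation writes the flux in terms of the newer
average. -/
lemma bern_degree_succ {n k : ℕ} (h : k ≤ n) (x : ℝ) :
    ((n : ℝ) + 1 - k) * bern (n + 1) k x = (n + 1) * (1 - x) * bern n k x := by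
  have h1 := Nat.choose_mul_succ_eq n k
  have h2 : (n.choose k : ℝ) * (n + 1) = (n + 1).choose k * ((n : ℝ) + 1 - k) := by
    have : ((n + 1 - k : ℕ) : ℝ) = (n : ℝ) + 1 - k := by
      rw [Nat.cast_sub (by lia)]; push_cast; ring
    rw [← this]; exact_mod_cast h1
  rw [bern_eq, bern_eq, show n + 1 - k = (n - k) + 1 by lia, pow_succ]
  linear_combination (-(x ^ k * (1 - x) ^ (n - k) * (1 - x))) * h2

lemma mul_bern (n k : ℕ) (x : ℝ) :
    (n + 1) * (x * bern n k x) = (k + 1) * bern (n + 1) (k + 1) x := by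
  have h1 := Nat.add_one_mul_choose_eq n k
  have h2 : ((n : ℝ) + 1) * n.choose k = (n + 1).choose (k + 1) * (k + 1) := by exact_mod_cast h1
  rw [bern_eq, bern_eq, show n + 1 - (k + 1) = n - k by lia, pow_succ]
  linear_combination (x ^ k * (1 - x) ^ (n - k) * x) * h2

/-- Two factors 1 - x raise the degree twice, and the squared term becomes the polynomial of degree
n + 2 with a coefficient of at most 2. As Bernstein polynomials sum to 1, the total is at most 1 +
2, whatever n is. -/
lemma sum_bern_weight_le (n : ℕ) {x : ℝ} (hx : x ∈ Icc (0 : ℝ) 1) :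
    ∑ k ∈ Finset.range (n + 1),
      bern n k x * (1 + ((n + 1) * (1 - x) / ((n : ℝ) + 1 - k)) ^ 2) ≤ 3 := by
  have key : ∀ k ∈ Finset.range (n + 1),
      bern n k x * (1 + ((n + 1) * (1 - x) / ((n : ℝ) + 1 - k)) ^ 2) ≤
        bern n k x + 2 * bern (n + 2) k x := by
    intro k hk
    have hk : k ≤ n := by simpa [Nat.lt_succ_iff] using hk
    have hk' : (k : ℝ) ≤ n := by exact_mod_cast hk
    have hd : 0 < (n : ℝ) + 1 - k := by linarith
    have h1 := bern_degree_succ hk x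
    have h2 := bern_degree_succ (show k ≤ n + 1 by lia) x
    push_cast at h2
    have hb := bern_nonneg (n + 2) k hx
    have e : bern n k x * ((n + 1) * (1 - x) / ((n : ℝ) + 1 - k)) ^ 2 =
        ((n + 1) / (n + 1 + 1)) * (((n : ℝ) + 1 + 1 - k) / ((n : ℝ) + 1 - k)) *
          bern (n + 2) k x := by
      field_simp
      have h3 : ((n : ℝ) + 1 + 1) * ((n + 1) * (1 - x) * bern n k x) * (1 - x) =
          ((n : ℝ) + 1 - k) * (((n : ℝ) + 1 + 1 - k) * bern (n + 2) k x) := by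
        rw [h2, ← h1]; ring
      linear_combination h3
    have f1 : ((n : ℝ) + 1) / (n + 1 + 1) ≤ 1 := by rw [div_le_one (by positivity)]; linarith
    have f2 : ((n : ℝ) + 1 + 1 - k) / ((n : ℝ) + 1 - k) ≤ 2 := by
      rw [div_le_iff₀ hd]; linarith
    have f3 : 0 ≤ ((n : ℝ) + 1 + 1 - k) / ((n : ℝ) + 1 - k) := div_nonneg (by linarith) hd.le
    rw [mul_add, mul_one, e]
    gcongr
    exact (mul_le_mul f1 f2 f3 zero_le_one).trans_eq (by norm_num)
  refine (Finset.sum_le_sum key).trans ?_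
  rw [Finset.sum_add_distrib, sum_bern, ← Finset.mul_sum]
  have h4 : ∑ k ∈ Finset.range (n + 1), bern (n + 2) k x ≤ 1 := by
    rw [← sum_bern (n + 2) x]
    exact Finset.sum_le_sum_of_subset_of_nonneg (Finset.range_mono (by lia))
      fun k _ _ => bern_nonneg _ _ hx
  linarith

/-- Multiplication by x raises degree and index together, so the moments reduce to integrals of
Bernstein polynomials. This is the variance for a Chebyshev estimate. -/
lemma integral_bern_sq_sub {n k : ℕ} (h : k ≤ n) (y : ℝ) :
    ∫ x in (0 : ℝ)..1, (n + 1) * bern n k x * (x - y) ^ 2 =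
      (k + 1) * (k + 2) / ((n + 2) * (n + 3)) - 2 * y * ((k + 1) / (n + 2)) + y ^ 2 := by
  have e : ∀ x : ℝ, (n + 1) * bern n k x * (x - y) ^ 2 =
      (k + 1) * (k + 2) / (n + 2) * bern (n + 2) (k + 2) x -
        2 * y * (k + 1) * bern (n + 1) (k + 1) x + y ^ 2 * (n + 1) * bern n k x := by
    intro x
    have h1 := mul_bern n k x
    have h2 := mul_bern (n + 1) (k + 1) x
    push_cast at h2
    have h3 : ((k : ℝ) + 1) * (k + 2) / (n + 2) * bern (n + 2) (k + 2) x =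
        x ^ 2 * ((n + 1) * bern n k x) := by
      field_simp
      linear_combination (-(k : ℝ) - 1) * h2 - ((n : ℝ) + 2) * x * h1
    rw [h3]
    linear_combination (-2 * y) * h1
  simp only [e]
  have hc := fun n k => (continuous_bern n k).intervalIntegrable (μ := volume) 0 1
  rw [intervalIntegral.integral_add (((hc _ _).const_mul _).sub ((hc _ _).const_mul _))
    ((hc _ _).const_mul _), intervalIntegral.integral_sub ((hc _ _).const_mul _)
    ((hc _ _).const_mul _), intervalIntegral.integral_const_mul,
    intervalIntegral.integral_const_mul, intervalIntegral.integral_const_mul,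
    integral_bern h, integral_bern (by lia), integral_bern (by lia)]
  push_cast
  field_simp
  ring

/-- The densities `(n + 1) B_{n, ⌊n y⌋}` concentrate at `y`. -/
lemma tendsto_integral_bern {y : ℝ} (hy : y ∈ Icc (0 : ℝ) 1) {f : ℝ → ℝ}
    (hf : ContinuousOn f (Icc 0 1)) :
    Tendsto (fun n : ℕ => ∫ x in (0 : ℝ)..1, (n + 1) * bern n ⌊n * y⌋₊ x * f x) atTop
      (𝓝 (f y)) := by
  have hk : ∀ n : ℕ, ⌊n * y⌋₊ ≤ n := fun n =>
    Nat.floor_le_of_le (by nlinarith [hy.2, (Nat.cast_nonneg n : (0 : ℝ) ≤ n)])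
  have hI : uIcc (0 : ℝ) 1 = Icc 0 1 := uIcc_of_le zero_le_one
  have hvar : Tendsto (fun n : ℕ => ∫ x in (0 : ℝ)..1, (n + 1) * bern n ⌊n * y⌋₊ x * (x - y) ^ 2)
      atTop (𝓝 0) := by
    have hfl : Tendsto (fun n : ℕ => (⌊n * y⌋₊ : ℝ) / n) atTop (𝓝 y) := by
      have := (tendsto_nat_floor_mul_div_atTop hy.1).comp tendsto_natCast_atTop_atTop
      refine this.congr fun n => ?_
      simp [mul_comm]
    have hin : Tendsto (fun n : ℕ => (n : ℝ)⁻¹) atTop (𝓝 0) := tendsto_inv_atTop_nhds_zero_nat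
    have h1 : Tendsto (fun n : ℕ => ((⌊n * y⌋₊ : ℝ) / n + (n : ℝ)⁻¹) *
        ((⌊n * y⌋₊ : ℝ) / n + 2 * (n : ℝ)⁻¹) / ((1 + 2 * (n : ℝ)⁻¹) * (1 + 3 * (n : ℝ)⁻¹)) -
        2 * y * (((⌊n * y⌋₊ : ℝ) / n + (n : ℝ)⁻¹) / (1 + 2 * (n : ℝ)⁻¹)) + y ^ 2) atTop
        (𝓝 ((y + 0) * (y + 2 * 0) / ((1 + 2 * 0) * (1 + 3 * 0)) -
          2 * y * ((y + 0) / (1 + 2 * 0)) + y ^ 2)) := by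
      refine Tendsto.add (Tendsto.sub (Tendsto.div ((hfl.add hin).mul (hfl.add (hin.const_mul 2)))
        (((hin.const_mul 2).const_add 1).mul ((hin.const_mul 3).const_add 1)) (by norm_num))
        (((hfl.add hin).div ((hin.const_mul 2).const_add 1) (by norm_num)).const_mul _))
        tendsto_const_nhds
    have h2 : (y + 0) * (y + 2 * 0) / ((1 + 2 * 0) * (1 + 3 * 0)) -
          2 * y * ((y + 0) / (1 + 2 * 0)) + y ^ 2 = 0 := by ring
    rw [h2] at h1
    refine h1.congr' ?_
    filter_upwards [eventually_gt_atTop 0] with n hn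
    have hn' : (0 : ℝ) < n := by exact_mod_cast hn
    rw [integral_bern_sq_sub (hk n)]
    field_simp
  obtain ⟨M, hM⟩ := isCompact_Icc.exists_bound_of_continuousOn hf
  have hM0 : 0 ≤ M := (norm_nonneg _).trans (hM 0 (by simp))
  rw [Metric.tendsto_nhds]
  intro δ hδ
  obtain ⟨d, hd, hfd⟩ := Metric.continuousWithinAt_iff.1 (hf y hy) (δ / 2) (half_pos hδ)
  -- Near y continuity is used; farther away than d, the trivial bound 2M is paid for by (x - y)².
  have hpt : ∀ x ∈ Icc (0 : ℝ) 1, |f x - f y| ≤ δ / 2 + 2 * M / d ^ 2 * (x - y) ^ 2 := by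
    intro x hx
    rcases lt_or_ge (dist x y) d with h | h
    · have := (hfd hx h).le
      rw [Real.dist_eq] at this
      have : 0 ≤ 2 * M / d ^ 2 * (x - y) ^ 2 := by positivity
      linarith
    · rw [Real.dist_eq] at h
      have h1 : d ^ 2 ≤ (x - y) ^ 2 := by rw [← sq_abs (x - y)]; gcongr
      have h2 : 2 * M ≤ 2 * M / d ^ 2 * (x - y) ^ 2 := by
        rw [div_mul_eq_mul_div, le_div_iff₀ (by positivity)]; gcongr
      have h3 := abs_sub (f x) (f y)
      have h4 := hM x hx
      have h5 := hM y hy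
      rw [Real.norm_eq_abs] at h4 h5
      linarith
  have hev := hvar.eventually_lt_const (show 0 < δ / 2 / (2 * M / d ^ 2 + 1) by positivity)
  filter_upwards [hev] with n hn
  have hb : Continuous fun x => ((n : ℝ) + 1) * bern n ⌊n * y⌋₊ x := by fun_prop
  have i1 : IntervalIntegrable (fun x => ((n : ℝ) + 1) * bern n ⌊n * y⌋₊ x * f x) volume 0 1 :=
    (hb.continuousOn.mul (hI ▸ hf)).intervalIntegrable
  have i2 : IntervalIntegrable (fun x => ((n : ℝ) + 1) * bern n ⌊n * y⌋₊ x * f y) volume 0 1 :=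
    (hb.mul continuous_const).intervalIntegrable _ _
  have e1 : ∫ x in (0 : ℝ)..1, ((n : ℝ) + 1) * bern n ⌊n * y⌋₊ x = 1 := by
    rw [intervalIntegral.integral_const_mul, integral_bern (hk n)]; field_simp
  have e2 : f y = ∫ x in (0 : ℝ)..1, ((n : ℝ) + 1) * bern n ⌊n * y⌋₊ x * f y := by
    rw [intervalIntegral.integral_mul_const, e1, one_mul]
  rw [Real.dist_eq]
  nth_rw 1 [e2]
  rw [← intervalIntegral.integral_sub i1 i2]
  have i3 : Continuous fun x => ((n : ℝ) + 1) * bern n ⌊n * y⌋₊ x * (x - y) ^ 2 := by fun_prop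
  have hle := intervalIntegral.norm_integral_le_of_norm_le (μ := volume)
    (f := fun x => ((n : ℝ) + 1) * bern n ⌊n * y⌋₊ x * f x -
      ((n : ℝ) + 1) * bern n ⌊n * y⌋₊ x * f y)
    (g := fun x => δ / 2 * (((n : ℝ) + 1) * bern n ⌊n * y⌋₊ x) + 2 * M / d ^ 2 *
      (((n : ℝ) + 1) * bern n ⌊n * y⌋₊ x * (x - y) ^ 2)) zero_le_one
    (Eventually.of_forall fun x hx => by
      have hx' := Ioc_subset_Icc_self hx
      have h1 := bern_nonneg n ⌊n * y⌋₊ hx'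
      rw [← mul_sub, norm_mul, Real.norm_of_nonneg (by positivity), Real.norm_eq_abs]
      calc _ ≤ ((n : ℝ) + 1) * bern n ⌊n * y⌋₊ x * (δ / 2 + 2 * M / d ^ 2 * (x - y) ^ 2) := by
            gcongr; exact hpt x hx'
        _ = _ := by ring)
    (((hb.intervalIntegrable _ _).const_mul _).add ((i3.intervalIntegrable _ _).const_mul _))
  rw [intervalIntegral.integral_add ((hb.intervalIntegrable _ _).const_mul _)
    ((i3.intervalIntegrable _ _).const_mul _), intervalIntegral.integral_const_mul (δ / 2), e1,
    intervalIntegral.integral_const_mul (2 * M / d ^ 2), Real.norm_eq_abs] at hle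
  refine hle.trans_lt ?_
  rw [lt_div_iff₀ (by positivity)] at hn
  have hv : 0 ≤ ∫ x in (0 : ℝ)..1, ((n : ℝ) + 1) * bern n ⌊n * y⌋₊ x * (x - y) ^ 2 :=
    intervalIntegral.integral_nonneg zero_le_one fun x hx => by
      have h1 := bern_nonneg n ⌊n * y⌋₊ hx
      positivity
  nlinarith

end Bernstein

end Kramers

/-! ### Averages in time of a solution, and their entropy -/

namespace Kramers

section Averages

variable {H : ℝ → ℝ} {T : ℝ} {ρ : ℝ → FiniteMeasure Xi} {v : ℝ → Xi → ℝ}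

/-- Weighted time averages of a curve of measures. -/
lemma exists_average (hT : 0 ≤ T) (hρ : ContinuousOn ρ (Icc 0 T)) {γ : Measure Xi}
    (hac : ∀ t ∈ Icc 0 T, (ρ t : Measure Xi) ≪ γ) {a : ℝ → ℝ} (ha : Continuous a)
    (ha0 : ∀ t ∈ Icc 0 T, 0 ≤ a t) :
    ∃ μ : Measure Xi, IsFiniteMeasure μ ∧ μ ≪ γ ∧ ∀ f : Xi → ℝ, Continuous f →
      ∫ ξ, f ξ ∂μ = ∫ t in 0..T, a t * ∫ ξ, f ξ ∂(ρ t : Measure Xi) := by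
  obtain ⟨κ, hκ, hκρ⟩ := exists_kernel hρ
  have ham : Measurable fun t => ENNReal.ofReal (a t) := ENNReal.measurable_ofReal.comp ha.measurable
  set l : Measure ℝ := (volume.restrict (Ioo 0 T)).withDensity fun t => ENNReal.ofReal (a t) with hl
  have hfin : IsFiniteMeasure l := by
    refine isFiniteMeasure_withDensity_ofReal ?_
    have : IntegrableOn a (Ioo 0 T) := (ha.integrableOn_Icc).mono_set Ioo_subset_Icc_self
    exact this.2
  refine ⟨(l.compProd κ).snd, inferInstance, ?_, fun f hf => ?_⟩
  · refine Measure.AbsolutelyContinuous.mk fun s hs hs0 => ?_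
    rw [Measure.snd_apply hs, Measure.compProd_apply (measurable_snd hs)]
    have hae : ∀ᵐ t ∂l, t ∈ Ioo 0 T :=
      (withDensity_absolutelyContinuous _ _).ae_le (ae_restrict_mem measurableSet_Ioo)
    rw [lintegral_eq_zero_of_ae_eq_zero]
    filter_upwards [hae] with t ht
    have ht' := Ioo_subset_Icc_self ht
    have e : Prod.mk t ⁻¹' (Prod.snd ⁻¹' s) = s := rfl
    rw [e, hκρ t ht']
    exact hac t ht' hs0
  · have hfb := integrable_of_continuous (l.compProd κ).snd hf
    have e1 : ∫ ξ, f ξ ∂(l.compProd κ).snd = ∫ z, f z.2 ∂(l.compProd κ) :=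
      integral_map measurable_snd.aemeasurable hf.aestronglyMeasurable
    have hi : Integrable (fun z : ℝ × Xi => f z.2) (l.compProd κ) :=
      (integrable_map_measure hf.aestronglyMeasurable measurable_snd.aemeasurable).1 hfb
    rw [e1, Measure.integral_compProd hi, hl,
      integral_withDensity_eq_integral_toReal_smul ham
        (Eventually.of_forall fun _ => ENNReal.ofReal_lt_top),
      intervalIntegral.integral_of_le hT, ← restrict_Ioo_eq_restrict_Ioc]
    refine setIntegral_congr_fun measurableSet_Ioo fun t ht => ?_
    have ht' := Ioo_subset_Icc_self ht
    simp only [hκρ t ht', smul_eq_mul, ENNReal.toReal_ofReal (ha0 t ht')]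

/-- The continuity equation tested with a product of functions of time and space. -/
lemma SolvesCE.integral_deriv_mul (h : SolvesCE T ρ v) (hT : 0 < T) {f : ℝ → ℝ} (hf : Continuous f)
    {W w : ℝ → ℝ} (hW : ∀ t, HasDerivAt W (w t) t) (hw : Continuous w) :
    ∫ t in 0..T, w t * ∫ ξ : Xi, (∫ y in (-1 : ℝ)..ξ, f y) ∂(ρ t : Measure Xi) =
      W T * (∫ ξ : Xi, (∫ y in (-1 : ℝ)..ξ, f y) ∂(ρ T : Measure Xi))
      - W 0 * (∫ ξ : Xi, (∫ y in (-1 : ℝ)..ξ, f y) ∂(ρ 0 : Measure Xi))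
      - ∫ t in 0..T, W t * ∫ ξ : Xi, v t ξ * f ξ ∂(ρ t : Measure Xi) := by
  set F : ℝ → ℝ := fun t => ∫ ξ : Xi, (∫ y in (-1 : ℝ)..ξ, f y) ∂(ρ t : Measure Xi) with hF
  set G : ℝ → ℝ := fun t => ∫ ξ : Xi, v t ξ * f ξ ∂(ρ t : Measure Xi) with hG
  have hGi : IntervalIntegrable G volume 0 T := h.intervalIntegrable_mul hT.le hf
  -- E agrees with F on [0, T] and is absolutely continuous, so integration by parts applies to it.
  let E : ℝ → ℝ := fun t => F 0 + ∫ r in 0..t, G r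
  have hFE : ∀ t ∈ Icc 0 T, F t = E t := fun t ht => by
    have := h.integral_sub_zero hT hf ht
    simp only [E, hF, hG]; linarith
  have hE : AbsolutelyContinuousOnInterval E 0 T := by
    have h1 := hGi.absolutelyContinuousOnInterval_intervalIntegral (left_mem_uIcc (a := 0) (b := T))
    have h2 : AbsolutelyContinuousOnInterval (fun _ : ℝ => F 0) 0 T :=
      (contDiff_const.contDiffOn (n := 1)).absolutelyContinuousOnInterval
    exact h2.add h1
  have hwd : deriv W = w := funext fun t => (hW t).deriv
  have hWac : AbsolutelyContinuousOnInterval W 0 T := by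
    refine (contDiff_one_iff_deriv.2 ⟨fun t => (hW t).differentiableAt, ?_⟩).contDiffOn.absolutelyContinuousOnInterval
    rwa [hwd]
  have hp := hWac.integral_mul_deriv_eq_deriv_mul hE
  rw [hwd] at hp
  have e1 : ∫ t in 0..T, W t * deriv E t = ∫ t in 0..T, W t * G t := by
    refine intervalIntegral.integral_congr_ae ?_
    filter_upwards [hGi.ae_hasDerivAt_integral] with t h1 h2
    rw [((h1 (uIoc_subset_uIcc h2) 0 left_mem_uIcc).const_add (F 0)).deriv]
  have e2 : ∫ t in 0..T, w t * F t = ∫ t in 0..T, w t * E t := by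
    refine intervalIntegral.integral_congr fun t ht => ?_
    rw [uIcc_of_le hT.le] at ht
    simp only [hFE t ht]
  change ∫ t in 0..T, w t * F t = W T * F T - W 0 * F 0 - ∫ t in 0..T, W t * G t
  rw [e2, hFE T ⟨hT.le, le_rfl⟩, hFE 0 ⟨le_rfl, hT.le⟩]
  linarith

/-- One step of the entropy estimate along a solution of the continuity equation. -/
lemma SolvesCE.regEntropy_le_add (hH : IsDoubleWell H) {ε : ℝ} (h : SolvesCE T ρ v) (hT : 0 < T)
    {μ₀ μ₁ : Measure Xi} [IsFiniteMeasure μ₀] [IsFiniteMeasure μ₁]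
    (hac₀ : μ₀ ≪ gam H ε) (hac₁ : μ₁ ≪ gam H ε) (hmass : μ₀ univ = μ₁ univ)
    {a σ : ℝ → ℝ} (ha : Continuous a) (ha0 : ∀ t ∈ Icc 0 T, 0 ≤ a t) (hσ : Continuous σ)
    (hμ₁ : ∀ f : Xi → ℝ, Continuous f →
      ∫ ξ, f ξ ∂μ₁ = ∫ t in 0..T, a t * ∫ ξ, f ξ ∂(ρ t : Measure Xi))
    (hμ : ∀ f : ℝ → ℝ, Continuous f → (∫ ξ : Xi, (∫ y in (-1 : ℝ)..ξ, f y) ∂μ₁) -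
      (∫ ξ : Xi, (∫ y in (-1 : ℝ)..ξ, f y) ∂μ₀) =
        ∫ t in 0..T, a t * σ t * ∫ ξ : Xi, v t ξ * f ξ ∂(ρ t : Measure Xi))
    {θ : ℝ} (hθ : 0 < θ) :
    regEntropy (gam H ε) μ₁ ≤ regEntropy (gam H ε) μ₀ +
      ∫⁻ t in Ioo 0 T, ENNReal.ofReal (a t * (θ + σ t ^ 2 / θ)) * diss H ε (ρ t) (v t) := by
  have hHc := hH.continuous
  have hτ := tau_pos hH ε
  have hgc := continuous_g hHc ε
  have hgp := g_pos hHc ε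
  set A : ℝ → ℝ≥0∞ := fun t => ENNReal.ofReal (1 / (2 * tau H ε)) *
    ∫⁻ ξ : Xi, ENNReal.ofReal (v t ξ ^ 2) ∂(ρ t : Measure Xi) with hA
  set B : ℝ → ℝ≥0∞ := fun t => ENNReal.ofReal (2 * tau H ε) * sqrtDirichlet (gam H ε) (ρ t) with hB
  -- By Young's inequality σ v f ≤ σ² v²/(2τθ) + θτ f²/2. Thus the kinetic part of the dissipation
  -- gets the weight σ²/θ, and the Fisher part the weight θ that it has in the static estimate.
  set P' := ∫⁻ t in Ioo 0 T, ENNReal.ofReal (a t * (σ t ^ 2 / θ)) * A t with hP'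
  set K' := ∫⁻ t in Ioo 0 T, ENNReal.ofReal (a t) * B t with hK'
  have hsum : P' + ENNReal.ofReal θ * K' ≤
      ∫⁻ t in Ioo 0 T, ENNReal.ofReal (a t * (θ + σ t ^ 2 / θ)) * diss H ε (ρ t) (v t) := by
    rw [hK', ← lintegral_const_mul' _ _ ENNReal.ofReal_ne_top]
    refine (le_lintegral_add _ _).trans (setLIntegral_mono' measurableSet_Ioo fun t ht => ?_)
    have hat := ha0 t (Ioo_subset_Icc_self ht)
    have h1 : 0 ≤ σ t ^ 2 / θ := by positivity
    change _ ≤ ENNReal.ofReal (a t * (θ + σ t ^ 2 / θ)) * (A t + B t)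
    rw [mul_add, ← mul_assoc (ENNReal.ofReal θ), ← ENNReal.ofReal_mul hθ.le]
    exact add_le_add
      (mul_le_mul' (ENNReal.ofReal_le_ofReal (by nlinarith [mul_nonneg hat hθ.le])) le_rfl)
      (mul_le_mul' (ENNReal.ofReal_le_ofReal (by nlinarith [mul_nonneg hat h1])) le_rfl)
  rcases eq_or_ne (∫⁻ t in Ioo 0 T, ENNReal.ofReal (a t * (θ + σ t ^ 2 / θ)) *
    diss H ε (ρ t) (v t)) ⊤ with htop | hfin
  · rw [htop, add_top]; exact le_top
  have hPK : P' + ENNReal.ofReal θ * K' ≠ ⊤ := ne_top_of_le_ne_top hfin hsum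
  have hPf : P' ≠ ⊤ := fun h => hPK (by rw [h, top_add])
  have hKf : K' ≠ ⊤ := fun h => hPK (by
    rw [h, ENNReal.mul_top (by simpa using hθ), add_top])
  have hconv : ENNReal.ofReal (P'.toReal + θ * K'.toReal) = P' + ENNReal.ofReal θ * K' := by
    rw [ENNReal.ofReal_add ENNReal.toReal_nonneg (by positivity), ENNReal.ofReal_toReal hPf,
      ENNReal.ofReal_mul hθ.le, ENNReal.ofReal_toReal hKf]
  have hIoo : ∀ F : ℝ → ℝ, ∫ t in 0..T, F t = ∫ t in Ioo 0 T, F t := fun F => by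
    rw [intervalIntegral.integral_of_le hT.le, ← restrict_Ioo_eq_restrict_Ioc]
  refine (Kramers.regEntropy_le_add hH hac₀ hac₁ hmass (P := P'.toReal) (K := K'.toReal) hθ.le
    ?_ ?_).trans (add_le_add_right (hconv.trans_le hsum) _)
  -- The Fisher information is a supremum of functionals that are linear in the measure; averaging
  -- each of them in time bounds it for the average by the average of its values.
  · intro p hp
    have hpc : Continuous p := hp.1.continuous
    have hdc : Continuous (deriv p) := hp.1.continuous_deriv (by exact_mod_cast le_top)
    have hpz : ∀ x, x ∉ Ioo (-1 : ℝ) 1 → p x = 0 := fun x hx =>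
      image_eq_zero_of_notMem_tsupport fun h => hx (hp.2.2 h)
    have hprim : ∀ x, ∫ y in (-1 : ℝ)..x, deriv p y = p x := fun x => by
      rw [intervalIntegral.integral_deriv_eq_sub (fun y _ => hp.1.differentiable (by simp) y)
        (hdc.intervalIntegrable _ _), hpz (-1) (by simp), sub_zero]
    have c1 : Continuous fun ξ : Xi => deriv p ξ / g H ε ξ :=
      (hdc.div hgc fun x => (hgp x).ne').comp continuous_subtype_val
    have c2 : Continuous fun ξ : Xi => (p ξ / g H ε ξ) ^ 2 :=
      ((hpc.div hgc fun x => (hgp x).ne').pow 2).comp continuous_subtype_val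
    set L : Xi → ℝ := fun ξ => -(tau H ε * (deriv p ξ / g H ε ξ)) -
      tau H ε / 2 * (p ξ / g H ε ξ) ^ 2 with hL
    have cL : Continuous L := ((c1.const_mul _).neg).sub (c2.const_mul _)
    have e1 : (-(tau H ε * ∫ ξ : Xi, deriv p ξ / g H ε ξ ∂μ₁)) -
        tau H ε / 2 * ∫ ξ : Xi, (p ξ / g H ε ξ) ^ 2 ∂μ₁ = ∫ ξ, L ξ ∂μ₁ := by
      have i1 : Integrable (fun ξ : Xi => -(tau H ε * (deriv p ξ / g H ε ξ))) μ₁ :=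
        integrable_of_continuous _ (c1.const_mul _).neg
      rw [MeasureTheory.integral_sub i1 (integrable_of_continuous _ (c2.const_mul _)), integral_neg,
        integral_const_mul, integral_const_mul]
    rw [e1, hμ₁ L cL, hIoo, ← ENNReal.ofReal_le_iff_le_toReal hKf]
    refine (ofReal_integral_le_lintegral _).trans (setLIntegral_mono' measurableSet_Ioo fun t ht => ?_)
    rw [ENNReal.ofReal_mul (ha0 t (Ioo_subset_Icc_self ht))]
    gcongr
    have := ofReal_le_sqrtDirichlet hH (ε := ε) (ρ t) hdc (by
      rw [hprim, hpz 1 (by simp)])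
    simpa only [hprim] using this
  · intro f hf
    have hfξ : Continuous fun ξ : Xi => f ξ ^ 2 := (hf.pow 2).comp continuous_subtype_val
    have hvf := h.integrable_mul hf
    have hi1 : IntegrableOn (fun t => a t * σ t * ∫ ξ : Xi, v t ξ * f ξ ∂(ρ t : Measure Xi))
        (Ioo 0 T) := by
      have := (h.intervalIntegrable_mul hT.le hf).continuousOn_mul
        (ha.mul hσ).continuousOn
      exact (intervalIntegrable_iff_integrableOn_Ioo_of_le hT.le).1 this
    have hi2 : IntegrableOn (fun t => a t * ∫ ξ : Xi, f ξ ^ 2 ∂(ρ t : Measure Xi)) (Ioo 0 T) :=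
      (ha.continuousOn.mul (continuousOn_integral h.cont hfξ)).integrableOn_Icc.mono_set
        Ioo_subset_Icc_self
    rw [hμ f hf, hμ₁ _ hfξ, hIoo, hIoo, ← sub_le_iff_le_add, ← integral_const_mul,
      ← MeasureTheory.integral_sub hi1 (hi2.const_mul _), ← ENNReal.ofReal_le_iff_le_toReal hPf]
    refine (ofReal_integral_le_lintegral _).trans (lintegral_mono_ae ?_)
    filter_upwards [hvf.1, ae_restrict_mem measurableSet_Ioo] with t hvt ht
    have hat := ha0 t (Ioo_subset_Icc_self ht)
    have e1 : a t * σ t * (∫ ξ : Xi, v t ξ * f ξ ∂(ρ t : Measure Xi)) -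
        θ * tau H ε / 2 * (a t * ∫ ξ : Xi, f ξ ^ 2 ∂(ρ t : Measure Xi)) =
        a t * ∫ ξ : Xi, (σ t * (v t ξ * f ξ) - θ * tau H ε / 2 * f ξ ^ 2) ∂(ρ t : Measure Xi) := by
      rw [MeasureTheory.integral_sub (hvt.const_mul _) ((integrable_of_continuous _ hfξ).const_mul _),
        integral_const_mul, integral_const_mul]
      ring
    rw [e1, ENNReal.ofReal_mul hat, ENNReal.ofReal_mul hat, mul_assoc]
    gcongr
    rw [hA, ← mul_assoc, ← ENNReal.ofReal_mul (by positivity),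
      ← lintegral_const_mul' _ _ ENNReal.ofReal_ne_top]
    refine (ofReal_integral_le_lintegral _).trans (lintegral_mono fun ξ => ?_)
    rw [← ENNReal.ofReal_mul (by positivity)]
    refine ENNReal.ofReal_le_ofReal ?_
    have key : σ t ^ 2 / θ * (1 / (2 * tau H ε)) * v t ξ ^ 2 -
        (σ t * (v t ξ * f ξ) - θ * tau H ε / 2 * f ξ ^ 2) =
        1 / (2 * tau H ε * θ) * (σ t * v t ξ - θ * tau H ε * f ξ) ^ 2 := by
      field_simp; ring
    have : 0 ≤ 1 / (2 * tau H ε * θ) * (σ t * v t ξ - θ * tau H ε * f ξ) ^ 2 := by positivity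
    linarith

end Averages

end Kramers

/-! ### Summation of the entropy steps along the Bernstein averages -/

namespace Kramers

section Chain

variable {H : ℝ → ℝ} {T : ℝ} {ρ : ℝ → FiniteMeasure Xi} {v : ℝ → Xi → ℝ}

lemma integral_bern_div (hT : 0 < T) (N k : ℕ) (F : ℝ → ℝ) :
    ∫ t in 0..T, (N + 1) / T * bern N k (t / T) * F t =
      ∫ x in (0 : ℝ)..1, (N + 1) * bern N k x * F (T * x) := by
  have := intervalIntegral.integral_comp_div (a := 0) (b := T)
    (fun x => (N + 1) / T * bern N k x * F (T * x)) hT.ne'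
  rw [zero_div, div_self hT.ne', smul_eq_mul, ← intervalIntegral.integral_const_mul] at this
  rw [show (∫ t in 0..T, (N + 1) / T * bern N k (t / T) * F t) =
    ∫ t in 0..T, (N + 1) / T * bern N k (t / T) * F (T * (t / T)) by
      simp only [mul_div_cancel₀ _ hT.ne'], this]
  refine intervalIntegral.integral_congr fun x _ => ?_
  field_simp

lemma measure_univ_of_average (hT : 0 < T) {m : ℝ≥0} (hm : ∀ t ∈ Icc 0 T, (ρ t).mass = m)
    {N k : ℕ} (hk : k ≤ N) {μ : Measure Xi} [IsFiniteMeasure μ]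
    (hμ : ∀ f : Xi → ℝ, Continuous f → ∫ ξ, f ξ ∂μ =
      ∫ t in 0..T, (N + 1) / T * bern N k (t / T) * ∫ ξ, f ξ ∂(ρ t : Measure Xi)) :
    μ univ = m := by
  have h1 := hμ (fun _ => 1) continuous_const
  have e : ∫ t in 0..T, (N + 1) / T * bern N k (t / T) * ∫ _ξ : Xi, (1 : ℝ) ∂(ρ t : Measure Xi) =
      ∫ t in 0..T, (N + 1) / T * bern N k (t / T) * (m : ℝ) := by
    refine intervalIntegral.integral_congr fun t ht => ?_
    rw [uIcc_of_le hT.le] at ht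
    simp only [integral_const, smul_eq_mul, mul_one]
    have : (ρ t : Measure Xi).real univ = m := by rw [← hm t ht]; rfl
    rw [this]
  rw [e, integral_bern_div hT N k (fun _ => (m : ℝ)), intervalIntegral.integral_mul_const,
    intervalIntegral.integral_const_mul, integral_bern hk] at h1
  have hN : (N + 1 : ℝ) ≠ 0 := by positivity
  simp only [integral_const, smul_eq_mul, mul_one] at h1
  rw [mul_one_div_cancel hN, one_mul] at h1
  rw [← ENNReal.ofReal_toReal (measure_ne_top μ univ)]
  rw [show (μ univ).toReal = (m : ℝ) from h1, ENNReal.ofReal_coe_nnreal]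

/-- The entropy of the Bernstein averages of a solution is controlled by the initial entropy and
the dissipation. -/
lemma SolvesCE.exists_average_entropy_le (hH : IsDoubleWell H) {ε : ℝ} (h : SolvesCE T ρ v)
    (hT : 0 < T) (hac : ∀ t ∈ Icc 0 T, (ρ t : Measure Xi) ≪ gam H ε) {m : ℝ≥0}
    (hm : ∀ t ∈ Icc 0 T, (ρ t).mass = m) {N k : ℕ} (hk : k ≤ N) :
    ∃ μ : Measure Xi, IsFiniteMeasure μ ∧ μ ≪ gam H ε ∧ (∀ f : Xi → ℝ, Continuous f →
      ∫ ξ, f ξ ∂μ = ∫ t in 0..T, (N + 1) / T * bern N k (t / T) * ∫ ξ, f ξ ∂(ρ t : Measure Xi)) ∧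
      regEntropy (gam H ε) μ ≤ regEntropy (gam H ε) (ρ 0) +
        ENNReal.ofReal 3 * ∫⁻ t in Ioo 0 T, diss H ε (ρ t) (v t) := by
  set wt : ℕ → ℝ → ℝ := fun k x =>
    bern N k x * (1 + ((N + 1) * (1 - x) / ((N : ℝ) + 1 - k)) ^ 2) with hwt
  have hx : ∀ t ∈ Icc 0 T, t / T ∈ Icc (0 : ℝ) 1 := fun t ht =>
    ⟨div_nonneg ht.1 hT.le, div_le_one_of_le₀ ht.2 hT.le⟩
  have hwt0 : ∀ k, ∀ t ∈ Icc 0 T, 0 ≤ wt k (t / T) := fun k t ht =>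
    mul_nonneg (bern_nonneg _ _ (hx t ht)) (by positivity)
  have h0 : (0 : ℝ) ∈ Icc 0 T := ⟨le_rfl, hT.le⟩
  have hmass0 : (ρ 0 : Measure Xi) univ = m := by
    rw [← hm 0 h0]; exact (ρ 0).ennreal_mass.symm
  set a : ℕ → ℝ → ℝ := fun k t => (N + 1) / T * bern N k (t / T) with ha
  have hac' : ∀ k, Continuous (a k) := fun k => by
    simp only [ha]
    exact continuous_const.mul ((continuous_bern N k).comp (by fun_prop))
  have ha0 : ∀ k, ∀ t ∈ Icc 0 T, 0 ≤ a k t := fun k t ht =>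
    mul_nonneg (by positivity) (bern_nonneg _ _ (hx t ht))
  have hFc : ∀ f : ℝ → ℝ, Continuous f → ContinuousOn
      (fun t => ∫ ξ : Xi, (∫ y in (-1 : ℝ)..ξ, f y) ∂(ρ t : Measure Xi)) (Icc 0 T) := fun f hf =>
    continuousOn_integral h.cont
      ((intervalIntegral.continuous_primitive (fun a b => hf.intervalIntegrable a b) (-1)).comp
        continuous_subtype_val)
  have step : ∀ j ≤ N, ∀ μ₀ μ₁ : Measure Xi, IsFiniteMeasure μ₀ → IsFiniteMeasure μ₁ →
      μ₀ ≪ gam H ε → μ₁ ≪ gam H ε → μ₀ univ = μ₁ univ →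
      (∀ f : Xi → ℝ, Continuous f → ∫ ξ, f ξ ∂μ₁ =
        ∫ t in 0..T, a j t * ∫ ξ, f ξ ∂(ρ t : Measure Xi)) →
      (∀ f : ℝ → ℝ, Continuous f → (∫ ξ : Xi, (∫ y in (-1 : ℝ)..ξ, f y) ∂μ₁) -
        (∫ ξ : Xi, (∫ y in (-1 : ℝ)..ξ, f y) ∂μ₀) =
        ∫ t in 0..T, bern (N + 1) j (t / T) * ∫ ξ : Xi, v t ξ * f ξ ∂(ρ t : Measure Xi)) →
      regEntropy (gam H ε) μ₁ ≤ regEntropy (gam H ε) μ₀ +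
        ∫⁻ t in Ioo 0 T, ENNReal.ofReal (wt j (t / T)) * diss H ε (ρ t) (v t) := by
    intro j hj μ₀ μ₁ _ _ h1 h2 h3 h4 h5
    have hjN : (0 : ℝ) < N + 1 - j := by
      have : (j : ℝ) ≤ N := by exact_mod_cast hj
      linarith
    -- This identifies σ, the ratio of the flux weight to the averaging weight.
    have e1 : ∀ t, bern (N + 1) j (t / T) = a j t * (T * (1 - t / T) / (N + 1 - j)) := fun t => by
      have := bern_degree_succ hj (t / T)
      simp only [ha]
      field_simp at this ⊢
      linarith
    -- Here θ = T/(N + 1) plays the role of the time step; with it the factors N + 1 and T cancel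
    -- and the weight sums to at most 3.
    have e2 : ∀ t, wt j (t / T) = a j t * (T / (N + 1) +
        (T * (1 - t / T) / (N + 1 - j)) ^ 2 / (T / (N + 1))) := fun t => by
      simp only [ha, hwt]
      field_simp
    simp only [e2]
    refine h.regEntropy_le_add hH hT h1 h2 h3 (hac' j) (ha0 j) (by fun_prop) h4 (fun f hf => ?_)
      (by positivity)
    rw [h5 f hf]
    simp only [e1]
  -- The difference of two neighbouring averages is tested by a weight that vanishes at both times 0
  -- and T when j < N, so no boundary values of ρ appear.
  have hWd : ∀ j : ℕ, ∀ t, HasDerivAt (fun t => bern (N + 1) (j + 1) (t / T))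
      (a j t - a (j + 1) t) t := fun j t => by
    have := (hasDerivAt_bern_succ N j (t / T)).comp t ((hasDerivAt_id t).div_const T)
    exact this.congr_deriv (by simp only [ha]; field_simp)
  -- The polynomial of index 0 equals 1 at time 0, so the first step starts from ρ(0) itself.
  have hWd0 : ∀ t, HasDerivAt (fun t => bern (N + 1) 0 (t / T)) (-a 0 t) t := fun t => by
    have := (hasDerivAt_bern_zero N (t / T)).comp t ((hasDerivAt_id t).div_const T)
    exact this.congr_deriv (by simp only [ha]; field_simp)
  have main : ∀ j ≤ N, ∃ μ : Measure Xi, IsFiniteMeasure μ ∧ μ ≪ gam H ε ∧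
      (∀ f : Xi → ℝ, Continuous f →
        ∫ ξ, f ξ ∂μ = ∫ t in 0..T, a j t * ∫ ξ, f ξ ∂(ρ t : Measure Xi)) ∧
      regEntropy (gam H ε) μ ≤ regEntropy (gam H ε) (ρ 0) +
        ∫⁻ t in Ioo 0 T, ENNReal.ofReal (∑ i ∈ Finset.range (j + 1), wt i (t / T)) *
          diss H ε (ρ t) (v t) := by
    intro j
    induction j with
    | zero =>
      intro hj
      obtain ⟨μ, hfin, hμac, hμ⟩ := exists_average hT.le h.cont hac (hac' 0) (ha0 0)
      refine ⟨μ, hfin, hμac, hμ, ?_⟩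
      simp only [zero_add, Finset.sum_range_one]
      refine step 0 hj _ _ inferInstance hfin (hac 0 h0) hμac
        (hmass0.trans (measure_univ_of_average hT hm hj hμ).symm) hμ fun f hf => ?_
      have hfp : Continuous fun ξ : Xi => ∫ y in (-1 : ℝ)..ξ, f y :=
        (intervalIntegral.continuous_primitive (fun a b => hf.intervalIntegrable a b) (-1)).comp
          continuous_subtype_val
      have := h.integral_deriv_mul hT hf hWd0 (hac' 0).neg
      simp only [div_self hT.ne', zero_div, bern_zero_at_zero, bern_at_one (Nat.succ_pos N),
        neg_mul, intervalIntegral.integral_neg] at this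
      rw [hμ _ hfp]
      linarith
    | succ j ih =>
      intro hj
      obtain ⟨μ₀, hfin₀, hμac₀, hμ₀, hle⟩ := ih (by lia)
      obtain ⟨μ, hfin, hμac, hμ⟩ := exists_average hT.le h.cont hac (hac' (j + 1)) (ha0 (j + 1))
      refine ⟨μ, hfin, hμac, hμ, ?_⟩
      have hs := step (j + 1) hj _ _ hfin₀ hfin hμac₀ hμac
        ((measure_univ_of_average hT hm (by lia) hμ₀).trans
          (measure_univ_of_average hT hm hj hμ).symm) hμ fun f hf => ?_
      · refine hs.trans ((add_le_add_left hle _).trans ?_)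
        rw [add_assoc]
        refine add_le_add_right ((le_lintegral_add _ _).trans
          (setLIntegral_mono' measurableSet_Ioo fun t ht => ?_)) _
        have ht' := Ioo_subset_Icc_self ht
        rw [← add_mul, ← ENNReal.ofReal_add (Finset.sum_nonneg fun i _ => hwt0 i t ht')
          (hwt0 _ t ht'), ← Finset.sum_range_succ]
      · have hfp : Continuous fun ξ : Xi => ∫ y in (-1 : ℝ)..ξ, f y :=
          (intervalIntegral.continuous_primitive (fun a b => hf.intervalIntegrable a b) (-1)).comp
            continuous_subtype_val
        have := h.integral_deriv_mul hT hf (hWd j) ((hac' j).sub (hac' (j + 1)))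
        have hi : ∀ i, IntervalIntegrable (fun t => a i t *
            ∫ ξ : Xi, (∫ y in (-1 : ℝ)..ξ, f y) ∂(ρ t : Measure Xi)) volume 0 T := fun i =>
          ((hac' i).continuousOn.mul (hFc f hf)).intervalIntegrable_of_Icc hT.le
        simp only [div_self hT.ne', zero_div, bern_succ_at_zero,
          bern_at_one (show j + 1 < N + 1 by lia), sub_mul] at this
        rw [intervalIntegral.integral_sub (hi j) (hi (j + 1))] at this
        rw [hμ _ hfp, hμ₀ _ hfp]
        linarith
  obtain ⟨μ, h1, h2, h3, h4⟩ := main k hk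
  refine ⟨μ, h1, h2, h3, h4.trans (add_le_add_right ?_ _)⟩
  rw [← lintegral_const_mul' _ _ ENNReal.ofReal_ne_top]
  refine setLIntegral_mono' measurableSet_Ioo fun t ht => ?_
  have ht' := Ioo_subset_Icc_self ht
  gcongr
  refine le_trans ?_ (sum_bern_weight_le N (hx t ht'))
  exact Finset.sum_le_sum_of_subset_of_nonneg (Finset.range_mono (by lia))
    fun i _ _ => hwt0 i t ht'

end Chain

end Kramers

/-! ### Concentration at the wells at every time -/

namespace Kramers

section Concentration

variable {H : ℝ → ℝ} {T : ℝ} {ρ : ℝ → FiniteMeasure Xi} {v : ℝ → Xi → ℝ}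

/-- Young's inequality for `eta`, whose Legendre conjugate is e^s - 1 - s; the tangent is taken at
e^s - 1. -/
lemma mul_le_eta_add {u s : ℝ} (hu : 0 ≤ u) (hs : 0 ≤ s) :
    s * u ≤ eta u + (Real.exp s - 1 - s) := by
  have := eta_tangent (u := Real.exp s - 1) (w := u) (by linarith [Real.add_one_le_exp s]) hu
  rw [eta, show 1 + (Real.exp s - 1) = Real.exp s by ring, Real.log_exp] at this
  linarith

/-- It lets the bound on the initial free energy control the regularized entropy. Both log(1 + u)
and the gain log((1 + u)/u) are estimated by log x ≤ x - 1. -/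
lemma eta_le {u : ℝ} (hu : 0 ≤ u) : eta u ≤ u * Real.log u + 1 := by
  rcases hu.eq_or_lt with rfl | hu
  · simp [eta]
  have h1 := Real.log_le_sub_one_of_pos (show 0 < 1 + u by positivity)
  have h2 := Real.log_le_sub_one_of_pos (show 0 < (1 + u) / u by positivity)
  rw [Real.log_div (by positivity) hu.ne'] at h2
  have h3 : u * (Real.log (1 + u) - Real.log u) ≤ 1 := by
    calc _ ≤ u * ((1 + u) / u - 1) := by gcongr
      _ = 1 := by field_simp; ring
  unfold eta
  nlinarith

/-- The dual side of the entropy is weakly continuous in μ, so it can be followed to limits of the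
averages. -/
lemma ofReal_integral_sub_le_regEntropy (hH : Continuous H) {ε : ℝ} {μ : Measure Xi}
    [IsFiniteMeasure μ] (hac : μ ≪ gam H ε) {f : ℝ → ℝ} (hf : Continuous f)
    (hf0 : ∀ x ∈ Icc (-1 : ℝ) 1, 0 ≤ f x) :
    ENNReal.ofReal ((∫ ξ : Xi, f ξ ∂μ) - ∫ ξ : Xi, (Real.exp (f ξ) - 1 - f ξ) ∂gam H ε) ≤
      regEntropy (gam H ε) μ := by
  have := isProbabilityMeasure_gam hH ε
  have hfx : Continuous fun ξ : Xi => f ξ := hf.comp continuous_subtype_val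
  have hi1 : Integrable (fun ξ : Xi => (μ.rnDeriv (gam H ε) ξ).toReal * f ξ) (gam H ε) :=
    (integrable_rnDeriv_smul_iff hac).2 (integrable_of_continuous μ hfx)
  have hi2 : Integrable (fun ξ : Xi => Real.exp (f ξ) - 1 - f ξ) (gam H ε) :=
    integrable_of_continuous _ (by fun_prop)
  rw [← integral_rnDeriv_smul hac]
  simp only [smul_eq_mul]
  rw [← integral_sub hi1 hi2]
  refine (ofReal_integral_le_lintegral _).trans (lintegral_mono fun ξ => ENNReal.ofReal_le_ofReal ?_)
  have := mul_le_eta_add (u := (μ.rnDeriv (gam H ε) ξ).toReal) ENNReal.toReal_nonneg (hf0 ξ ξ.2)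
  linarith

/-- The average with index ⌊N t/T⌋ concentrates at time t as N → ∞. Its entropy is bounded
independently of N, and only the dual functional with continuous f has to converge. -/
lemma SolvesCE.ofReal_integral_sub_le (hH : IsDoubleWell H) {ε : ℝ} (h : SolvesCE T ρ v)
    (hT : 0 < T) (hac : ∀ t ∈ Icc 0 T, (ρ t : Measure Xi) ≪ gam H ε) {m : ℝ≥0}
    (hm : ∀ t ∈ Icc 0 T, (ρ t).mass = m) {t : ℝ} (ht : t ∈ Icc 0 T) {f : ℝ → ℝ}
    (hf : Continuous f) (hf0 : ∀ x ∈ Icc (-1 : ℝ) 1, 0 ≤ f x) :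
    ENNReal.ofReal ((∫ ξ : Xi, f ξ ∂(ρ t : Measure Xi)) -
      ∫ ξ : Xi, (Real.exp (f ξ) - 1 - f ξ) ∂gam H ε) ≤ regEntropy (gam H ε) (ρ 0) +
        ENNReal.ofReal 3 * ∫⁻ t in Ioo 0 T, diss H ε (ρ t) (v t) := by
  have hy : t / T ∈ Icc (0 : ℝ) 1 := ⟨div_nonneg ht.1 hT.le, div_le_one_of_le₀ ht.2 hT.le⟩
  have hfx : Continuous fun ξ : Xi => f ξ := hf.comp continuous_subtype_val
  have hF := continuousOn_integral h.cont hfx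
  have hF' : ContinuousOn (fun x => ∫ ξ : Xi, f ξ ∂(ρ (T * x) : Measure Xi)) (Icc 0 1) :=
    hF.comp (by fun_prop) fun x hx => ⟨mul_nonneg hT.le hx.1, by nlinarith [hx.2]⟩
  have hlim := tendsto_integral_bern hy hF'
  simp only [mul_div_cancel₀ t hT.ne'] at hlim
  refine le_of_tendsto (ENNReal.tendsto_ofReal (hlim.sub_const _)) (Eventually.of_forall fun N => ?_)
  have hk : ⌊N * (t / T)⌋₊ ≤ N :=
    Nat.floor_le_of_le (by nlinarith [hy.2, (Nat.cast_nonneg N : (0 : ℝ) ≤ N)])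
  obtain ⟨μ, hfin, hμac, hμ, hle⟩ := h.exists_average_entropy_le hH hT hac hm hk
  refine le_trans ?_ hle
  rw [← integral_bern_div hT N _ (fun t => ∫ ξ : Xi, f ξ ∂(ρ t : Measure Xi)), ← hμ _ hfx]
  exact ofReal_integral_sub_le_regEntropy hH.continuous hμac hf hf0

lemma regEntropy_le_of_freeEnergy_le (hH : Continuous H) {ε : ℝ} {ρ : FiniteMeasure Xi} {C : ℝ}
    (hC : freeEnergy (gam H ε) ρ ≤ (C : EReal)) :
    regEntropy (gam H ε) ρ ≤ ENNReal.ofReal (C + ρ.mass * Real.log ρ.mass + 1) := by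
  have := isProbabilityMeasure_gam hH ε
  unfold freeEnergy at hC
  split_ifs at hC with h
  · have hi : Integrable (fun ξ => dens (gam H ε) ρ ξ * Real.log (dens (gam H ε) ρ ξ) + 1)
        (gam H ε) := h.2.add (integrable_const _)
    have h0 := fun ξ => eta_le (dens_nonneg (gam H ε) ρ ξ)
    calc regEntropy (gam H ε) ρ ≤ ∫⁻ ξ, ENNReal.ofReal
          (dens (gam H ε) ρ ξ * Real.log (dens (gam H ε) ρ ξ) + 1) ∂gam H ε :=
        lintegral_mono fun ξ => ENNReal.ofReal_le_ofReal (h0 ξ)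
      _ = ENNReal.ofReal (∫ ξ, (dens (gam H ε) ρ ξ * Real.log (dens (gam H ε) ρ ξ) + 1) ∂gam H ε) :=
        (ofReal_integral_eq_lintegral_ofReal hi (Eventually.of_forall fun ξ =>
          (eta_nonneg (dens_nonneg _ _ _)).trans (h0 ξ))).symm
      _ ≤ _ := by
        refine ENNReal.ofReal_le_ofReal ?_
        rw [integral_add h.2 (integrable_const _)]
        have : (∫ ξ, dens (gam H ε) ρ ξ * Real.log (dens (gam H ε) ρ ξ) ∂gam H ε)
          - (ρ.mass : ℝ) * Real.log (ρ.mass : ℝ) ≤ C := by exact_mod_cast hC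
        simp
        linarith
  · exact absurd hC (by simp)

/-- A measure that does not charge the interior of `Ξ` is a combination of the two wells. -/
lemma eq_dirac_add_dirac {ρ : FiniteMeasure Xi}
    (h : ∫ ξ : Xi, (1 - (ξ : ℝ) ^ 2) ∂(ρ : Measure Xi) = 0) :
    (ρ : Measure Xi) =
      ENNReal.ofReal ((∫ ξ : Xi, (1 - (ξ : ℝ)) ∂(ρ : Measure Xi)) / 2) • Measure.dirac leftWell
      + ENNReal.ofReal ((∫ ξ : Xi, (1 + (ξ : ℝ)) ∂(ρ : Measure Xi)) / 2) •
        Measure.dirac rightWell := by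
  have hsq : ∀ ξ : Xi, 0 ≤ 1 - (ξ : ℝ) ^ 2 := fun ξ => by nlinarith [ξ.2.1, ξ.2.2]
  have hae := (integral_eq_zero_iff_of_nonneg hsq
    (integrable_of_continuous (ρ : Measure Xi) (by fun_prop))).1 h
  have hmem : ∀ᵐ ξ ∂(ρ : Measure Xi), ξ ∈ ({leftWell, rightWell} : Set Xi) := by
    filter_upwards [hae] with ξ hξ
    have h1 : (1 - (ξ : ℝ)) * (1 + ξ) = 0 := by
      simp only [Pi.zero_apply] at hξ; linarith
    rcases mul_eq_zero.1 h1 with h | h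
    · right; exact Subtype.ext (by simp [rightWell]; linarith)
    · left; exact Subtype.ext (by simp [leftWell]; linarith)
  have hne : leftWell ≠ rightWell := fun h => by
    have := congrArg Subtype.val h
    norm_num [leftWell, rightWell] at this
  have hdec : (ρ : Measure Xi) = (ρ : Measure Xi) {leftWell} • Measure.dirac leftWell +
      (ρ : Measure Xi) {rightWell} • Measure.dirac rightWell := by
    conv_lhs => rw [← Measure.restrict_eq_self_of_ae_mem hmem, Set.insert_eq,
      Measure.restrict_union (by simpa using hne) (measurableSet_singleton _),
      Measure.restrict_singleton, Measure.restrict_singleton]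
  have hint : ∀ f : Xi → ℝ, ∫ ξ, f ξ ∂(ρ : Measure Xi) =
      ((ρ : Measure Xi) {leftWell}).toReal * f leftWell +
      ((ρ : Measure Xi) {rightWell}).toReal * f rightWell := fun f => by
    conv_lhs => rw [hdec]
    rw [integral_add_measure ((integrable_dirac (by simp)).smul_measure (measure_ne_top _ _))
      ((integrable_dirac (by simp)).smul_measure (measure_ne_top _ _)),
      integral_smul_measure, integral_smul_measure, integral_dirac, integral_dirac, smul_eq_mul,
      smul_eq_mul]
  rw [hint, hint]
  conv_lhs => rw [hdec]
  simp only [leftWell, rightWell]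
  congr 2
  · refine (ENNReal.ofReal_toReal (measure_ne_top (ρ : Measure Xi) {_})).symm.trans ?_
    congr 1
    ring
  · refine (ENNReal.ofReal_toReal (measure_ne_top (ρ : Measure Xi) {_})).symm.trans ?_
    congr 1
    ring

/-- Test with f = c(1 - x²). It vanishes at the wells, so the exponential correction tends to zero
with ε; hence c ∫(1 - ξ²) dμ₀ ≤ K for every c ≥ 0. -/
lemma integral_one_sub_sq_eq_zero (hH : IsDoubleWell H) {l : Filter ℝ} [NeBot l]
    (hl : l ≤ 𝓝[>] 0) {μ : ℝ → FiniteMeasure Xi} {μ₀ : FiniteMeasure Xi}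
    (hμ : Tendsto μ l (𝓝 μ₀)) {K : ℝ}
    (hK : ∀ᶠ ε in l, ∀ f : ℝ → ℝ, Continuous f → (∀ x ∈ Icc (-1 : ℝ) 1, 0 ≤ f x) →
      (∫ ξ : Xi, f ξ ∂(μ ε : Measure Xi)) - ∫ ξ : Xi, (Real.exp (f ξ) - 1 - f ξ) ∂gam H ε ≤ K) :
    ∫ ξ : Xi, (1 - (ξ : ℝ) ^ 2) ∂(μ₀ : Measure Xi) = 0 := by
  have hsq : ∀ ξ : Xi, 0 ≤ 1 - (ξ : ℝ) ^ 2 := fun ξ => by nlinarith [ξ.2.1, ξ.2.2]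
  set I := ∫ ξ : Xi, (1 - (ξ : ℝ) ^ 2) ∂(μ₀ : Measure Xi) with hI
  have h0 : 0 ≤ I := integral_nonneg hsq
  have key : ∀ c : ℝ, 0 ≤ c → c * I ≤ K := by
    intro c hc
    have h1 : Tendsto (fun ε => ∫ ξ : Xi, (c * (1 - (ξ : ℝ) ^ 2)) ∂(μ ε : Measure Xi)) l
        (𝓝 (c * I)) := by
      rw [hI, ← integral_const_mul]
      exact ((continuous_integral_finiteMeasure (by fun_prop)).tendsto μ₀).comp hμ
    have h2 := (tendsto_integral_gam hH (f := fun x => Real.exp (c * (1 - x ^ 2)) - 1 -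
      c * (1 - x ^ 2)) (by fun_prop)).mono_left hl
    norm_num at h2
    have h3 := h1.sub h2
    rw [sub_zero] at h3
    refine le_of_tendsto h3 ?_
    filter_upwards [hK] with ε hε
    exact hε (fun x => c * (1 - x ^ 2)) (by fun_prop)
      fun x hx => mul_nonneg hc (by nlinarith [hx.1, hx.2])
  by_contra hne
  have hpos : 0 < I := lt_of_le_of_ne h0 (Ne.symm hne)
  have h1 := key ((|K| + 1) / I) (by positivity)
  rw [div_mul_cancel₀ _ hpos.ne'] at h1
  linarith [le_abs_self K]

end Concentration

end Kramers

/-! ### The cell variable and cut-offs at the wells -/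

namespace Kramers

section CellTest

variable {H : ℝ → ℝ}

/-- The change of variables that maps `[-1, 1]` to `[-κ, κ]`. -/
noncomputable def cellVar (H : ℝ → ℝ) (ε x : ℝ) : ℝ :=
  -kap H + ∫ y in (-1 : ℝ)..x, 1 / (g H ε y * tau H ε)

lemma continuous_one_div_g_mul_tau (hH : IsDoubleWell H) (ε : ℝ) :
    Continuous fun x => 1 / (g H ε x * tau H ε) :=
  continuous_const.div ((continuous_g hH.continuous ε).mul continuous_const)
    fun x => (mul_pos (g_pos hH.continuous ε x) (tau_pos hH ε)).ne'

lemma hasDerivAt_cellVar (hH : IsDoubleWell H) (ε x : ℝ) :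
    HasDerivAt (cellVar H ε) (1 / (g H ε x * tau H ε)) x :=
  ((continuous_one_div_g_mul_tau hH ε).integral_hasStrictDerivAt (-1) x).hasDerivAt.const_add _

lemma continuous_cellVar (hH : IsDoubleWell H) (ε : ℝ) : Continuous (cellVar H ε) :=
  continuous_iff_continuousAt.2 fun x => (hasDerivAt_cellVar hH ε x).continuousAt

lemma cellVar_neg_one (ε : ℝ) : cellVar H ε (-1) = -kap H := by simp [cellVar]

/-- The normalization of τ_ε is the one for which ∫ dξ/(g_ε τ_ε) = 2κ. -/
lemma cellVar_one (hH : IsDoubleWell H) (ε : ℝ) : cellVar H ε 1 = kap H := by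
  have hκ := hH.kap_pos
  have hI := integral_one_div_g_pos hH.continuous ε
  have e : ∀ y, 1 / (g H ε y * tau H ε) = 1 / tau H ε * (1 / g H ε y) := fun y => by
    rw [mul_comm, one_div_mul_one_div]
  simp only [cellVar, e, intervalIntegral.integral_const_mul]
  unfold tau
  field_simp
  ring

lemma monotone_cellVar (hH : IsDoubleWell H) (ε : ℝ) : Monotone (cellVar H ε) :=
  monotone_of_hasDerivAt_nonneg (hasDerivAt_cellVar hH ε) fun x =>
    one_div_nonneg.2 (mul_pos (g_pos hH.continuous ε x) (tau_pos hH ε)).le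

lemma cellVar_mem (hH : IsDoubleWell H) (ε : ℝ) {x : ℝ} (hx : x ∈ Icc (-1 : ℝ) 1) :
    cellVar H ε x ∈ Icc (-kap H) (kap H) := by
  exact ⟨(cellVar_neg_one ε).symm.trans_le (monotone_cellVar hH ε hx.1),
    (monotone_cellVar hH ε hx.2).trans_eq (cellVar_one hH ε)⟩

variable {a b c : ℝ → ℝ}

/-- Lower bounds for the dissipation from a pair of functions on the cell and a pair of
probability densities that serve to cut off at the wells. -/
lemma ofReal_cellTest_le_diss (hH : IsDoubleWell H) (ε : ℝ) (ha : Continuous a) (hc : Continuous c)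
    (hb : ∀ σ, HasDerivAt b (c σ) σ) {q r : ℝ → ℝ} (hq : Continuous q) (hr : Continuous r)
    (hq1 : ∫ x in (-1 : ℝ)..1, q x = 1) (hr1 : ∫ x in (-1 : ℝ)..1, r x = 1)
    (ρ : FiniteMeasure Xi) {v : Xi → ℝ} (hv : Measurable v) :
    ENNReal.ofReal ((∫ ξ : Xi, v ξ * (a (cellVar H ε ξ) * (1 / (g H ε ξ * tau H ε)))
        ∂(ρ : Measure Xi)) +
      ∫ ξ : Xi, (b (kap H) * (q ξ / g H ε ξ) - b (-kap H) * (r ξ / g H ε ξ) -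
        1 / (g H ε ξ ^ 2 * tau H ε) * (c (cellVar H ε ξ) + a (cellVar H ε ξ) ^ 2 / 2 +
          (b (cellVar H ε ξ) - b (-kap H) - b (kap H) * (∫ y in (-1 : ℝ)..ξ, q y) +
            b (-kap H) * ∫ y in (-1 : ℝ)..ξ, r y) ^ 2 / 2)) ∂(ρ : Measure Xi)) ≤
      diss H ε ρ v := by
  have hs := continuous_cellVar hH ε
  have hg1 := continuous_one_div_g_mul_tau hH ε
  have hτ := tau_pos hH ε
  -- By the chain rule the first term has the primitive b(s) - b(-κ), up to 1/τ. The densities q and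
  -- r remove the values b(κ) and b(-κ), so that the whole primitive vanishes at x = 1 as well.
  set f : ℝ → ℝ := fun x => 1 / tau H ε * (c (cellVar H ε x) * (1 / (g H ε x * tau H ε)) -
    b (kap H) * q x + b (-kap H) * r x) with hf
  have hf1 : Continuous fun x => c (cellVar H ε x) * (1 / (g H ε x * tau H ε)) :=
    (hc.comp hs).mul hg1
  have hfc : Continuous f := by fun_prop
  have hp : ∀ x, ∫ y in (-1 : ℝ)..x, f y = 1 / tau H ε * (b (cellVar H ε x) - b (-kap H) -
      b (kap H) * (∫ y in (-1 : ℝ)..x, q y) + b (-kap H) * ∫ y in (-1 : ℝ)..x, r y) := by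
    intro x
    have i1 := hf1.intervalIntegrable (μ := volume) (-1) x
    have i2 := (hq.const_mul (b (kap H))).intervalIntegrable (μ := volume) (-1) x
    have i3 := (hr.const_mul (b (-kap H))).intervalIntegrable (μ := volume) (-1) x
    have i12 : IntervalIntegrable (fun x => c (cellVar H ε x) * (1 / (g H ε x * tau H ε)) -
      b (kap H) * q x) volume (-1) x := i1.sub i2
    simp only [hf]
    rw [intervalIntegral.integral_const_mul, intervalIntegral.integral_add i12 i3,
      intervalIntegral.integral_sub i1 i2, intervalIntegral.integral_const_mul,
      intervalIntegral.integral_const_mul,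
      intervalIntegral.integral_eq_sub_of_hasDerivAt
        (fun y _ => (hb (cellVar H ε y)).comp y (hasDerivAt_cellVar hH ε y)) i1]
    simp [cellVar_neg_one]
  have h0 : ∫ y in (-1 : ℝ)..1, f y = 0 := by
    rw [hp, hq1, hr1, cellVar_one hH]; ring
  refine le_of_eq_of_le ?_ (ofReal_le_diss hH (ε := ε) ρ hv
    (α := fun x => a (cellVar H ε x) * (1 / (g H ε x * tau H ε))) ((ha.comp hs).mul hg1) hfc h0)
  congr 2
  refine integral_congr_ae (Eventually.of_forall fun ξ => ?_)
  have hgx := g_pos hH.continuous ε ξ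
  have hfx : f ξ = 1 / tau H ε * (c (cellVar H ε ξ) * (1 / (g H ε ξ * tau H ε)) -
    b (kap H) * q ξ + b (-kap H) * r ξ) := rfl
  simp only [hp]
  rw [hfx]
  field_simp
  ring

/-- The threshold 1/4 is the one below which `eventually_well_small` applies. -/
lemma exists_layer (hH : IsDoubleWell H) :
    ∃ r ∈ Ioo (0 : ℝ) 1, ∀ x : ℝ, r ≤ |x| → |x| ≤ 1 → H x ≤ 1 / 4 := by
  have h1 : ∀ᶠ x in 𝓝 (1 : ℝ), H x < 1 / 4 :=
    hH.continuous.continuousAt.eventually_lt continuousAt_const (by rw [hH.at_one]; norm_num)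
  obtain ⟨δ, hδ, hb⟩ := Metric.eventually_nhds_iff.1 h1
  refine ⟨max (1 / 2) (1 - δ / 2), ⟨by positivity, max_lt (by norm_num) (by linarith)⟩,
    fun x hx hx1 => ?_⟩
  have h2 : H |x| ≤ 1 / 4 := by
    refine (hb ?_).le
    rw [Real.dist_eq, abs_lt]
    constructor <;> linarith [le_max_right (1 / 2) (1 - δ / 2)]
  rcases abs_choice x with h | h
  · rwa [h] at h2
  · rwa [h, hH.even] at h2

/-- A continuous cut-off that vanishes for `x ≤ r` and equals `1` at `x = 1`. -/
noncomputable def ramp (r x : ℝ) : ℝ := max 0 ((x - r) / (1 - r))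

@[fun_prop]
lemma continuous_ramp (r : ℝ) : Continuous (ramp r) := by unfold ramp; fun_prop

lemma ramp_nonneg (r x : ℝ) : 0 ≤ ramp r x := le_max_left _ _

lemma ramp_eq_zero {r x : ℝ} (hr : r < 1) (hx : x ≤ r) : ramp r x = 0 :=
  max_eq_left (div_nonpos_of_nonpos_of_nonneg (by linarith) (by linarith))

lemma ramp_one {r : ℝ} (hr : r < 1) : ramp r 1 = 1 := by
  rw [ramp, div_self (by linarith)]; simp

lemma ramp_le_one {r x : ℝ} (hr : r < 1) (hx : x ≤ 1) : ramp r x ≤ 1 :=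
  max_le zero_le_one ((div_le_one (by linarith)).2 (by linarith))

/-- Both functions agree at x = ±1, so their difference is controlled by 1 - x², which the limit
measures do not see. -/
lemma abs_ramp_sub_le {r x : ℝ} (hr : r ∈ Ioo (0 : ℝ) 1) (hx : x ∈ Icc (-1 : ℝ) 1) :
    |ramp r x - (1 + x) / 2| ≤ 1 / (1 - r) * (1 - x ^ 2) := by
  obtain ⟨h0, h1⟩ := hr
  obtain ⟨hx0, hx1⟩ := hx
  have hr' : 0 < 1 - r := by linarith
  have e : |ramp r x - (1 + x) / 2| * (1 - r) = |(ramp r x - (1 + x) / 2) * (1 - r)| := by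
    rw [abs_mul, abs_of_pos hr']
  rw [div_mul_eq_mul_div, one_mul, le_div_iff₀ hr', e]
  rcases le_total x r with h | h
  · rw [ramp_eq_zero h1 h, abs_le]
    constructor <;> nlinarith
  · rw [ramp, max_eq_right (div_nonneg (by linarith) hr'.le), sub_mul, div_mul_cancel₀ _ hr'.ne',
      abs_le]
    constructor <;> nlinarith

end CellTest

end Kramers

/-! ### Estimates for the cell tests near the wells -/

namespace Kramers

section CellTest

variable {H : ℝ → ℝ} {a b c : ℝ → ℝ}

/-- Each well carries half of the limit mass, so a cut-off equal to 1 at one well and 0 at the other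
has γ_ε-integral close to 1/2; normalizing it produces the factor 2. -/
lemma eventually_integral_ramp (hH : IsDoubleWell H) {f : ℝ → ℝ} (hf : Continuous f)
    (hf1 : f (-1) + f 1 = 1) {δ : ℝ} (hδ : 0 < δ) :
    ∀ᶠ ε in 𝓝[>] (0 : ℝ), 0 < ∫ x in (-1 : ℝ)..1, g H ε x * f x ∧
      |(∫ x in (-1 : ℝ)..1, g H ε x * f x)⁻¹ - 2| ≤ δ := by
  have h1 := tendsto_integral_gam hH hf
  simp only [hf1, integral_gam hH.continuous] at h1
  have h2 := h1.inv₀ (by norm_num)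
  filter_upwards [h1.eventually_const_lt (show (0 : ℝ) < 1 / 2 by norm_num),
    h2 (Metric.closedBall_mem_nhds _ hδ)] with ε h3 h4
  refine ⟨h3, ?_⟩
  simpa [Real.dist_eq] using h4

lemma integral_primitive_mem {q : ℝ → ℝ} (hq : Continuous q)
    (hq0 : ∀ x ∈ Icc (-1 : ℝ) 1, 0 ≤ q x) (hq1 : ∫ x in (-1 : ℝ)..1, q x = 1) {x : ℝ}
    (hx : x ∈ Icc (-1 : ℝ) 1) : ∫ y in (-1 : ℝ)..x, q y ∈ Icc (0 : ℝ) 1 := by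
  have h1 := intervalIntegral.integral_nonneg (μ := volume) hx.1
    fun y hy => hq0 y ⟨hy.1, hy.2.trans hx.2⟩
  have h2 := intervalIntegral.integral_nonneg (μ := volume) hx.2
    fun y hy => hq0 y ⟨hx.1.trans hy.1, hy.2⟩
  have h3 := intervalIntegral.integral_add_adjacent_intervals
    (hq.intervalIntegrable (μ := volume) (-1) x) (hq.intervalIntegrable x 1)
  exact ⟨h1, by linarith⟩

/-- The slope of the cell variable is at most δ there: it is almost constant in a well. -/
lemma kap_sub_cellVar_le (hH : IsDoubleWell H) {ε r δ : ℝ}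
    (hδ : ∀ x ∈ Icc r 1, 1 / (g H ε x * tau H ε) ≤ δ) {x : ℝ} (hx : x ∈ Icc r 1) :
    kap H - cellVar H ε x ≤ δ * (1 - x) := by
  have hc := continuous_one_div_g_mul_tau hH ε
  have h3 := intervalIntegral.integral_add_adjacent_intervals
    (hc.intervalIntegrable (μ := volume) (-1) x) (hc.intervalIntegrable x 1)
  have h4 : ∫ y in x..1, 1 / (g H ε y * tau H ε) ≤ ∫ _y in x..1, δ :=
    intervalIntegral.integral_mono_on hx.2 (hc.intervalIntegrable _ _) (by simp)
      fun y hy => hδ y ⟨hx.1.trans hy.1, hy.2⟩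
  rw [intervalIntegral.integral_const, smul_eq_mul] at h4
  rw [← cellVar_one hH ε, cellVar, cellVar]
  linarith

lemma cellVar_add_kap_le (hH : IsDoubleWell H) {ε r δ : ℝ}
    (hδ : ∀ x ∈ Icc (-1) r, 1 / (g H ε x * tau H ε) ≤ δ) {x : ℝ} (hx : x ∈ Icc (-1) r) :
    cellVar H ε x + kap H ≤ δ * (1 + x) := by
  have hc := continuous_one_div_g_mul_tau hH ε
  have h4 : ∫ y in (-1)..x, 1 / (g H ε y * tau H ε) ≤ ∫ _y in (-1)..x, δ :=
    intervalIntegral.integral_mono_on hx.1 (hc.intervalIntegrable _ _) (by simp)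
      fun y hy => hδ y ⟨hy.1, hy.2.trans hx.2⟩
  rw [intervalIntegral.integral_const, smul_eq_mul] at h4
  rw [cellVar]
  linarith

lemma integral_comp_cellVar (hH : IsDoubleWell H) (ε : ℝ) (ha : Continuous a) (x : ℝ) :
    ∫ y in (-1 : ℝ)..x, a (cellVar H ε y) * (1 / (g H ε y * tau H ε)) =
      ∫ σ in (-kap H)..cellVar H ε x, a σ := by
  rw [← cellVar_neg_one ε]
  exact intervalIntegral.integral_comp_mul_deriv (fun y _ => hasDerivAt_cellVar hH ε y)
    (continuous_one_div_g_mul_tau hH ε).continuousOn ha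

lemma abs_integral_le_of_mem {κ B : ℝ} (hB : ∀ σ ∈ Icc (-κ) κ, |a σ| ≤ B)
    {s t : ℝ} (hs : s ∈ Icc (-κ) κ) (ht : t ∈ Icc (-κ) κ) (hst : s ≤ t) :
    |∫ σ in s..t, a σ| ≤ B * (t - s) := by
  have := intervalIntegral.norm_integral_le_of_norm_le_const (f := a) (a := s) (b := t) (C := B)
    fun x hx => by
      rw [uIoc_of_le hst] at hx
      exact hB x ⟨hs.1.trans hx.1.le, hx.2.trans ht.2⟩
  rwa [Real.norm_eq_abs, abs_of_nonneg (sub_nonneg.2 hst)] at this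

/-- The primitives of the flux test functions are close to a linear function at the wells. -/
lemma abs_integral_cellVar_sub_le (hH : IsDoubleWell H) {ε r δ B : ℝ} (hr : r ∈ Ioo (0 : ℝ) 1)
    (ha : Continuous a) (hB : ∀ σ ∈ Icc (-kap H) (kap H), |a σ| ≤ B)
    (hδ : ∀ x, r ≤ |x| → |x| ≤ 1 → 1 / (g H ε x * tau H ε) ≤ δ) (hδ0 : 0 ≤ δ) {x : ℝ}
    (hx : x ∈ Icc (-1 : ℝ) 1) :
    |(∫ y in (-1 : ℝ)..x, a (cellVar H ε y) * (1 / (g H ε y * tau H ε))) -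
      (∫ σ in (-kap H)..kap H, a σ) * ((1 + x) / 2)| ≤
      B * δ + (kap H * B + 4 * kap H * B / (1 - r ^ 2)) * (1 - x ^ 2) := by
  have hκ := hH.kap_pos
  obtain ⟨hr0, hr1⟩ := hr
  have hl : -kap H ∈ Icc (-kap H) (kap H) := ⟨le_rfl, by linarith⟩
  have hu : kap H ∈ Icc (-kap H) (kap H) := ⟨by linarith, le_rfl⟩
  have hB0 : 0 ≤ B := (abs_nonneg _).trans (hB _ hl)
  have hs := cellVar_mem hH ε hx
  have hx2 : 0 ≤ 1 - x ^ 2 := by nlinarith [hx.1, hx.2]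
  have hr2 : 0 < 1 - r ^ 2 := by nlinarith
  rw [integral_comp_cellVar hH ε ha]
  set A := ∫ σ in (-kap H)..kap H, a σ with hA
  set Φ := ∫ σ in (-kap H)..cellVar H ε x, a σ with hΦ
  have hAb : |A| ≤ B * (2 * kap H) := by
    have := abs_integral_le_of_mem hB hl hu (by linarith)
    rwa [show kap H - -kap H = 2 * kap H by ring] at this
  have hΦb := abs_integral_le_of_mem hB hl hs hs.1
  have hΦb' := abs_integral_le_of_mem hB hs hu hs.2
  have hadd := intervalIntegral.integral_add_adjacent_intervals
    (ha.intervalIntegrable (μ := volume) (-kap H) (cellVar H ε x))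
    (ha.intervalIntegrable (cellVar H ε x) (kap H))
  rw [show (∫ σ in cellVar H ε x..kap H, a σ) = A - Φ by linarith] at hΦb'
  have hK1 : 0 ≤ kap H * B * (1 - x ^ 2) := by positivity
  have hK2 : 0 ≤ 4 * kap H * B / (1 - r ^ 2) * (1 - x ^ 2) := by positivity
  rw [add_mul]
  have hA' := abs_le.1 hAb
  have hΦ' := abs_le.1 hΦb
  have hΦ'' := abs_le.1 hΦb'
  -- In a well s is close to ±κ, so the primitive is close to A or to 0; there the linear function
  -- is within a multiple of 1 - x² of the same value.
  rcases le_total r |x| with h | h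
  · rcases le_total 0 x with h0 | h0
    · rw [abs_of_nonneg h0] at h
      have h5 := kap_sub_cellVar_le hH (ε := ε) (δ := δ) (r := r)
        (fun y hy => hδ y (hy.1.trans (le_abs_self y)) (abs_le.2 ⟨by linarith [hy.1], hy.2⟩))
        ⟨h, hx.2⟩
      have h6 : B * (kap H - cellVar H ε x) ≤ B * δ := by
        refine mul_le_mul_of_nonneg_left (h5.trans ?_) hB0
        nlinarith
      have h7 : |A * ((1 - x) / 2)| ≤ kap H * B * (1 - x ^ 2) := by
        rw [abs_mul, abs_of_nonneg (by linarith [hx.2] : 0 ≤ (1 - x) / 2)]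
        calc |A| * ((1 - x) / 2) ≤ B * (2 * kap H) * ((1 - x) / 2) :=
              mul_le_mul_of_nonneg_right hAb (by linarith [hx.2])
          _ = kap H * B * (1 - x) := by ring
          _ ≤ _ := mul_le_mul_of_nonneg_left (by nlinarith [hx.2]) (by positivity)
      rw [show Φ - A * ((1 + x) / 2) = A * ((1 - x) / 2) - (A - Φ) by ring]
      refine (abs_sub _ _).trans ?_
      linarith
    · rw [abs_of_nonpos h0] at h
      have h5 := cellVar_add_kap_le hH (ε := ε) (δ := δ) (r := -r)
        (fun y hy => hδ y (by rw [abs_of_nonpos (by linarith [hy.2])]; linarith [hy.2])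
          (abs_le.2 ⟨hy.1, by linarith [hy.2]⟩))
        ⟨hx.1, by linarith⟩
      have h6 : B * (cellVar H ε x - -kap H) ≤ B * δ := by
        refine mul_le_mul_of_nonneg_left ?_ hB0
        nlinarith
      have h7 : |A * ((1 + x) / 2)| ≤ kap H * B * (1 - x ^ 2) := by
        rw [abs_mul, abs_of_nonneg (by linarith [hx.1] : 0 ≤ (1 + x) / 2)]
        calc |A| * ((1 + x) / 2) ≤ B * (2 * kap H) * ((1 + x) / 2) :=
              mul_le_mul_of_nonneg_right hAb (by linarith [hx.1])
          _ = kap H * B * (1 + x) := by ring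
          _ ≤ _ := mul_le_mul_of_nonneg_left (by nlinarith [hx.1]) (by positivity)
      refine (abs_sub _ _).trans ?_
      linarith
  -- Between the wells 1 - x² ≥ 1 - r², so any bounded error is absorbed in the second term.
  · have h1 : 4 * kap H * B ≤ 4 * kap H * B / (1 - r ^ 2) * (1 - x ^ 2) := by
      rw [div_mul_eq_mul_div, le_div_iff₀ hr2]
      refine mul_le_mul_of_nonneg_left ?_ (by positivity)
      have := sq_abs x
      nlinarith [abs_nonneg x]
    have h2 : |A * ((1 + x) / 2)| ≤ B * (2 * kap H) := by
      rw [abs_mul, abs_of_nonneg (by linarith [hx.1] : 0 ≤ (1 + x) / 2)]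
      exact (mul_le_of_le_one_right (abs_nonneg _) (by linarith [hx.2])).trans hAb
    have h3 : |Φ| ≤ B * (2 * kap H) :=
      hΦb.trans (mul_le_mul_of_nonneg_left (by linarith [hs.2]) hB0)
    refine (abs_sub _ _).trans ?_
    have : 0 ≤ B * δ := by positivity
    linarith

/-- The error terms in the cell test functions are small at the wells. -/
lemma abs_potential_sub_le {r δ B I J p q x x' E : ℝ} (hr : r ∈ Ioo (0 : ℝ) 1)
    (hx : x ∈ Icc (-1 : ℝ) 1) (hx' : x' = -x) (hI : |I - 2| ≤ δ) (hJ : |J - 2| ≤ δ) (hp : |p| ≤ B)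
    (hq : |q| ≤ B) (hE : |E| ≤ 6 * B ^ 2 * δ) :
    |q * (ramp r x * I) - p * (ramp r x' * J) - E - (q * (1 + x) - p * (1 - x))| ≤
      (2 * B + 6 * B ^ 2) * δ + 4 * B / (1 - r) * (1 - x ^ 2) := by
  have key : ∀ {y L : ℝ}, y ∈ Icc (-1 : ℝ) 1 → |L - 2| ≤ δ →
      |ramp r y * L - (1 + y)| ≤ δ + 2 * (1 / (1 - r) * (1 - y ^ 2)) := by
    intro y L hy hL
    have h1 := abs_ramp_sub_le hr hy
    have h2 : |ramp r y * (L - 2)| ≤ δ := by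
      rw [abs_mul, abs_of_nonneg (ramp_nonneg _ _)]
      exact (mul_le_of_le_one_left (abs_nonneg _) (ramp_le_one hr.2 hy.2)).trans hL
    rw [show ramp r y * L - (1 + y) = ramp r y * (L - 2) + 2 * (ramp r y - (1 + y) / 2) by ring]
    refine (abs_add_le _ _).trans (add_le_add h2 ?_)
    rw [abs_mul, abs_two]
    linarith
  have k1 := key hx hI
  have k2 := key (y := x') ⟨by linarith [hx.2], by linarith [hx.1]⟩ hJ
  subst hx'
  rw [neg_sq] at k2
  have m : ∀ {s z R : ℝ}, |s| ≤ B → |z| ≤ R → |s * z| ≤ B * R := fun hs hz => by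
    rw [abs_mul]; exact mul_le_mul hs hz (abs_nonneg _) ((abs_nonneg _).trans hs)
  have m1 := m hq k1
  have m2 := m hp k2
  rw [show q * (ramp r x * I) - p * (ramp r (-x) * J) - E - (q * (1 + x) - p * (1 - x)) =
    q * (ramp r x * I - (1 + x)) - p * (ramp r (-x) * J - (1 + -x)) - E by ring]
  refine (abs_sub _ _).trans ((add_le_add_left (abs_sub _ _) _).trans ?_)
  have : 4 * B / (1 - r) * (1 - x ^ 2) = 4 * B * (1 / (1 - r) * (1 - x ^ 2)) := by ring
  rw [this]
  linarith

end CellTest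

end Kramers

/-! ### Construction of the cell tests -/

namespace Kramers

section CellTest

variable {H : ℝ → ℝ} {a b c : ℝ → ℝ}

/-- The test functions for the limit problem are limits of test functions for the dissipation. -/
lemma exists_cellTest (hH : IsDoubleWell H) (ha : Continuous a) (hc : Continuous c)
    (hb : ∀ σ, HasDerivAt b (c σ) σ)
    (hcell : ∀ σ ∈ Icc (-kap H) (kap H), c σ = -((a σ ^ 2 + b σ ^ 2) / 2)) :
    ∃ K : ℝ, ∀ δ > 0, ∀ᶠ ε in 𝓝[>] (0 : ℝ), ∃ α ψ : ℝ → ℝ, Continuous α ∧ Continuous ψ ∧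
      (∀ (ρ : FiniteMeasure Xi) (v : Xi → ℝ), Measurable v →
        ENNReal.ofReal ((∫ ξ : Xi, v ξ * α ξ ∂(ρ : Measure Xi)) +
          ∫ ξ : Xi, ψ ξ ∂(ρ : Measure Xi)) ≤ diss H ε ρ v) ∧
      ∀ x ∈ Icc (-1 : ℝ) 1,
        |ψ x - (b (kap H) * (1 + x) - b (-kap H) * (1 - x))| ≤ δ + K * (1 - x ^ 2) ∧
        |(∫ y in (-1 : ℝ)..x, α y) - (∫ σ in (-kap H)..kap H, a σ) * ((1 + x) / 2)| ≤
          δ + K * (1 - x ^ 2) := by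
  have hκ := hH.kap_pos
  have hbc : Continuous b := continuous_iff_continuousAt.2 fun x => (hb x).continuousAt
  obtain ⟨r, hr, hlayer⟩ := exists_layer hH
  have hr2 : 0 < 1 - r ^ 2 := by nlinarith [hr.1, hr.2]
  have hr1 : 0 < 1 - r := by linarith [hr.2]
  obtain ⟨B₁, hB₁⟩ := isCompact_Icc.exists_bound_of_continuousOn
    (s := Icc (-kap H) (kap H)) ha.continuousOn
  obtain ⟨B₂, hB₂⟩ := isCompact_Icc.exists_bound_of_continuousOn
    (s := Icc (-kap H) (kap H)) hbc.continuousOn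
  set B := max B₁ B₂
  have hBa : ∀ σ ∈ Icc (-kap H) (kap H), |a σ| ≤ B := fun σ hσ =>
    (hB₁ σ hσ).trans (le_max_left _ _)
  have hBb : ∀ σ ∈ Icc (-kap H) (kap H), |b σ| ≤ B := fun σ hσ =>
    (hB₂ σ hσ).trans (le_max_right _ _)
  have hl : -kap H ∈ Icc (-kap H) (kap H) := ⟨le_rfl, by linarith⟩
  have hu : kap H ∈ Icc (-kap H) (kap H) := ⟨by linarith, le_rfl⟩
  have hB0 : 0 ≤ B := (abs_nonneg _).trans (hBa _ hl)
  refine ⟨max (kap H * B + 4 * kap H * B / (1 - r ^ 2)) (4 * B / (1 - r)), fun δ hδ => ?_⟩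
  set δ' := δ / (2 * B + 6 * B ^ 2 + 1) with hδ'
  have hδ'0 : 0 < δ' := by positivity
  have hδ'1 : (2 * B + 6 * B ^ 2 + 1) * δ' = δ := by rw [hδ']; field_simp
  filter_upwards [eventually_well_small hH hδ'0,
    eventually_integral_ramp hH (f := fun x => ramp r x) (by fun_prop)
      (by rw [ramp_one hr.2, ramp_eq_zero hr.2 (by linarith [hr.1])]; norm_num) hδ'0,
    eventually_integral_ramp hH (f := fun x => ramp r (-x)) (by fun_prop)
      (by rw [neg_neg, ramp_one hr.2, ramp_eq_zero hr.2 (by linarith [hr.1])]; norm_num) hδ'0]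
    with ε hsmall ⟨hI0, hI⟩ ⟨hJ0, hJ⟩
  set I := ∫ x in (-1 : ℝ)..1, g H ε x * ramp r x with hIdef
  set J := ∫ x in (-1 : ℝ)..1, g H ε x * ramp r (-x) with hJdef
  have hgc := continuous_g hH.continuous ε
  have hgp := g_pos hH.continuous ε
  have hτ := tau_pos hH ε
  have hs := continuous_cellVar hH ε
  have hg1 := continuous_one_div_g_mul_tau hH ε
  have hsm : ∀ x, r ≤ |x| → |x| ≤ 1 →
      1 / (g H ε x * tau H ε) ≤ δ' ∧ 1 / (g H ε x ^ 2 * tau H ε) ≤ δ' := fun x h1 h2 =>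
    hsmall x (abs_le.1 h2) (hlayer x h1 h2)
  -- The weight g makes q/g a bounded cut-off, close to 1 + x at the wells. On Ξ, q lives on x ≥ r
  -- and w on x ≤ -r.
  let q : ℝ → ℝ := fun x => g H ε x * ramp r x * I⁻¹
  let w : ℝ → ℝ := fun x => g H ε x * ramp r (-x) * J⁻¹
  have hq : Continuous q := by fun_prop
  have hw : Continuous w := by fun_prop
  have hq0 : ∀ x, 0 ≤ q x := fun x =>
    mul_nonneg (mul_nonneg (hgp x).le (ramp_nonneg _ _)) (inv_nonneg.2 hI0.le)
  have hw0 : ∀ x, 0 ≤ w x := fun x =>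
    mul_nonneg (mul_nonneg (hgp x).le (ramp_nonneg _ _)) (inv_nonneg.2 hJ0.le)
  have hq1 : ∫ x in (-1 : ℝ)..1, q x = 1 := by
    simp only [q, intervalIntegral.integral_mul_const]
    exact mul_inv_cancel₀ hI0.ne'
  have hw1 : ∫ x in (-1 : ℝ)..1, w x = 1 := by
    simp only [w, intervalIntegral.integral_mul_const]
    exact mul_inv_cancel₀ hJ0.ne'
  have hPq : Continuous fun x => ∫ y in (-1 : ℝ)..x, q y :=
    intervalIntegral.continuous_primitive (fun a b => hq.intervalIntegrable a b) (-1)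
  have hPw : Continuous fun x => ∫ y in (-1 : ℝ)..x, w y :=
    intervalIntegral.continuous_primitive (fun a b => hw.intervalIntegrable a b) (-1)
  have has : Continuous fun x => a (cellVar H ε x) := ha.comp hs
  have hbs : Continuous fun x => b (cellVar H ε x) := hbc.comp hs
  have hcs : Continuous fun x => c (cellVar H ε x) := hc.comp hs
  set D : ℝ → ℝ := fun x => b (cellVar H ε x) - b (-kap H) - b (kap H) *
    (∫ y in (-1 : ℝ)..x, q y) + b (-kap H) * ∫ y in (-1 : ℝ)..x, w y with hD
  have hDc : Continuous D := by fun_prop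
  set E : ℝ → ℝ := fun x => 1 / (g H ε x ^ 2 * tau H ε) *
    (c (cellVar H ε x) + a (cellVar H ε x) ^ 2 / 2 + D x ^ 2 / 2) with hE
  have hEc : Continuous E := by
    have : Continuous fun x => 1 / (g H ε x ^ 2 * tau H ε) :=
      continuous_const.div ((hgc.pow 2).mul continuous_const)
        fun x => (mul_pos (pow_pos (hgp x) 2) hτ).ne'
    exact this.mul (by fun_prop)
  have hqg : ∀ x, q x / g H ε x = ramp r x * I⁻¹ := fun x => by
    have := (hgp x).ne'
    simp only [q]; field_simp
  have hwg : ∀ x, w x / g H ε x = ramp r (-x) * J⁻¹ := fun x => by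
    have := (hgp x).ne'
    simp only [w]; field_simp
  -- In the wells the prefactor is at most δ', and the bracket at most B² + B²/2 + (3B)²/2 = 6B².
  -- Between them ∫q = 0 and ∫w = 1 up to x, hence D = b(s) and the bracket vanishes by the cell
  -- equation.
  have hEb : ∀ x ∈ Icc (-1 : ℝ) 1, |E x| ≤ 6 * B ^ 2 * δ' := by
    intro x hx
    have hσ := cellVar_mem hH ε hx
    have h1 := hBb _ hσ
    have h2 := hBb _ hl
    have h3 := hBb _ hu
    rcases le_total r |x| with h | h
    · have hp1 := integral_primitive_mem hq (fun x _ => hq0 x) hq1 hx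
      have hp2 := integral_primitive_mem hw (fun x _ => hw0 x) hw1 hx
      have hDx : |D x| ≤ 3 * B := by
        have e : D x = b (cellVar H ε x) - b (kap H) * (∫ y in (-1 : ℝ)..x, q y) -
          b (-kap H) * (1 - ∫ y in (-1 : ℝ)..x, w y) := by simp only [hD]; ring
        have m : ∀ {s z : ℝ}, |s| ≤ B → z ∈ Icc (0 : ℝ) 1 → |s * z| ≤ B := fun hs hz => by
          rw [abs_mul, abs_of_nonneg hz.1]
          exact (mul_le_of_le_one_right (abs_nonneg _) hz.2).trans hs
        rw [e]
        refine (abs_sub _ _).trans ((add_le_add_left (abs_sub _ _) _).trans ?_)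
        have m1 := m h3 hp1
        have m2 := m h2 (z := 1 - ∫ y in (-1 : ℝ)..x, w y)
          ⟨by linarith [hp2.2], by linarith [hp2.1]⟩
        linarith
      have hsq : ∀ {y R : ℝ}, |y| ≤ R → y ^ 2 ≤ R ^ 2 := fun hy => sq_le_sq' (abs_le.1 hy).1 (abs_le.1 hy).2
      have s1 := hsq h1
      have s2 := hsq (hBa _ hσ)
      have s3 := hsq hDx
      have hbr : |c (cellVar H ε x) + a (cellVar H ε x) ^ 2 / 2 + D x ^ 2 / 2| ≤ 6 * B ^ 2 := by
        rw [hcell _ hσ, abs_le]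
        constructor <;> nlinarith [sq_nonneg (D x), sq_nonneg (b (cellVar H ε x)), sq_nonneg B]
      have h4 := (hsm x h (abs_le.2 hx)).2
      have h5 : 0 ≤ 1 / (g H ε x ^ 2 * tau H ε) :=
        one_div_nonneg.2 (mul_pos (pow_pos (hgp x) 2) hτ).le
      rw [hE, abs_mul, abs_of_nonneg h5, mul_comm]
      exact mul_le_mul hbr h4 h5 (by positivity)
    · obtain ⟨h4, h5⟩ := abs_le.1 h
      have e1 : ∫ y in (-1 : ℝ)..x, q y = 0 := by
        rw [intervalIntegral.integral_congr (g := fun _ => 0), intervalIntegral.integral_zero]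
        intro y hy
        rw [uIcc_of_le hx.1] at hy
        simp only [q]
        rw [ramp_eq_zero hr.2 (hy.2.trans h5)]; simp
      have e2 : ∫ y in x..1, w y = 0 := by
        rw [intervalIntegral.integral_congr (g := fun _ => 0), intervalIntegral.integral_zero]
        intro y hy
        rw [uIcc_of_le hx.2] at hy
        simp only [w]
        rw [ramp_eq_zero hr.2 (by linarith [hy.1])]; simp
      have e3 := intervalIntegral.integral_add_adjacent_intervals
        (hw.intervalIntegrable (μ := volume) (-1) x) (hw.intervalIntegrable x 1)
      rw [e2, hw1, add_zero] at e3
      have : E x = 0 := by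
        simp only [hE, hD]
        rw [e1, e3, hcell _ hσ]
        ring
      rw [this, abs_zero]
      positivity
  refine ⟨fun x => a (cellVar H ε x) * (1 / (g H ε x * tau H ε)),
    fun x => b (kap H) * (ramp r x * I⁻¹) - b (-kap H) * (ramp r (-x) * J⁻¹) - E x,
    has.mul hg1, by fun_prop, fun ρ v hv => ?_, fun x hx => ⟨?_, ?_⟩⟩
  · have := ofReal_cellTest_le_diss hH ε ha hc hb hq hw hq1 hw1 ρ hv
    simp only [hqg, hwg] at this
    exact this
  · have hx2 : 0 ≤ 1 - x ^ 2 := by nlinarith [hx.1, hx.2]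
    refine (abs_potential_sub_le hr hx rfl hI hJ (hBb _ hl) (hBb _ hu) (hEb x hx)).trans
      (add_le_add (by linarith) (mul_le_mul_of_nonneg_right (le_max_right _ _) hx2))
  · have hx2 : 0 ≤ 1 - x ^ 2 := by nlinarith [hx.1, hx.2]
    refine (abs_integral_cellVar_sub_le hH hr ha hBa (fun y h1 h2 => (hsm y h1 h2).1) hδ'0.le
      hx).trans (add_le_add ?_ (mul_le_mul_of_nonneg_right (le_max_left _ _) hx2))
    nlinarith [mul_nonneg hB0 hδ'0.le, mul_nonneg (sq_nonneg B) hδ'0.le]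

end CellTest

end Kramers

/-! ### Passage to the limit in the cell tests -/

namespace Kramers

section Limit

variable {H : ℝ → ℝ} {T : ℝ} {l : Filter ℝ} {ρ : ℝ → ℝ → FiniteMeasure Xi}
  {ρ₀ : ℝ → FiniteMeasure Xi} {v : ℝ → ℝ → Xi → ℝ} {m : ℝ≥0}

lemma tendsto_integral_curve [l.IsCountablyGenerated] {f : Xi → ℝ} (hf : Continuous f)
    (hρ : ∀ᶠ ε in l, ContinuousOn (ρ ε) (Icc 0 T))
    (hm : ∀ᶠ ε in l, ∀ t ∈ Icc 0 T, (ρ ε t).mass = m)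
    (hlim : ∀ t ∈ Icc 0 T, Tendsto (fun ε => ρ ε t) l (𝓝 (ρ₀ t))) {s t : ℝ} (hs : s ∈ Icc 0 T)
    (ht : t ∈ Icc 0 T) (hst : s ≤ t) :
    Tendsto (fun ε => ∫ r in s..t, ∫ ξ, f ξ ∂(ρ ε r : Measure Xi)) l
      (𝓝 (∫ r in s..t, ∫ ξ, f ξ ∂(ρ₀ r : Measure Xi))) := by
  obtain ⟨B, hB⟩ := isCompact_univ.exists_bound_of_continuousOn hf.continuousOn
  have hsub : Icc s t ⊆ Icc 0 T := Icc_subset_Icc hs.1 ht.2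
  refine intervalIntegral.tendsto_integral_filter_of_dominated_convergence (fun _ => B * m) ?_ ?_
    (by simp) ?_
  · filter_upwards [hρ] with ε hε
    rw [uIoc_of_le hst]
    exact (((continuousOn_integral hε hf).mono hsub).integrableOn_Icc.mono_set
      Ioc_subset_Icc_self).aestronglyMeasurable
  · filter_upwards [hm] with ε hε
    refine Eventually.of_forall fun r hr => ?_
    rw [uIoc_of_le hst] at hr
    have := norm_integral_le_of_norm_le_const (μ := (ρ ε r : Measure Xi))
      (Eventually.of_forall fun ξ => hB ξ (mem_univ _))
    rwa [show (ρ ε r : Measure Xi).real univ = m by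
      rw [← hε r (hsub (Ioc_subset_Icc_self hr))]; rfl] at this
  · refine Eventually.of_forall fun r hr => ?_
    rw [uIoc_of_le hst] at hr
    exact ((continuous_integral_finiteMeasure hf).tendsto _).comp
      (hlim r (hsub (Ioc_subset_Icc_self hr)))

lemma integral_sub_le_of_abs_sub_le {μ : FiniteMeasure Xi} {f h e : Xi → ℝ} (hf : Continuous f)
    (hh : Continuous h) (he : Continuous e) {δ : ℝ} (H : ∀ ξ, |f ξ - h ξ| ≤ δ + e ξ) :
    (∫ ξ, (h ξ - e ξ) ∂(μ : Measure Xi)) - δ * μ.mass ≤ ∫ ξ, f ξ ∂(μ : Measure Xi) ∧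
      ∫ ξ, f ξ ∂(μ : Measure Xi) ≤ (∫ ξ, (h ξ + e ξ) ∂(μ : Measure Xi)) + δ * μ.mass := by
  have hi := fun {f : Xi → ℝ} (hf : Continuous f) => integrable_of_continuous (μ : Measure Xi) hf
  have c1 : Continuous fun ξ => h ξ - e ξ := hh.sub he
  have c2 : Continuous fun ξ => h ξ + e ξ := hh.add he
  have e1 : δ * μ.mass = ∫ _ξ, δ ∂(μ : Measure Xi) := by
    rw [integral_const, smul_eq_mul, mul_comm]; rfl
  rw [e1, ← integral_sub (hi c1) (hi continuous_const),
    ← integral_add (hi c2) (hi continuous_const)]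
  constructor
  · refine integral_mono (hi (c1.sub continuous_const)) (hi hf) fun ξ => ?_
    have := (abs_le.1 (H ξ)).1
    simp only; linarith
  · refine integral_mono (hi hf) (hi (c2.add continuous_const)) fun ξ => ?_
    have := (abs_le.1 (H ξ)).2
    simp only; linarith

variable {a b c : ℝ → ℝ}

/-- Integrated cell tests bound the dissipation in the limit from below. -/
lemma ofReal_cellTest_le_liminf (hH : IsDoubleWell H) (hT : 0 < T) [NeBot l]
    [l.IsCountablyGenerated] (hl : l ≤ 𝓝[>] 0) (hv : ∀ᶠ ε in l, SolvesCE T (ρ ε) (v ε))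
    (hm : ∀ᶠ ε in l, ∀ t ∈ Icc 0 T, (ρ ε t).mass = m)
    (hlim : ∀ t ∈ Icc 0 T, Tendsto (fun ε => ρ ε t) l (𝓝 (ρ₀ t)))
    (hconc : ∀ t ∈ Icc 0 T, ∫ ξ : Xi, (1 - (ξ : ℝ) ^ 2) ∂(ρ₀ t : Measure Xi) = 0)
    (ha : Continuous a) (hc : Continuous c) (hb : ∀ σ, HasDerivAt b (c σ) σ)
    (hcell : ∀ σ ∈ Icc (-kap H) (kap H), c σ = -((a σ ^ 2 + b σ ^ 2) / 2))
    {s t : ℝ} (hs : s ∈ Icc 0 T) (ht : t ∈ Icc 0 T) (hst : s ≤ t) :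
    ENNReal.ofReal ((∫ σ in (-kap H)..kap H, a σ) *
      ((∫ ξ : Xi, (1 + (ξ : ℝ)) ∂(ρ₀ t : Measure Xi)) -
        ∫ ξ : Xi, (1 + (ξ : ℝ)) ∂(ρ₀ s : Measure Xi)) / 2 +
      ∫ r in s..t, (b (kap H) * (∫ ξ : Xi, (1 + (ξ : ℝ)) ∂(ρ₀ r : Measure Xi)) -
        b (-kap H) * ∫ ξ : Xi, (1 - (ξ : ℝ)) ∂(ρ₀ r : Measure Xi))) ≤
      liminf (fun ε => ∫⁻ r in Ioo s t, diss H ε (ρ ε r) (v ε r)) l := by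
  obtain ⟨K, hK⟩ := exists_cellTest hH ha hc hb hcell
  set A := ∫ σ in (-kap H)..kap H, a σ with hA
  set p := b (kap H)
  set p' := b (-kap H)
  set X := A * ((∫ ξ : Xi, (1 + (ξ : ℝ)) ∂(ρ₀ t : Measure Xi)) -
    ∫ ξ : Xi, (1 + (ξ : ℝ)) ∂(ρ₀ s : Measure Xi)) / 2 +
    ∫ r in s..t, (p * (∫ ξ : Xi, (1 + (ξ : ℝ)) ∂(ρ₀ r : Measure Xi)) -
      p' * ∫ ξ : Xi, (1 - (ξ : ℝ)) ∂(ρ₀ r : Measure Xi)) with hX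
  have hsub : Icc s t ⊆ Icc 0 T := Icc_subset_Icc hs.1 ht.2
  have hi := fun {f : Xi → ℝ} (μ : FiniteMeasure Xi) (hf : Continuous f) =>
    integrable_of_continuous (μ : Measure Xi) hf
  -- K may be large, but by concentration this error has zero integral against ρ₀(r) at every time
  -- r.
  set e : Xi → ℝ := fun ξ => K * (1 - (ξ : ℝ) ^ 2) with he
  have hec : Continuous e := by fun_prop
  have he0 : ∀ r ∈ Icc 0 T, ∫ ξ, e ξ ∂(ρ₀ r : Measure Xi) = 0 := fun r hr => by
    rw [he, integral_const_mul, hconc r hr, mul_zero]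
  set φ : Xi → ℝ := fun ξ => A * ((1 + (ξ : ℝ)) / 2) with hφ
  have hφc : Continuous φ := by fun_prop
  set χ : Xi → ℝ := fun ξ => p * (1 + (ξ : ℝ)) - p' * (1 - (ξ : ℝ)) with hχ
  have hχc : Continuous χ := by fun_prop
  have hφ0 : ∀ r, ∫ ξ, φ ξ ∂(ρ₀ r : Measure Xi) =
      A * (∫ ξ : Xi, (1 + (ξ : ℝ)) ∂(ρ₀ r : Measure Xi)) / 2 := fun r => by
    rw [hφ, integral_const_mul, integral_div]; ring
  have hχ0 : ∀ r, ∫ ξ, χ ξ ∂(ρ₀ r : Measure Xi) =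
      p * (∫ ξ : Xi, (1 + (ξ : ℝ)) ∂(ρ₀ r : Measure Xi)) -
      p' * ∫ ξ : Xi, (1 - (ξ : ℝ)) ∂(ρ₀ r : Measure Xi) := fun r => by
    rw [hχ, integral_sub (hi _ (by fun_prop)) (hi _ (by fun_prop)), integral_const_mul,
      integral_const_mul]
  have c1 : Continuous fun ξ => φ ξ - e ξ := hφc.sub hec
  have c2 : Continuous fun ξ => φ ξ + e ξ := hφc.add hec
  have c3 : Continuous fun ξ => χ ξ - e ξ := hχc.sub hec
  have hwk : ∀ {f : Xi → ℝ}, Continuous f → ∀ r ∈ Icc 0 T, Tendsto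
      (fun ε => ∫ ξ, f ξ ∂(ρ ε r : Measure Xi)) l (𝓝 (∫ ξ, f ξ ∂(ρ₀ r : Measure Xi))) :=
    fun hf r hr => ((continuous_integral_finiteMeasure hf).tendsto _).comp (hlim r hr)
  have hconv : Tendsto (fun ε => (∫ ξ, (φ ξ - e ξ) ∂(ρ ε t : Measure Xi)) -
      (∫ ξ, (φ ξ + e ξ) ∂(ρ ε s : Measure Xi)) +
      ∫ r in s..t, ∫ ξ, (χ ξ - e ξ) ∂(ρ ε r : Measure Xi)) l (𝓝 X) := by
    have h1 := ((hwk c1 t ht).sub (hwk c2 s hs)).add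
      (tendsto_integral_curve c3 (hv.mono fun _ h => h.cont) hm hlim hs ht hst)
    refine h1.trans_eq ?_
    congr 1
    rw [integral_sub (hi _ hφc) (hi _ hec), integral_add (hi _ hφc) (hi _ hec), he0 t ht, he0 s hs,
      hφ0, hφ0, hX]
    have : ∫ r in s..t, ∫ ξ, (χ ξ - e ξ) ∂(ρ₀ r : Measure Xi) =
        ∫ r in s..t, (p * (∫ ξ : Xi, (1 + (ξ : ℝ)) ∂(ρ₀ r : Measure Xi)) -
          p' * ∫ ξ : Xi, (1 - (ξ : ℝ)) ∂(ρ₀ r : Measure Xi)) := by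
      refine intervalIntegral.integral_congr fun r hr => ?_
      rw [uIcc_of_le hst] at hr
      rw [integral_sub (hi _ hχc) (hi _ hec), he0 r (hsub hr), hχ0, sub_zero]
    rw [this]
    ring
  have key : ∀ η > 0, ENNReal.ofReal (X - η) ≤
      liminf (fun ε => ∫⁻ r in Ioo s t, diss H ε (ρ ε r) (v ε r)) l := by
    intro η hη
    have hts : 0 ≤ t - s := by linarith
    set δ := η / (2 * (m * (2 + (t - s)) + 1)) with hδ
    have hδ0 : 0 < δ := by positivity
    have hδ1 : δ * m * (2 + (t - s)) ≤ η / 2 := by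
      rw [hδ, div_mul_eq_mul_div, div_mul_eq_mul_div, div_le_iff₀ (by positivity)]
      nlinarith
    refine le_liminf_of_le (by isBoundedDefault) ?_
    filter_upwards [hv, hm, hl (hK δ hδ0), hconv.eventually_const_lt (show X - η / 2 < X by linarith)]
      with ε hvε hmε ⟨α, ψ, hαc, hψc, hd, hest⟩ hXε
    have hψx : Continuous fun ξ : Xi => ψ ξ := hψc.comp continuous_subtype_val
    have hΦx : Continuous fun ξ : Xi => ∫ y in (-1 : ℝ)..ξ, α y :=
      (intervalIntegral.continuous_primitive (fun a b => hαc.intervalIntegrable a b) (-1)).comp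
        continuous_subtype_val
    have i1 : IntervalIntegrable (fun r => ∫ ξ : Xi, v ε r ξ * α ξ ∂(ρ ε r : Measure Xi))
        volume s t := (hvε.intervalIntegrable_mul hT.le hαc).mono_set (by
          rw [uIcc_of_le hst, uIcc_of_le hT.le]; exact hsub)
    have i2 : ∀ {f : Xi → ℝ}, Continuous f → IntervalIntegrable
        (fun r => ∫ ξ, f ξ ∂(ρ ε r : Measure Xi)) volume s t := fun hf =>
      ((continuousOn_integral hvε.cont hf).mono hsub).intervalIntegrable_of_Icc hst
    have hle : ENNReal.ofReal ((∫ r in s..t, ∫ ξ : Xi, v ε r ξ * α ξ ∂(ρ ε r : Measure Xi)) +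
        ∫ r in s..t, ∫ ξ : Xi, ψ ξ ∂(ρ ε r : Measure Xi)) ≤
        ∫⁻ r in Ioo s t, diss H ε (ρ ε r) (v ε r) := by
      rw [← intervalIntegral.integral_add i1 (i2 hψx), intervalIntegral.integral_of_le hst,
        ← restrict_Ioo_eq_restrict_Ioc]
      exact (ofReal_integral_le_lintegral _).trans (setLIntegral_mono' measurableSet_Ioo
        fun r _ => hd (ρ ε r) (v ε r) (hvε.meas.comp measurable_prodMk_left))
    refine le_trans (ENNReal.ofReal_le_ofReal ?_) hle
    -- The continuity equation replaces the flux term by the primitive of α integrated against the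
    -- endpoint measures; no limit of v is needed.
    rw [← hvε.integral_sub hT hαc hs ht]
    have b1 := (integral_sub_le_of_abs_sub_le (μ := ρ ε t) hΦx hφc hec fun ξ => (hest ξ ξ.2).2).1
    have b2 := (integral_sub_le_of_abs_sub_le (μ := ρ ε s) hΦx hφc hec fun ξ => (hest ξ ξ.2).2).2
    rw [hmε t ht] at b1
    rw [hmε s hs] at b2
    have b3 : (∫ r in s..t, ∫ ξ, (χ ξ - e ξ) ∂(ρ ε r : Measure Xi)) - δ * m * (t - s) ≤
        ∫ r in s..t, ∫ ξ : Xi, ψ ξ ∂(ρ ε r : Measure Xi) := by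
      have e3 : δ * m * (t - s) = ∫ _r in s..t, δ * m := by
        rw [intervalIntegral.integral_const, smul_eq_mul, mul_comm]
      rw [e3, ← intervalIntegral.integral_sub (i2 c3) (by simp)]
      refine intervalIntegral.integral_mono_on hst ((i2 c3).sub (by simp)) (i2 hψx)
        fun r hr => ?_
      have := (integral_sub_le_of_abs_sub_le (μ := ρ ε r) hψx hχc hec fun ξ => (hest ξ ξ.2).1).1
      rwa [hmε r (hsub hr)] at this
    linarith
  have hη : Tendsto (fun η : ℝ => ENNReal.ofReal (X - η)) (𝓝[>] 0) (𝓝 (ENNReal.ofReal X)) := by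
    have : Continuous fun η : ℝ => ENNReal.ofReal (X - η) :=
      ENNReal.continuous_ofReal.comp (by fun_prop)
    have h := this.tendsto 0
    rw [sub_zero] at h
    exact h.mono_left nhdsWithin_le_nhds
  exact le_of_tendsto hη (eventually_mem_nhdsWithin.mono fun η h => key η h)

end Limit

end Kramers

/-! ### Duality for the cell problem -/

namespace Kramers

section Duality

/-- `A = ∫ a`, `β₀ = b(-κ)` and `β₁ = b(κ)` for functions with `b' = -(a² + b²) / 2` on
`[-κ, κ]`. -/
def IsCellTest (κ A β₀ β₁ : ℝ) : Prop :=
  ∃ a b c : ℝ → ℝ, Continuous a ∧ Continuous c ∧ (∀ σ, HasDerivAt b (c σ) σ) ∧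
    (∀ σ ∈ Icc (-κ) κ, c σ = -((a σ ^ 2 + b σ ^ 2) / 2)) ∧
    ∫ σ in (-κ)..κ, a σ = A ∧ b (-κ) = β₀ ∧ b κ = β₁

/-- Tests are functions on the whole line: a and b' are extended by constants beyond [-κ, κ], and b
is recovered as a primitive. -/
lemma isCellTest_of_hasDerivAt {κ : ℝ} (hκ : 0 < κ) {a b : ℝ → ℝ} (ha : ContinuousOn a (Icc (-κ) κ))
    (hb : ∀ σ ∈ Icc (-κ) κ, HasDerivAt b (-((a σ ^ 2 + b σ ^ 2) / 2)) σ) :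
    IsCellTest κ (∫ σ in (-κ)..κ, a σ) (b (-κ)) (b κ) := by
  have hle : -κ ≤ κ := by linarith
  have hbc : ContinuousOn b (Icc (-κ) κ) := fun σ hσ => (hb σ hσ).continuousAt.continuousWithinAt
  let a' : ℝ → ℝ := IccExtend hle ((Icc (-κ) κ).domRestrict a)
  let c' : ℝ → ℝ := IccExtend hle ((Icc (-κ) κ).domRestrict fun σ => -((a σ ^ 2 + b σ ^ 2) / 2))
  have hcc : ContinuousOn (fun σ => -((a σ ^ 2 + b σ ^ 2) / 2)) (Icc (-κ) κ) :=
    (((ha.pow 2).add (hbc.pow 2)).div_const 2).neg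
  have ha' : Continuous a' := (continuousOn_iff_continuous_domRestrict.1 ha).Icc_extend'
  have hc' : Continuous c' := (continuousOn_iff_continuous_domRestrict.1 hcc).Icc_extend'
  have ea : ∀ σ ∈ Icc (-κ) κ, a' σ = a σ := fun σ hσ => by
    simp only [a', IccExtend_of_mem hle _ hσ]; rfl
  have ec : ∀ σ ∈ Icc (-κ) κ, c' σ = -((a σ ^ 2 + b σ ^ 2) / 2) := fun σ hσ => by
    simp only [c', IccExtend_of_mem hle _ hσ]; rfl
  let b' : ℝ → ℝ := fun σ => b (-κ) + ∫ s in (-κ)..σ, c' s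
  have eb : ∀ σ ∈ Icc (-κ) κ, b' σ = b σ := fun σ hσ => by
    have h1 : ∫ s in (-κ)..σ, c' s = b σ - b (-κ) := by
      refine intervalIntegral.integral_eq_sub_of_hasDerivAt (fun s hs => ?_)
        (hc'.intervalIntegrable _ _)
      rw [uIcc_of_le hσ.1] at hs
      have hs' : s ∈ Icc (-κ) κ := ⟨hs.1, hs.2.trans hσ.2⟩
      rw [ec s hs']
      exact hb s hs'
    simp only [b', h1]; ring
  refine ⟨a', b', c', ha', hc', fun σ => ?_, fun σ hσ => ?_, ?_, eb _ ⟨le_rfl, hle⟩,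
    eb _ ⟨hle, le_rfl⟩⟩
  · exact (hc'.integral_hasStrictDerivAt (-κ) σ).hasDerivAt.const_add _
  · rw [ec σ hσ, ea σ hσ, eb σ hσ]
  · refine intervalIntegral.integral_congr fun σ hσ => ?_
    rw [uIcc_of_le hle] at hσ
    exact ea σ hσ

/-- There are cell tests with arbitrarily large flux part. -/
lemma exists_isCellTest_ge {κ : ℝ} (hκ : 0 < κ) {L : ℝ} (hL : 0 ≤ L) :
    ∃ A β₀ β₁, L ≤ A ∧ IsCellTest κ A β₀ β₁ ∧ IsCellTest κ (-A) β₀ β₁ := by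
  -- The pair a = 2R/(R² - σ²), b = -2σ/(R² - σ²) solves the cell equation and blows up at ±R with R
  -- = κ + δ. Its integral ∫a = 2 log((2κ + δ)/δ) exceeds L for this δ; the equation contains a only
  -- through a², so -a works with the same b.
  set δ := 2 * κ * Real.exp (-L) with hδ
  have hδ0 : 0 < δ := by positivity
  set R := κ + δ with hR
  have hpos : ∀ σ ∈ Icc (-κ) κ, 0 < R - σ ∧ 0 < R + σ := fun σ hσ =>
    ⟨by linarith [hσ.2], by linarith [hσ.1]⟩
  have hsq : ∀ σ ∈ Icc (-κ) κ, 0 < R ^ 2 - σ ^ 2 := fun σ hσ => by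
    have := mul_pos (hpos σ hσ).1 (hpos σ hσ).2; nlinarith
  let a : ℝ → ℝ := fun σ => 2 * R / (R ^ 2 - σ ^ 2)
  let b : ℝ → ℝ := fun σ => -2 * σ / (R ^ 2 - σ ^ 2)
  have ha : ContinuousOn a (Icc (-κ) κ) :=
    continuousOn_const.div (by fun_prop) fun σ hσ => (hsq σ hσ).ne'
  have hb : ∀ σ ∈ Icc (-κ) κ, HasDerivAt b (-((a σ ^ 2 + b σ ^ 2) / 2)) σ := fun σ hσ => by
    have h := ((hasDerivAt_id σ).const_mul (-2)).div (((hasDerivAt_id σ).pow 2).const_sub (R ^ 2))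
      (hsq σ hσ).ne'
    refine h.congr_deriv ?_
    have := (hsq σ hσ).ne'
    simp only [a, b, Pi.pow_apply, id]
    norm_num
    field_simp
    ring
  have h1 := isCellTest_of_hasDerivAt hκ ha hb
  have h2 := isCellTest_of_hasDerivAt hκ (a := fun σ => -a σ) (b := b) ha.neg
    (by simpa only [neg_sq] using hb)
  rw [intervalIntegral.integral_neg] at h2
  refine ⟨_, _, _, ?_, h1, h2⟩
  have hle : -κ ≤ κ := by linarith
  have hA : ∫ σ in (-κ)..κ, a σ = (Real.log (R + κ) - Real.log (R - κ)) -
      (Real.log (R + -κ) - Real.log (R - -κ)) := by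
    refine intervalIntegral.integral_eq_sub_of_hasDerivAt
      (f := fun σ => Real.log (R + σ) - Real.log (R - σ)) (fun σ hσ => ?_)
      (ha.intervalIntegrable_of_Icc hle)
    rw [uIcc_of_le hle] at hσ
    obtain ⟨h3, h4⟩ := hpos σ hσ
    have h := (((hasDerivAt_id σ).const_add R).log h4.ne').sub
      (((hasDerivAt_id σ).const_sub R).log h3.ne')
    refine h.congr_deriv ?_
    have := (hsq σ hσ).ne'
    simp only [a, id]
    rw [show R ^ 2 - σ ^ 2 = (R + σ) * (R - σ) by ring]
    field_simp
    ring
  have e1 : R - κ = δ := by rw [hR]; ring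
  have e2 : Real.log δ = Real.log (2 * κ) - L := by
    rw [hδ, Real.log_mul (by positivity) (by positivity), Real.log_exp]; ring
  have e3 : Real.log (2 * κ) ≤ Real.log (R + κ) :=
    Real.log_le_log (by positivity) (by rw [hR]; linarith)
  rw [hA, ← sub_eq_add_neg, sub_neg_eq_add, e1, e2]
  linarith

/-- The optimal profile in the cell problem. -/
noncomputable def profile (κ S p q s : ℝ) : ℝ :=
  (p * (κ - s) ^ 2 + q * (κ + s) ^ 2 + 2 * S * (κ ^ 2 - s ^ 2)) / (4 * κ ^ 2)

/-- The derivative of the optimal profile. -/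
noncomputable def profileDeriv (κ S p q s : ℝ) : ℝ :=
  (q * (κ + s) - p * (κ - s) - 2 * S * s) / (2 * κ ^ 2)

lemma hasDerivAt_profile {κ : ℝ} (hκ : κ ≠ 0) (S p q s : ℝ) :
    HasDerivAt (profile κ S p q) (profileDeriv κ S p q s) s := by
  have h := ((((((hasDerivAt_id s).const_sub κ).pow 2).const_mul p).add
    ((((hasDerivAt_id s).const_add κ).pow 2).const_mul q)).add
    ((((hasDerivAt_id s).pow 2).const_sub (κ ^ 2)).const_mul (2 * S))).div_const (4 * κ ^ 2)
  refine h.congr_deriv ?_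
  simp only [profileDeriv, id]
  field_simp
  simp
  ring

lemma hasDerivAt_profileDeriv {κ : ℝ} (hκ : κ ≠ 0) (S p q s : ℝ) :
    HasDerivAt (profileDeriv κ S p q) (((p + q) / 2 - S) / κ ^ 2) s := by
  have h := (((((hasDerivAt_id s).const_add κ).const_mul q).sub
    (((hasDerivAt_id s).const_sub κ).const_mul p)).sub
    ((hasDerivAt_id s).const_mul (2 * S))).div_const (2 * κ ^ 2)
  refine h.congr_deriv ?_
  field_simp
  ring

lemma continuous_profile (κ S p q : ℝ) : Continuous (profile κ S p q) := by
  unfold profile; fun_prop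

lemma continuous_profileDeriv (κ S p q : ℝ) : Continuous (profileDeriv κ S p q) := by
  unfold profileDeriv; fun_prop

/-- The first integral (u'² - w²)/(2u) of the Euler–Lagrange equation of the cell problem, with
constant value u''. It is what fixes S. -/
lemma profileDeriv_sq {κ S p q w : ℝ} (hκ : κ ≠ 0) (hS : S ^ 2 = p * q + κ ^ 2 * w ^ 2) (s : ℝ) :
    profileDeriv κ S p q s ^ 2 = w ^ 2 + 2 * (((p + q) / 2 - S) / κ ^ 2) * profile κ S p q s := by
  have hw : w ^ 2 = (S ^ 2 - p * q) / κ ^ 2 := by rw [hS]; field_simp; ring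
  rw [hw]
  unfold profile profileDeriv
  field_simp
  ring

lemma profile_pos {κ S p q s : ℝ} (hκ : 0 < κ) (hS : 0 ≤ S) (hp : 0 < p) (hq : 0 < q)
    (hs : s ∈ Icc (-κ) κ) : 0 < profile κ S p q s := by
  have h1 : 0 ≤ κ ^ 2 - s ^ 2 := by nlinarith [hs.1, hs.2]
  refine div_pos (add_pos_of_pos_of_nonneg ?_ (by positivity)) (by positivity)
  rcases lt_or_ge s κ with h | h
  · have : 0 < κ - s := by linarith
    positivity
  · have : 0 < κ + s := by linarith
    positivity

lemma profile_neg_end {κ : ℝ} (hκ : κ ≠ 0) (S p q : ℝ) : profile κ S p q (-κ) = p := by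
  unfold profile; field_simp; ring

lemma profile_end {κ : ℝ} (hκ : κ ≠ 0) (S p q : ℝ) : profile κ S p q κ = q := by
  unfold profile; field_simp; ring

lemma isH1_of_hasDerivAt {κ : ℝ} {u u' : ℝ → ℝ} (hu : ∀ s, HasDerivAt u (u' s) s)
    (hu' : Continuous u') : IsH1 (-κ) κ u := by
  have hd : deriv u = u' := funext fun s => (hu s).deriv
  refine ⟨(contDiff_one_iff_deriv.2 ⟨fun s => (hu s).differentiableAt,
    by rwa [hd]⟩).contDiffOn.absolutelyContinuousOnInterval, ?_⟩
  obtain ⟨B, hB⟩ := isCompact_Icc.exists_bound_of_continuousOn (s := Icc (-κ) κ) hu'.continuousOn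
  rw [hd]
  refine MemLp.of_bound hu'.aestronglyMeasurable B ?_
  filter_upwards [ae_restrict_mem measurableSet_Ioo] with s hs
  exact hB s (Ioo_subset_Icc_self hs)

/-- The dissipation of a positive optimal profile is bounded by its cell test. -/
lemma lintegral_profile_le {κ S p q w : ℝ} (hκ : 0 < κ) (hS0 : 0 ≤ S) {δ : ℝ} (hδ : 0 < δ)
    (hp : 0 ≤ p) (hq : 0 ≤ q) (hS : S ^ 2 = (p + δ) * (q + δ) + κ ^ 2 * w ^ 2) {X : ℝ≥0∞}
    (hX : ∀ A β₀ β₁, IsCellTest κ A β₀ β₁ → ENNReal.ofReal (w * A + β₁ * q - β₀ * p) ≤ X) :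
    ∫⁻ s in Ioo (-κ) κ, ENNReal.ofReal ((w ^ 2 + profileDeriv κ S (p + δ) (q + δ) s ^ 2) /
      (2 * profile κ S (p + δ) (q + δ) s)) ≤ X := by
  set u := profile κ S (p + δ) (q + δ) with hu
  set u' := profileDeriv κ S (p + δ) (q + δ) with hu'
  set c := (((p + δ) + (q + δ)) / 2 - S) / κ ^ 2 with hc
  have hle : -κ ≤ κ := by linarith
  have hpos : ∀ s ∈ Icc (-κ) κ, 0 < u s := fun s hs =>
    profile_pos hκ hS0 (by linarith) (by linarith) hs
  have huc : Continuous u := continuous_profile _ _ _ _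
  have huc' : Continuous u' := continuous_profileDeriv _ _ _ _
  have hd : ∀ s, HasDerivAt u (u' s) s := fun s => hasDerivAt_profile hκ.ne' _ _ _ s
  have hd' : ∀ s, HasDerivAt u' c s := fun s => hasDerivAt_profileDeriv hκ.ne' _ _ _ s
  have hode : ∀ s, u' s ^ 2 = w ^ 2 + 2 * c * u s := profileDeriv_sq hκ.ne' hS
  have ha : ContinuousOn (fun s => w / u s) (Icc (-κ) κ) :=
    continuousOn_const.div huc.continuousOn fun s hs => (hpos s hs).ne'
  -- With the first integral, a = w/u and b = u'/u satisfy the cell equation, so the profile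
  -- provides its own test.
  have hb : ∀ s ∈ Icc (-κ) κ, HasDerivAt (fun s => u' s / u s)
      (-(((w / u s) ^ 2 + (u' s / u s) ^ 2) / 2)) s := fun s hs => by
    refine ((hd' s).div (hd s) (hpos s hs).ne').congr_deriv ?_
    have := (hpos s hs).ne'
    field_simp
    linear_combination -hode s
  have ht := hX _ _ _ (isCellTest_of_hasDerivAt hκ ha hb)
  -- Since b decreases, replacing the boundary data p + δ, q + δ by p, q does not lower the value of
  -- the test.
  have hanti : u' κ / u κ ≤ u' (-κ) / u (-κ) := by
    have hcont : ContinuousOn (fun s => u' s / u s) (Icc (-κ) κ) :=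
      huc'.continuousOn.div huc.continuousOn fun s hs => (hpos s hs).ne'
    refine antitoneOn_of_deriv_nonpos (convex_Icc (-κ) κ) hcont (fun s hs => ?_) (fun s hs => ?_)
      ⟨le_rfl, hle⟩ ⟨hle, le_rfl⟩ hle
    · exact (hb s (interior_subset hs)).differentiableAt.differentiableWithinAt
    · rw [(hb s (interior_subset hs)).deriv]
      have : 0 ≤ ((w / u s) ^ 2 + (u' s / u s) ^ 2) / 2 := by positivity
      linarith
  have eκ : u κ = q + δ := profile_end hκ.ne' _ _ _
  have eκ' : u (-κ) = p + δ := profile_neg_end hκ.ne' _ _ _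
  have hint : ContinuousOn (fun s => (w ^ 2 + u' s ^ 2) / (2 * u s)) (Icc (-κ) κ) :=
    (by fun_prop : Continuous fun s => w ^ 2 + u' s ^ 2).continuousOn.div
      (by fun_prop : Continuous fun s => 2 * u s).continuousOn
      fun s hs => (mul_pos two_pos (hpos s hs)).ne'
  -- By the first integral the integrand equals w · (w/u) + u''.
  have hval : ∫ s in (-κ)..κ, (w ^ 2 + u' s ^ 2) / (2 * u s) =
      w * (∫ s in (-κ)..κ, w / u s) + (u' κ - u' (-κ)) := by
    rw [← intervalIntegral.integral_eq_sub_of_hasDerivAt (fun s _ => hd' s)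
      (by simp), ← intervalIntegral.integral_const_mul,
      ← intervalIntegral.integral_add ((ha.intervalIntegrable_of_Icc hle).const_mul w) (by simp)]
    refine intervalIntegral.integral_congr fun s hs => ?_
    rw [uIcc_of_le hle] at hs
    have := (hpos s hs).ne'
    rw [hode s]
    field_simp
    ring
  have e : ∫⁻ s in Ioo (-κ) κ, ENNReal.ofReal ((w ^ 2 + u' s ^ 2) / (2 * u s)) =
      ENNReal.ofReal (∫ s in (-κ)..κ, (w ^ 2 + u' s ^ 2) / (2 * u s)) := by
    rw [intervalIntegral.integral_of_le hle, ← restrict_Ioo_eq_restrict_Ioc,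
      ofReal_integral_eq_lintegral_ofReal]
    · exact hint.integrableOn_Icc.mono_set Ioo_subset_Icc_self
    · filter_upwards [ae_restrict_mem measurableSet_Ioo] with s hs
      have := hpos s (Ioo_subset_Icc_self hs)
      simp only [Pi.zero_apply]
      positivity
  rw [e, hval]
  refine le_trans (ENNReal.ofReal_le_ofReal ?_) ht
  have e1 : u' κ = u' κ / u κ * (q + δ) := by
    rw [← eκ, div_mul_cancel₀ _ (hpos κ ⟨hle, le_rfl⟩).ne']
  have e2 : u' (-κ) = u' (-κ) / u (-κ) * (p + δ) := by
    rw [← eκ', div_mul_cancel₀ _ (hpos (-κ) ⟨le_rfl, hle⟩).ne']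
  set α := u' κ / u κ
  set β := u' (-κ) / u (-κ)
  rw [e1, e2]
  linarith [mul_le_mul_of_nonneg_left hanti hδ.le]

/-- The cell problem is dominated by the supremum over its test functions. -/
lemma M_le_of_forall_cellTest {κ p q w : ℝ} (hκ : 0 < κ) (hp : 0 ≤ p) (hq : 0 ≤ q) {X : ℝ≥0∞}
    (hX : ∀ A β₀ β₁, IsCellTest κ A β₀ β₁ → ENNReal.ofReal (w * A + β₁ * q - β₀ * p) ≤ X) :
    M κ w p q ≤ X := by
  set S : ℝ → ℝ := fun δ => √((p + δ) * (q + δ) + κ ^ 2 * w ^ 2) with hS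
  have hSc : Continuous S := by fun_prop
  have hsq : ∀ s ∈ Icc (-κ) κ, 0 ≤ κ ^ 2 - s ^ 2 := fun s hs => by nlinarith [hs.1, hs.2]
  have hd : ∀ s, HasDerivAt (profile κ (S 0) p q) (profileDeriv κ (S 0) p q s) s := fun s =>
    hasDerivAt_profile hκ.ne' _ _ _ s
  have hnn : ∀ s ∈ Icc (-κ) κ, 0 ≤ profile κ (S 0) p q s := fun s hs => by
    have h1 := hsq s hs
    have h2 : 0 ≤ S 0 := Real.sqrt_nonneg _
    unfold profile
    positivity
  refine (iInf₂_le (profile κ (S 0) p q) ⟨isH1_of_hasDerivAt hd (continuous_profileDeriv _ _ _ _),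
    hnn, profile_neg_end hκ.ne' _ _ _, profile_end hκ.ne' _ _ _⟩).trans ?_
  have hbound : ∀ δ ∈ Ioi (0 : ℝ), ∫⁻ s in Ioo (-κ) κ,
      ENNReal.ofReal ((w ^ 2 + profileDeriv κ (S δ) (p + δ) (q + δ) s ^ 2) /
        (2 * profile κ (S δ) (p + δ) (q + δ) s)) ≤ X := fun δ hδ => by
    have hδ' : (0 : ℝ) < δ := hδ
    exact lintegral_profile_le hκ (Real.sqrt_nonneg _) hδ hp hq (Real.sq_sqrt (by positivity)) hX
  have hmeas : ∀ δ, Measurable fun s =>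
      ENNReal.ofReal ((w ^ 2 + profileDeriv κ (S δ) (p + δ) (q + δ) s ^ 2) /
        (2 * profile κ (S δ) (p + δ) (q + δ) s)) := fun δ => by
    have h1 := (continuous_profileDeriv κ (S δ) (p + δ) (q + δ)).measurable
    have h2 := (continuous_profile κ (S δ) (p + δ) (q + δ)).measurable
    exact (((h1.pow_const 2).const_add _).div (h2.const_mul 2)).ennreal_ofReal
  -- The boundary values may be zero, so the estimate is made for p + δ, q + δ and Fatou's lemma is
  -- used as δ → 0.
  have hF := lintegral_liminf_le (μ := volume.restrict (Ioo (-κ) κ)) (u := 𝓝[>] (0 : ℝ)) hmeas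
  refine le_trans ?_ (hF.trans ?_)
  · refine setLIntegral_mono' measurableSet_Ioo fun s hs => ?_
    have hs' := Ioo_subset_Icc_self hs
    rw [(hd s).deriv]
    have h2 : 0 ≤ S 0 := Real.sqrt_nonneg _
    have hs2 : 0 < κ ^ 2 - s ^ 2 := by nlinarith [hs.1, hs.2]
    have hu0 : 0 ≤ profile κ (S 0) p q s := by unfold profile; positivity
    -- A zero of the limit profile inside the interval forces p = q = w = 0; then both quotients are
    -- 0/0 = 0. Elsewhere the integrand is continuous in δ at 0.
    rcases hu0.eq_or_lt with h0 | hu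
    · have hk1 : 0 < (κ - s) ^ 2 := by have : 0 < κ - s := by linarith [hs.2]
                                       positivity
      have hk2 : 0 < (κ + s) ^ 2 := by have : 0 < κ + s := by linarith [hs.1]
                                       positivity
      have h3 : p * (κ - s) ^ 2 + q * (κ + s) ^ 2 + 2 * S 0 * (κ ^ 2 - s ^ 2) = 0 := by
        unfold profile at h0
        rcases div_eq_zero_iff.1 h0.symm with h | h
        · exact h
        · exact absurd h (by positivity)
      have q1 : 0 ≤ p * (κ - s) ^ 2 := by positivity
      have q2 : 0 ≤ q * (κ + s) ^ 2 := by positivity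
      have q3 : 0 ≤ 2 * S 0 * (κ ^ 2 - s ^ 2) := by positivity
      have hp0 : p = 0 := (mul_eq_zero.1 (by linarith : p * (κ - s) ^ 2 = 0)).resolve_right hk1.ne'
      have hq0 : q = 0 := (mul_eq_zero.1 (by linarith : q * (κ + s) ^ 2 = 0)).resolve_right hk2.ne'
      have hS0 : S 0 = 0 := by
        have := (mul_eq_zero.1 (by linarith : 2 * S 0 * (κ ^ 2 - s ^ 2) = 0)).resolve_right hs2.ne'
        linarith
      have hw : w ^ 2 = 0 := by
        have h4 : (p + 0) * (q + 0) + κ ^ 2 * w ^ 2 ≤ 0 := Real.sqrt_eq_zero'.1 hS0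
        rw [hp0] at h4
        have : κ ^ 2 * w ^ 2 ≤ 0 := by linarith
        nlinarith [sq_nonneg w, pow_pos hκ 2]
      have hu' : profileDeriv κ (S 0) p q s ^ 2 = 0 := by
        unfold profileDeriv; rw [hp0, hq0, hS0]; simp
      rw [hw, hu']
      simp
    · have hcont : ContinuousAt (fun δ => ENNReal.ofReal
          ((w ^ 2 + profileDeriv κ (S δ) (p + δ) (q + δ) s ^ 2) /
          (2 * profile κ (S δ) (p + δ) (q + δ) s))) 0 := by
        refine ENNReal.continuous_ofReal.continuousAt.comp (ContinuousAt.div ?_ ?_ ?_)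
        · unfold profileDeriv; fun_prop
        · unfold profile; fun_prop
        · simp only [add_zero]; positivity
      have hlim := (hcont.tendsto.mono_left (nhdsWithin_le_nhds (s := Ioi 0))).liminf_eq
      rw [hlim]
      simp only [add_zero]
      rw [add_div, ENNReal.ofReal_add (by positivity) (by positivity),
        ENNReal.ofReal_div_of_pos (by positivity), ENNReal.ofReal_div_of_pos (by positivity)]
  · refine (liminf_le_limsup).trans (limsup_le_of_le (by isBoundedDefault) ?_)
    exact eventually_mem_nhdsWithin.mono hbound

end Duality

end Kramers

/-! ### From interval bounds to absolute continuity and a pointwise bound -/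

namespace Kramers

section LimitCurve

variable {κ T m : ℝ} {q : ℝ → ℝ} {D : ℝ → ℝ → ℝ≥0∞}

/-- A curve whose cell tests are dominated by a superadditive function of intervals is absolutely
continuous. -/
lemma absolutelyContinuous_of_cellTest_le (hκ : 0 < κ) (hT : 0 ≤ T)
    (hq : ∀ t ∈ Icc 0 T, q t ∈ Icc 0 (2 * m)) {C : ℝ} (hC : 0 ≤ C)
    (hD : ∀ (n : ℕ) (I : ℕ → ℝ × ℝ), (∀ i < n, 0 ≤ (I i).1 ∧ (I i).1 ≤ (I i).2 ∧ (I i).2 ≤ T) →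
      (Finset.range n : Set ℕ).PairwiseDisjoint (fun i => Ioc (I i).1 (I i).2) →
      ∑ i ∈ Finset.range n, D (I i).1 (I i).2 ≤ ENNReal.ofReal C)
    (htest : ∀ A β₀ β₁, IsCellTest κ A β₀ β₁ → ∀ s ∈ Icc 0 T, ∀ t ∈ Icc 0 T, s ≤ t →
      ENNReal.ofReal (A * (q t - q s) / 2 + ∫ r in s..t, (β₁ * q r - β₀ * (2 * m - q r))) ≤
        D s t) :
    AbsolutelyContinuousOnInterval q 0 T := by
  rw [absolutelyContinuousOnInterval_iff]
  intro η hη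
  -- The flux coefficient A is so large that the dissipation contributes 2C/A < η/2; the tests with
  -- A and -A together bound the increments in both directions.
  obtain ⟨A, β₀, β₁, hA, h1, h2⟩ := exists_isCellTest_ge hκ (L := 4 * C / η + 1) (by positivity)
  have hA0 : 0 < A := lt_of_lt_of_le (by positivity) hA
  have hm : 0 ≤ m := by
    have := hq 0 ⟨le_rfl, hT⟩
    linarith [this.1.trans this.2]
  set B := (|β₀| + |β₁|) * (2 * m) with hB
  have hB0 : 0 ≤ B := by positivity
  have key : ∀ s ∈ Icc 0 T, ∀ t ∈ Icc 0 T, s ≤ t → D s t ≠ ⊤ →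
      |q s - q t| ≤ 2 / A * ((D s t).toReal + B * (t - s)) := by
    intro s hs t ht hst hfin
    have hint : |∫ r in s..t, (β₁ * q r - β₀ * (2 * m - q r))| ≤ B * (t - s) := by
      have := intervalIntegral.norm_integral_le_of_norm_le_const (a := s) (b := t) (C := B)
        (f := fun r => β₁ * q r - β₀ * (2 * m - q r)) fun r hr => by
          rw [uIoc_of_le hst] at hr
          have hr' := hq r ⟨hs.1.trans hr.1.le, hr.2.trans ht.2⟩
          rw [Real.norm_eq_abs]
          refine (abs_sub _ _).trans ?_
          rw [abs_mul, abs_mul, abs_of_nonneg hr'.1, abs_of_nonneg (sub_nonneg.2 hr'.2), hB]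
          nlinarith [abs_nonneg β₀, abs_nonneg β₁, hr'.1, hr'.2]
      rwa [Real.norm_eq_abs, abs_of_nonneg (sub_nonneg.2 hst)] at this
    have hint' := abs_le.1 hint
    have k1 := (ENNReal.ofReal_le_iff_le_toReal hfin).1 (htest _ _ _ h1 s hs t ht hst)
    have k2 := (ENNReal.ofReal_le_iff_le_toReal hfin).1 (htest _ _ _ h2 s hs t ht hst)
    have k3 : A * |q s - q t| ≤ 2 * ((D s t).toReal + B * (t - s)) := by
      have e : A * |q s - q t| = |A * (q s - q t)| := by rw [abs_mul, abs_of_pos hA0]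
      rw [e, abs_le]
      constructor <;> nlinarith
    rw [div_mul_eq_mul_div, le_div_iff₀ hA0]
    linarith
  -- For intervals of this total length the boundary terms contribute at most η/2.
  refine ⟨η * A / (4 * (B + 1)), by positivity, fun E hE hEδ => ?_⟩
  set I : ℕ → ℝ × ℝ := fun i => (min (E.2 i).1 (E.2 i).2, max (E.2 i).1 (E.2 i).2) with hI
  have hmem : ∀ i ∈ Finset.range E.1, (E.2 i).1 ∈ Icc 0 T ∧ (E.2 i).2 ∈ Icc 0 T := fun i hi => by
    have := hE.1 i hi
    rwa [uIcc_of_le hT] at this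
  have hsum := hD E.1 I (fun i hi => by
      obtain ⟨h3, h4⟩ := hmem i (Finset.mem_range.2 hi)
      exact ⟨le_min h3.1 h4.1, min_le_max, max_le h3.2 h4.2⟩) hE.2
  have hfin : ∀ i ∈ Finset.range E.1, D (I i).1 (I i).2 ≠ ⊤ :=
    (ENNReal.sum_ne_top).1 (ne_top_of_le_ne_top ENNReal.ofReal_ne_top hsum)
  have hsum' : ∑ i ∈ Finset.range E.1, (D (I i).1 (I i).2).toReal ≤ C := by
    rw [← ENNReal.toReal_sum hfin]
    exact ENNReal.toReal_le_of_le_ofReal hC hsum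
  have hstep : ∀ i ∈ Finset.range E.1, dist (q (E.2 i).1) (q (E.2 i).2) ≤
      2 / A * ((D (I i).1 (I i).2).toReal + B * dist (E.2 i).1 (E.2 i).2) := by
    intro i hi
    obtain ⟨h3, h4⟩ := hmem i hi
    have hf := hfin i hi
    simp only [hI] at hf ⊢
    rw [Real.dist_eq, Real.dist_eq]
    rcases le_total (E.2 i).1 (E.2 i).2 with h | h
    · rw [min_eq_left h, max_eq_right h] at hf ⊢
      rw [abs_sub_comm (E.2 i).1, abs_of_nonneg (sub_nonneg.2 h)]
      exact key _ h3 _ h4 h hf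
    · rw [min_eq_right h, max_eq_left h] at hf ⊢
      rw [abs_sub_comm (q _), abs_of_nonneg (sub_nonneg.2 h)]
      exact key _ h4 _ h3 h hf
  refine (Finset.sum_le_sum hstep).trans_lt ?_
  rw [← Finset.mul_sum, Finset.sum_add_distrib, ← Finset.mul_sum]
  have e1 : 4 * C ≤ (A - 1) * η := by
    rw [← div_le_iff₀ hη]; linarith
  have e2 : B * ∑ i ∈ Finset.range E.1, dist (E.2 i).1 (E.2 i).2 ≤ η * A / 4 := by
    calc _ ≤ B * (η * A / (4 * (B + 1))) := mul_le_mul_of_nonneg_left hEδ.le hB0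
      _ ≤ (B + 1) * (η * A / (4 * (B + 1))) := by gcongr; linarith
      _ = η * A / 4 := by field_simp
  rw [div_mul_eq_mul_div, div_lt_iff₀ hA0]
  nlinarith

/-- The integrated cell problem of a curve is dominated by any superadditive function of intervals
that dominates its cell tests. -/
lemma lintegral_M_le (hκ : 0 < κ) (hT : 0 ≤ T) (hq : ∀ t ∈ Icc 0 T, q t ∈ Icc 0 (2 * m))
    (hac : AbsolutelyContinuousOnInterval q 0 T)
    (hD : ∀ s ∈ Icc 0 T, ∀ t ∈ Icc 0 T, s ≤ t → D 0 s + D s t ≤ D 0 t) (hfin : D 0 T ≠ ⊤)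
    (htest : ∀ A β₀ β₁, IsCellTest κ A β₀ β₁ → ∀ s ∈ Icc 0 T, ∀ t ∈ Icc 0 T, s ≤ t →
      ENNReal.ofReal (A * (q t - q s) / 2 + ∫ r in s..t, (β₁ * q r - β₀ * (2 * m - q r))) ≤
        D s t) :
    ∫⁻ t in Ioo 0 T, M κ (deriv q t / 2) (2 * m - q t) (q t) ≤ D 0 T := by
  have h0 : (0 : ℝ) ∈ Icc 0 T := ⟨le_rfl, hT⟩
  have hT' : T ∈ Icc 0 T := ⟨hT, le_rfl⟩
  have hle : ∀ s ∈ Icc 0 T, ∀ t ∈ Icc 0 T, s ≤ t → D 0 s ≤ D 0 t := fun s hs t ht hst =>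
    le_self_add.trans (hD s hs t ht hst)
  have hfin' : ∀ t ∈ Icc 0 T, D 0 t ≠ ⊤ := fun t ht =>
    ne_top_of_le_ne_top hfin (hle t ht T hT' ht.2)
  -- N is monotone, hence differentiable almost everywhere with ∫ N' ≤ N(T) - N(0); continuity of N
  -- is not required.
  set N : ℝ → ℝ := fun t => (D 0 t).toReal with hN
  have hNm : MonotoneOn N (Icc 0 T) := fun s hs t ht hst =>
    ENNReal.toReal_mono (hfin' t ht) (hle s hs t ht hst)
  have hNm' : MonotoneOn N (uIcc 0 T) := by rwa [uIcc_of_le hT]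
  have hqc : ContinuousOn q (Icc 0 T) := by simpa [uIcc_of_le hT] using hac.continuousOn
  have hGc : ∀ β₀ β₁, ContinuousOn (fun r => β₁ * q r - β₀ * (2 * m - q r)) (Icc 0 T) :=
    fun β₀ β₁ => (hqc.const_smul β₁).sub ((continuousOn_const.sub hqc).const_smul β₀)
  have hpt : ∀ᵐ t ∂volume.restrict (Ioo 0 T),
      M κ (deriv q t / 2) (2 * m - q t) (q t) ≤ ENNReal.ofReal (deriv N t) := by
    have hd1 : ∀ᵐ t ∂volume.restrict (Ioo 0 T), DifferentiableWithinAt ℝ N (Icc 0 T) t :=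
      ae_restrict_of_ae_restrict_of_subset Ioo_subset_Icc_self 
        (hNm.ae_differentiableWithinAt measurableSet_Icc)
    filter_upwards [ae_restrict_mem measurableSet_Ioo, hd1,
      ae_restrict_of_ae hac.ae_differentiableAt] with t ht hNt hqt
    have ht' := Ioo_subset_Icc_self ht
    have hnhds : Icc 0 T ∈ 𝓝 t := Icc_mem_nhds ht.1 ht.2
    have hqd := (hqt (by rwa [uIcc_of_le hT])).hasDerivAt
    have hNd := (hNt.differentiableAt hnhds).hasDerivAt
    refine M_le_of_forall_cellTest hκ (by linarith [(hq t ht').2]) (hq t ht').1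
      fun A β₀ β₁ hA => ENNReal.ofReal_le_ofReal ?_
    have hG := hGc β₀ β₁
    set G : ℝ → ℝ := fun r => β₁ * q r - β₀ * (2 * m - q r) with hGdef
    have hGi : ∀ s ∈ Icc 0 T, ∀ t ∈ Icc 0 T, IntervalIntegrable G volume s t := fun s hs t ht =>
      (hG.mono (uIcc_subset_Icc hs ht)).intervalIntegrable
    have hId : HasDerivAt (fun s => ∫ r in 0..s, G r) (G t) t :=
      intervalIntegral.integral_hasDerivAt_right (hGi 0 h0 t ht')
        ((hG.mono Ioo_subset_Icc_self).stronglyMeasurableAtFilter isOpen_Ioo t ht)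
        (hG.continuousAt hnhds)
    -- Superadditivity with the test on [r, s] gives monotonicity, and the derivative at t is the
    -- pointwise bound. The null set of excluded times depends on N and q only, so all tests are
    -- available at the same t.
    have hmono : MonotoneOn (fun s => N s - (A * q s / 2 + ∫ r in 0..s, G r)) (Icc 0 T) := by
      intro r hr s hs hrs
      have k0 := hD r hr s hs hrs
      have k1 := htest A β₀ β₁ hA r hr s hs hrs
      have hrs_fin : D r s ≠ ⊤ := ne_top_of_le_ne_top (hfin' s hs) (le_add_self.trans k0)
      have k2 := (ENNReal.ofReal_le_iff_le_toReal hrs_fin).1 k1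
      have k3 := ENNReal.toReal_mono (hfin' s hs) k0
      rw [ENNReal.toReal_add (hfin' r hr) hrs_fin] at k3
      have k4 := intervalIntegral.integral_add_adjacent_intervals (hGi 0 h0 r hr) (hGi r hr s hs)
      simp only [hN]
      linarith
    have hder : HasDerivAt (fun s => N s - (A * q s / 2 + ∫ r in 0..s, G r))
        (deriv N t - (A * deriv q t / 2 + G t)) t :=
      hNd.sub (((hqd.const_mul A).div_const 2).add hId)
    have := hmono.derivWithin_nonneg (x := t)
    rw [derivWithin_of_mem_nhds hnhds, hder.deriv] at this
    simp only [hGdef] at this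
    linarith
  refine (lintegral_mono_ae hpt).trans ?_
  have hNi := hNm'.intervalIntegrable_deriv
  rw [← ofReal_integral_eq_lintegral_ofReal
    ((intervalIntegrable_iff_integrableOn_Ioo_of_le hT).1 hNi)]
  · have := hNm'.intervalIntegral_deriv_mem_uIcc
    have hN0 : N 0 ≤ N T := hNm h0 hT' hT
    rw [uIcc_of_le (sub_nonneg.2 hN0), intervalIntegral.integral_of_le hT,
      ← restrict_Ioo_eq_restrict_Ioc] at this
    refine (ENNReal.ofReal_le_ofReal this.2).trans (ENNReal.ofReal_le_of_le_toReal ?_)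
    have : 0 ≤ N 0 := ENNReal.toReal_nonneg
    simp only [hN] at *
    linarith
  · filter_upwards [ae_restrict_mem measurableSet_Ioo] with t ht
    have := hNm.derivWithin_nonneg (x := t)
    rwa [derivWithin_of_mem_nhds (Icc_mem_nhds ht.1 ht.2)] at this

end LimitCurve

end Kramers

/-! ### Lower bounds for dissipation and free energy -/

namespace Kramers

section LowerBound

variable {H : ℝ → ℝ} {T : ℝ} {l : Filter ℝ} {ρ : ℝ → ℝ → FiniteMeasure Xi}
  {ρ₀ : ℝ → FiniteMeasure Xi} {v : ℝ → ℝ → Xi → ℝ} {m : ℝ≥0}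

lemma liminf_add_liminf_le {ι : Type*} {f : Filter ι} (F G : ι → ℝ≥0∞) :
    liminf F f + liminf G f ≤ liminf (fun x => F x + G x) f := by
  rw [liminf_eq_iSup_iInf (u := F), liminf_eq_iSup_iInf (u := G)]
  refine ENNReal.biSup_add_biSup_le' ⟨univ, univ_mem⟩ ⟨univ, univ_mem⟩ fun s hs t ht => ?_
  refine le_liminf_of_le (by isBoundedDefault) ?_
  filter_upwards [hs, ht] with x hxs hxt
  exact add_le_add (iInf₂_le x hxs) (iInf₂_le x hxt)

lemma sum_liminf_le {ι : Type*} {f : Filter ι} (s : Finset ℕ) (F : ℕ → ι → ℝ≥0∞) :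
    ∑ i ∈ s, liminf (F i) f ≤ liminf (fun x => ∑ i ∈ s, F i x) f := by
  classical
  rcases f.eq_or_neBot with rfl | _
  · simp [liminf_bot]
  induction s using Finset.induction_on with
  | empty => simp
  | insert i s hi ih =>
    simp only [Finset.sum_insert hi]
    exact (add_le_add_right ih _).trans (liminf_add_liminf_le _ _)

lemma integral_one_add_add_integral_one_sub (μ : FiniteMeasure Xi) :
    (∫ ξ : Xi, (1 + (ξ : ℝ)) ∂(μ : Measure Xi)) + ∫ ξ : Xi, (1 - (ξ : ℝ)) ∂(μ : Measure Xi) =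
      2 * μ.mass := by
  rw [← integral_add (integrable_of_continuous _ (by fun_prop))
    (integrable_of_continuous _ (by fun_prop))]
  have e : ∀ ξ : Xi, 1 + (ξ : ℝ) + (1 - ξ) = 2 := fun ξ => by ring
  simp only [e, integral_const, smul_eq_mul]
  rw [mul_comm]; rfl

lemma integral_one_add_mem {μ : FiniteMeasure Xi} (hμ : μ.mass = m) :
    ∫ ξ : Xi, (1 + (ξ : ℝ)) ∂(μ : Measure Xi) ∈ Icc (0 : ℝ) (2 * m) := by
  have h1 : 0 ≤ ∫ ξ : Xi, (1 + (ξ : ℝ)) ∂(μ : Measure Xi) :=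
    integral_nonneg fun ξ => by simp only [Pi.zero_apply]; linarith [ξ.2.1]
  have h2 : 0 ≤ ∫ ξ : Xi, (1 - (ξ : ℝ)) ∂(μ : Measure Xi) :=
    integral_nonneg fun ξ => by simp only [Pi.zero_apply]; linarith [ξ.2.2]
  have h3 := integral_one_add_add_integral_one_sub μ
  rw [hμ] at h3
  exact ⟨h1, by linarith⟩

/-- The lower bound for the dissipation along a filter with bounded dissipation. -/
lemma J0_le (hH : IsDoubleWell H) (hT : 0 < T) [NeBot l]
    [l.IsCountablyGenerated] (hl : l ≤ 𝓝[>] 0) (hv : ∀ᶠ ε in l, SolvesCE T (ρ ε) (v ε))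
    (hm : ∀ᶠ ε in l, ∀ t ∈ Icc 0 T, (ρ ε t).mass = m) (hm₀ : ∀ t ∈ Icc 0 T, (ρ₀ t).mass = m)
    (hlim : ∀ t ∈ Icc 0 T, Tendsto (fun ε => ρ ε t) l (𝓝 (ρ₀ t)))
    (hconc : ∀ t ∈ Icc 0 T, ∫ ξ : Xi, (1 - (ξ : ℝ) ^ 2) ∂(ρ₀ t : Measure Xi) = 0)
    {c : ℝ≥0∞} (hc : c ≠ ⊤) (hd : ∀ᶠ ε in l, ∫⁻ t in Ioo 0 T, diss H ε (ρ ε t) (v ε t) ≤ c) :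
    J0 H T ρ₀ ≤ c := by
  set q : ℝ → ℝ := fun t => ∫ ξ : Xi, (1 + (ξ : ℝ)) ∂(ρ₀ t : Measure Xi) with hq
  have hp : ∀ t ∈ Icc 0 T, ∫ ξ : Xi, (1 - (ξ : ℝ)) ∂(ρ₀ t : Measure Xi) = 2 * m - q t :=
    fun t ht => by
      have := integral_one_add_add_integral_one_sub (ρ₀ t)
      rw [hm₀ t ht] at this
      simp only [hq]; linarith
  have hqm : ∀ t ∈ Icc 0 T, q t ∈ Icc (0 : ℝ) (2 * m) := fun t ht =>
    integral_one_add_mem (hm₀ t ht)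
  -- Half-open intervals are disjoint when adjacent, and their unions are exact; the lower limit
  -- keeps superadditivity.
  set D : ℝ → ℝ → ℝ≥0∞ := fun s t =>
    liminf (fun ε => ∫⁻ r in Ioc s t, diss H ε (ρ ε r) (v ε r)) l with hD
  have htest : ∀ A β₀ β₁, IsCellTest (kap H) A β₀ β₁ → ∀ s ∈ Icc 0 T, ∀ t ∈ Icc 0 T, s ≤ t →
      ENNReal.ofReal (A * (q t - q s) / 2 + ∫ r in s..t, (β₁ * q r - β₀ * (2 * m - q r))) ≤
        D s t := by
    rintro A β₀ β₁ ⟨a, b, c, ha, hc, hb, hcell, rfl, rfl, rfl⟩ s hs t ht hst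
    have := ofReal_cellTest_le_liminf hH hT hl hv hm hlim hconc ha hc hb hcell hs ht hst
    simp only [restrict_Ioo_eq_restrict_Ioc] at this
    rw [show (∫ r in s..t, (b (kap H) * q r - b (-kap H) * (2 * m - q r))) =
      ∫ r in s..t, (b (kap H) * q r -
        b (-kap H) * ∫ ξ : Xi, (1 - (ξ : ℝ)) ∂(ρ₀ r : Measure Xi)) from
      intervalIntegral.integral_congr fun r hr => by
        rw [uIcc_of_le hst] at hr
        simp only [hp r ⟨hs.1.trans hr.1, hr.2.trans ht.2⟩]]
    exact this
  have hD0 : D 0 T ≤ c := by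
    refine liminf_le_of_frequently_le' (hd.frequently.mono fun ε hε => ?_)
    rwa [← restrict_Ioo_eq_restrict_Ioc]
  have hDn : ∀ (n : ℕ) (I : ℕ → ℝ × ℝ),
      (∀ i < n, 0 ≤ (I i).1 ∧ (I i).1 ≤ (I i).2 ∧ (I i).2 ≤ T) →
      (Finset.range n : Set ℕ).PairwiseDisjoint (fun i => Ioc (I i).1 (I i).2) →
      ∑ i ∈ Finset.range n, D (I i).1 (I i).2 ≤ D 0 T := by
    intro n I hI hdis
    refine (sum_liminf_le _ _).trans (liminf_le_liminf (Eventually.of_forall fun ε => ?_))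
    rw [← lintegral_biUnion_finset hdis fun _ _ => measurableSet_Ioc]
    refine lintegral_mono_set (iUnion₂_subset fun i hi => ?_)
    obtain ⟨h1, -, h2⟩ := hI i (Finset.mem_range.1 hi)
    exact Ioc_subset_Ioc h1 h2
  have hDadd : ∀ s ∈ Icc 0 T, ∀ t ∈ Icc 0 T, s ≤ t → D 0 s + D s t ≤ D 0 t := by
    intro s hs t ht hst
    refine (liminf_add_liminf_le _ _).trans (liminf_le_liminf (Eventually.of_forall fun ε => ?_))
    rw [← lintegral_union measurableSet_Ioc (Ioc_disjoint_Ioc_of_le le_rfl),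
      Ioc_union_Ioc_eq_Ioc hs.1 hst]
  have hac : AbsolutelyContinuousOnInterval q 0 T := by
    refine absolutelyContinuous_of_cellTest_le hH.kap_pos hT.le hqm (C := c.toReal)
      ENNReal.toReal_nonneg (fun n I hI hdis => ?_) htest
    rw [ENNReal.ofReal_toReal hc]
    exact (hDn n I hI hdis).trans hD0
  have hac' : AbsolutelyContinuousOnInterval (fun t => 2 * (m : ℝ) - q t) 0 T := by
    have h1 : AbsolutelyContinuousOnInterval (fun _ : ℝ => 2 * (m : ℝ)) 0 T :=
      (contDiff_const.contDiffOn (n := 1)).absolutelyContinuousOnInterval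
    exact h1.sub hac
  have hcurve : IsLimitCurve T ρ₀ (fun t => 2 * m - q t) q (fun t => deriv q t / 2) := by
    refine ⟨fun t ht => ⟨by linarith [(hqm t ht).2], (hqm t ht).1⟩, fun t ht => ?_, hac', hac,
      Eventually.of_forall fun t => ⟨rfl, ?_⟩⟩
    · rw [eq_dirac_add_dirac (hconc t ht), hp t ht]
    · rw [deriv_const_sub]; ring
  refine le_trans (iInf_le_of_le _ (iInf_le_of_le _ (iInf_le_of_le _ (iInf_le_of_le hcurve le_rfl)))) ?_
  exact (lintegral_M_le hH.kap_pos hT.le hqm hac hDadd (ne_top_of_le_ne_top hc hD0) htest).trans hD0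

/-- The graph of u log u lies above its tangent at c. -/
lemma mul_log_ge {u c : ℝ} (hu : 0 ≤ u) (hc : 0 < c) :
    u * (Real.log c + 1) - c ≤ u * Real.log u := by
  rcases hu.eq_or_lt with rfl | hu
  · simp [hc.le]
  have h := Real.log_le_sub_one_of_pos (show 0 < c / u by positivity)
  rw [Real.log_div hc.ne' hu.ne'] at h
  have : u * (Real.log c - Real.log u) ≤ u * (c / u - 1) := by gcongr
  rw [mul_sub, mul_sub, mul_div_cancel₀ _ hu.ne'] at this
  linarith

/-- The free energy of a combination of the two wells. -/
lemma freeEnergy_gam0_le {μ : FiniteMeasure Xi} {p q : ℝ} (hp : 0 ≤ p) (hq : 0 ≤ q)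
    (hμ : (μ : Measure Xi) = ENNReal.ofReal (p / 2) • Measure.dirac leftWell
      + ENNReal.ofReal (q / 2) • Measure.dirac rightWell) :
    freeEnergy gam0 μ ≤ (((p * Real.log p + q * Real.log q) / 2 -
      μ.mass * Real.log μ.mass : ℝ) : EReal) := by
  classical
  have hne : rightWell ≠ leftWell := fun h => by
    have := congrArg Subtype.val h
    norm_num [leftWell, rightWell] at this
  have hfin0 : IsFiniteMeasure gam0 := by
    unfold gam0
    have h1 : IsFiniteMeasure ((2⁻¹ : ℝ≥0∞) • Measure.dirac leftWell) :=
      Measure.smul_finite _ (by simp)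
    have h2 : IsFiniteMeasure ((2⁻¹ : ℝ≥0∞) • Measure.dirac rightWell) :=
      Measure.smul_finite _ (by simp)
    infer_instance
  let f : Xi → ℝ≥0∞ := fun ξ => if ξ = leftWell then ENNReal.ofReal p else ENNReal.ofReal q
  have hf : Measurable f := Measurable.ite (measurableSet_singleton _) measurable_const measurable_const
  have hhalf : ∀ x : ℝ, ENNReal.ofReal (x / 2) = 2⁻¹ * ENNReal.ofReal x := fun x => by
    rw [ENNReal.ofReal_div_of_pos two_pos, ENNReal.div_eq_inv_mul]; simp
  have hwd : (μ : Measure Xi) = gam0.withDensity f := by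
    rw [hμ, gam0, withDensity_add_measure, withDensity_smul_measure, withDensity_smul_measure,
      dirac_withDensity, dirac_withDensity, smul_smul, smul_smul, hhalf, hhalf]
    simp only [f, if_pos, if_neg hne]
  have hac : (μ : Measure Xi) ≪ gam0 := by
    rw [hwd]; exact withDensity_absolutelyContinuous _ _
  have hdens : dens gam0 μ =ᵐ[gam0] fun ξ => (f ξ).toReal := by
    have : (μ : Measure Xi).rnDeriv gam0 =ᵐ[gam0] f := by
      rw [hwd]; exact Measure.rnDeriv_withDensity _ hf
    filter_upwards [this] with ξ hξ
    rw [dens, hξ]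
  have hint : ∀ F : Xi → ℝ, Integrable F gam0 ∧
      ∫ ξ, F ξ ∂gam0 = (F leftWell + F rightWell) / 2 := fun F => by
    have i1 : Integrable F ((2⁻¹ : ℝ≥0∞) • Measure.dirac leftWell) :=
      (integrable_dirac (by simp)).smul_measure (by simp)
    have i2 : Integrable F ((2⁻¹ : ℝ≥0∞) • Measure.dirac rightWell) :=
      (integrable_dirac (by simp)).smul_measure (by simp)
    refine ⟨i1.add_measure i2, ?_⟩
    rw [gam0, integral_add_measure i1 i2, integral_smul_measure, integral_smul_measure,
      integral_dirac, integral_dirac]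
    simp
    ring
  have hcongr : (fun ξ => dens gam0 μ ξ * Real.log (dens gam0 μ ξ)) =ᵐ[gam0]
      fun ξ => (f ξ).toReal * Real.log (f ξ).toReal := by
    filter_upwards [hdens] with ξ hξ
    rw [hξ]
  rw [freeEnergy, if_pos ⟨hac, (hint _).1.congr hcongr.symm⟩, integral_congr_ae hcongr, (hint _).2]
  simp only [f, if_pos, if_neg hne, ENNReal.toReal_ofReal hp, ENNReal.toReal_ofReal hq]
  exact le_rfl

/-- The lower bound for the free energies. -/
lemma freeEnergy_le_liminf (hH : IsDoubleWell H) [NeBot l] (hl : l ≤ 𝓝[>] 0)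
    {μ : ℝ → FiniteMeasure Xi} {μ₀ : FiniteMeasure Xi} (hm : ∀ᶠ ε in l, (μ ε).mass = m)
    (hm₀ : μ₀.mass = m) (hμ : Tendsto μ l (𝓝 μ₀))
    (hconc : ∫ ξ : Xi, (1 - (ξ : ℝ) ^ 2) ∂(μ₀ : Measure Xi) = 0) :
    freeEnergy gam0 μ₀ ≤ liminf (fun ε => freeEnergy (gam H ε) (μ ε)) l := by
  set q : ℝ := ∫ ξ : Xi, (1 + (ξ : ℝ)) ∂(μ₀ : Measure Xi) with hq
  set p : ℝ := ∫ ξ : Xi, (1 - (ξ : ℝ)) ∂(μ₀ : Measure Xi) with hp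
  have hq0 : 0 ≤ q := integral_nonneg fun ξ => by simp only [Pi.zero_apply]; linarith [ξ.2.1]
  have hp0 : 0 ≤ p := integral_nonneg fun ξ => by simp only [Pi.zero_apply]; linarith [ξ.2.2]
  have heq := eq_dirac_add_dirac hconc
  refine (freeEnergy_gam0_le hp0 hq0 heq).trans ?_
  rw [hm₀]
  set E := (p * Real.log p + q * Real.log q) / 2 - (m : ℝ) * Real.log m with hE
  have hint : ∀ F : Xi → ℝ, ∫ ξ, F ξ ∂(μ₀ : Measure Xi) =
      p / 2 * F leftWell + q / 2 * F rightWell := fun F => by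
    rw [heq, integral_add_measure ((integrable_dirac (by simp)).smul_measure (by simp))
      ((integrable_dirac (by simp)).smul_measure (by simp)),
      integral_smul_measure, integral_smul_measure, integral_dirac, integral_dirac, smul_eq_mul,
      smul_eq_mul, ENNReal.toReal_ofReal (by positivity), ENNReal.toReal_ofReal (by positivity)]
  have key : ∀ δ > 0, ((E - 2 * δ : ℝ) : EReal) ≤
      liminf (fun ε => freeEnergy (gam H ε) (μ ε)) l := by
    intro δ hδ
    -- A continuous interpolation of the limit densities at the wells, raised by δ. The maximum
    -- keeps c positive on all of ℝ and is inactive at ±1.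
    let c : ℝ → ℝ := fun x => max δ (((p + δ) * (1 - x) + (q + δ) * (1 + x)) / 2)
    have hc : Continuous c := by fun_prop
    have hcpos : ∀ x, 0 < c x := fun x => lt_of_lt_of_le hδ (le_max_left _ _)
    have hlc : Continuous fun x => Real.log (c x) + 1 :=
      (hc.log fun x => (hcpos x).ne').add continuous_const
    have hlcx : Continuous fun ξ : Xi => Real.log (c ξ) + 1 := hlc.comp continuous_subtype_val
    have hcx : Continuous fun ξ : Xi => c ξ := hc.comp continuous_subtype_val
    have hc1 : c 1 = q + δ := by
      simp only [c]; rw [max_eq_right] <;> linarith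
    have hc2 : c (-1) = p + δ := by
      simp only [c]; rw [max_eq_right] <;> linarith
    have h1 : Tendsto (fun ε => ∫ ξ : Xi, (Real.log (c ξ) + 1) ∂(μ ε : Measure Xi)) l
        (𝓝 (∫ ξ : Xi, (Real.log (c ξ) + 1) ∂(μ₀ : Measure Xi))) :=
      ((continuous_integral_finiteMeasure hlcx).tendsto μ₀).comp hμ
    have h2 := (tendsto_integral_gam hH hc).mono_left hl
    have h3 := (h1.sub h2).sub_const ((m : ℝ) * Real.log m)
    rw [hint] at h3
    simp only [leftWell, rightWell, hc1, hc2] at h3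
    have hlog : ∀ {x : ℝ}, 0 ≤ x → x * Real.log x ≤ x * Real.log (x + δ) := fun {x} hx => by
      rcases hx.eq_or_lt with rfl | hx
      · simp
      · gcongr; linarith
    -- The loss is at most δ, as x log(x + δ) ≥ x log x; the factor 2 leaves room for a strict
    -- inequality.
    have h4 : E - 2 * δ < p / 2 * (Real.log (p + δ) + 1) + q / 2 * (Real.log (q + δ) + 1) -
        (p + δ + (q + δ)) / 2 - m * Real.log m := by
      have := hlog hp0
      have := hlog hq0
      rw [hE]
      linarith
    refine le_liminf_of_le (by isBoundedDefault) ?_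
    filter_upwards [hm, h3.eventually_const_lt h4] with ε hmε hε
    unfold freeEnergy
    split_ifs with h
    · rw [hmε, EReal.coe_le_coe_iff]
      have := isProbabilityMeasure_gam hH.continuous ε
      have i1 : Integrable (fun ξ : Xi => dens (gam H ε) (μ ε) ξ * (Real.log (c ξ) + 1))
          (gam H ε) := (integrable_rnDeriv_smul_iff h.1).2 (integrable_of_continuous _ hlcx)
      have i2 : Integrable (fun ξ : Xi => c ξ) (gam H ε) := integrable_of_continuous _ hcx
      have h5 : (∫ ξ : Xi, (Real.log (c ξ) + 1) ∂(μ ε : Measure Xi)) - ∫ ξ : Xi, c ξ ∂gam H ε ≤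
          ∫ ξ, dens (gam H ε) (μ ε) ξ * Real.log (dens (gam H ε) (μ ε) ξ) ∂gam H ε := by
        rw [integral_eq_integral_dens hH.continuous h.1, ← integral_sub i1 i2]
        exact integral_mono (i1.sub i2) h.2 fun ξ => mul_log_ge (dens_nonneg _ _ _) (hcpos ξ)
      linarith
    · exact le_top
  have hlim : Tendsto (fun δ : ℝ => ((E - 2 * δ : ℝ) : EReal)) (𝓝[>] 0) (𝓝 (E : EReal)) := by
    have : Continuous fun δ : ℝ => ((E - 2 * δ : ℝ) : EReal) :=
      continuous_coe_real_ereal.comp (by fun_prop)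
    have h := this.tendsto 0
    rw [mul_zero, sub_zero] at h
    exact h.mono_left nhdsWithin_le_nhds
  exact le_of_tendsto hlim (eventually_mem_nhdsWithin.mono fun δ h => key δ h)

end LowerBound

end Kramers

/-! ### Main theorem -/

theorem mainTheorem3
    (H : ℝ → ℝ) (hH : Kramers.IsDoubleWell H)
    (T : ℝ) (hT : 0 < T)
    (Λ : Set ℝ) (hΛpos : Λ ⊆ Ioi 0) (hΛ0 : (0 : ℝ) ∈ closure Λ)
    (ρ : ℝ → ℝ → FiniteMeasure Kramers.Xi) (ρ₀ : ℝ → FiniteMeasure Kramers.Xi)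
    (m C : ℝ≥0)
    (hcont : ∀ ε ∈ Λ, ContinuousOn (ρ ε) (Icc 0 T))
    (hac : ∀ ε ∈ Λ, ∀ t ∈ Icc 0 T,
      (ρ ε t : Measure Kramers.Xi) ≪ Kramers.gam H ε)
    (hmass : ∀ ε ∈ Λ, ∀ t ∈ Icc 0 T, (ρ ε t).mass = m)
    (hE : ∀ ε ∈ Λ, Kramers.freeEnergy (Kramers.gam H ε) (ρ ε 0) ≤ ((C : ℝ) : EReal))
    (hJ : ∀ ε ∈ Λ, Kramers.J H T ε (ρ ε) ≤ (C : ℝ≥0∞))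
    (hlim : ∀ t ∈ Icc 0 T, Tendsto (fun ε => ρ ε t) (𝓝[Λ] 0) (𝓝 (ρ₀ t))) :
    Kramers.J0 H T ρ₀ ≤ liminf (fun ε => Kramers.J H T ε (ρ ε)) (𝓝[Λ] 0) ∧
    ∀ t ∈ Icc 0 T,
      Kramers.freeEnergy Kramers.gam0 (ρ₀ t) ≤
        liminf (fun ε => Kramers.freeEnergy (Kramers.gam H ε) (ρ ε t)) (𝓝[Λ] 0) := by
  have hne : NeBot (𝓝[Λ] (0 : ℝ)) := mem_closure_iff_nhdsWithin_neBot.1 hΛ0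
  have hle : 𝓝[Λ] (0 : ℝ) ≤ 𝓝[>] 0 := nhdsWithin_mono _ hΛpos
  have hΛ : ∀ᶠ ε in 𝓝[Λ] (0 : ℝ), ε ∈ Λ := eventually_mem_nhdsWithin
  have hm : ∀ᶠ ε in 𝓝[Λ] (0 : ℝ), ∀ t ∈ Icc 0 T, (ρ ε t).mass = m := hΛ.mono hmass
  have hm₀ : ∀ t ∈ Icc 0 T, (ρ₀ t).mass = m := fun t ht =>
    tendsto_nhds_unique ((FiniteMeasure.continuous_mass.tendsto _).comp (hlim t ht))
      (tendsto_const_nhds.congr' (hm.mono fun ε hε => (hε t ht).symm))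
  have h0 : (0 : ℝ) ∈ Icc 0 T := ⟨le_rfl, hT.le⟩
  have hconc : ∀ t ∈ Icc 0 T,
      ∫ ξ : Kramers.Xi, (1 - (ξ : ℝ) ^ 2) ∂(ρ₀ t : Measure Kramers.Xi) = 0 := by
    intro t ht
    -- The first term bounds the initial regularized entropy, the second one the growth along the
    -- averages. The bound C + 1 allows the choice of a velocity without attaining the infimum in
    -- `J`.
    set R : ℝ≥0∞ := ENNReal.ofReal (C + m * Real.log m + 1) + ENNReal.ofReal 3 * (C + 1) with hR
    have hRfin : R ≠ ⊤ := by simp [hR, ENNReal.mul_eq_top]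
    refine Kramers.integral_one_sub_sq_eq_zero hH hle (hlim t ht) (K := R.toReal) ?_
    filter_upwards [hΛ] with ε hε f hf hf0
    obtain ⟨v, hv, hvJ⟩ : ∃ v, Kramers.SolvesCE T (ρ ε) v ∧
        ∫⁻ t in Ioo 0 T, Kramers.diss H ε (ρ ε t) (v t) < C + 1 := by
      have h1 : Kramers.J H T ε (ρ ε) < C + 1 := (hJ ε hε).trans_lt
        (ENNReal.lt_add_right ENNReal.coe_ne_top one_ne_zero)
      simp only [Kramers.J, iInf_lt_iff, exists_prop] at h1
      exact h1
    rw [← ENNReal.ofReal_le_iff_le_toReal hRfin]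
    refine (hv.ofReal_integral_sub_le hH hT (hac ε hε) (hmass ε hε) ht hf hf0).trans
      (add_le_add ?_ (mul_le_mul' le_rfl hvJ.le))
    have := Kramers.regEntropy_le_of_freeEnergy_le hH.continuous (hE ε hε)
    rwa [hmass ε hε 0 h0] at this
  refine ⟨?_, fun t ht => Kramers.freeEnergy_le_liminf hH hle (hm.mono fun ε hε => hε t ht)
    (hm₀ t ht) (hlim t ht) (hconc t ht)⟩
  -- For c above the lower limit, the filter is restricted to those ε with `J` < c; it stays
  -- nontrivial, and all convergences persist.
  refine le_of_forall_gt_imp_ge_of_dense fun c hc => ?_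
  rcases eq_or_ne c ⊤ with rfl | hctop
  · exact le_top
  have hfreq : ∃ᶠ ε in 𝓝[Λ] (0 : ℝ), Kramers.J H T ε (ρ ε) < c :=
    frequently_lt_of_liminf_lt (by isBoundedDefault) hc
  have hne' : NeBot (𝓝[Λ] (0 : ℝ) ⊓ 𝓟 {ε | Kramers.J H T ε (ρ ε) < c}) :=
    frequently_mem_iff_neBot.1 hfreq
  have hv : ∀ ε, ∃ v, Kramers.J H T ε (ρ ε) < c → Kramers.SolvesCE T (ρ ε) v ∧
      ∫⁻ t in Ioo 0 T, Kramers.diss H ε (ρ ε t) (v t) < c := by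
    intro ε
    by_cases h : Kramers.J H T ε (ρ ε) < c
    · have h' := h
      simp only [Kramers.J, iInf_lt_iff, exists_prop] at h'
      obtain ⟨v, hv⟩ := h'
      exact ⟨v, fun _ => hv⟩
    · exact ⟨fun _ _ => 0, fun h' => absurd h' h⟩
  choose v hv using hv
  have hmem : ∀ᶠ ε in 𝓝[Λ] (0 : ℝ) ⊓ 𝓟 {ε | Kramers.J H T ε (ρ ε) < c},
      Kramers.J H T ε (ρ ε) < c := mem_inf_of_right (mem_principal_self _)
  exact Kramers.J0_le hH hT (inf_le_left.trans hle) (hmem.mono fun ε h => (hv ε h).1)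
    (hm.filter_mono inf_le_left) hm₀ (fun t ht => (hlim t ht).mono_left inf_le_left) hconc hctop
    (hmem.mono fun ε h => (hv ε h).2.le)
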